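/- Let $\gamma>1$ and $a\in\mathbb{R}\setminus\{0\}$ be constants, put $\bar\gamma=\frac{\gamma-1}{2}$ and, for $\varepsilon,\delta>0$, $\nu=\frac{\delta}{\bar\gamma\varepsilon}$. Fix one choice of the sign $\pm$ and let $$p(\xi)=a\Big(\sqrt{|\xi|^2+\nu^2+2\nu\xi_3}\pm\sqrt{|\xi|^2+\nu^2-2\nu\xi_3}\Big),\qquad \xi\in\mathbb{R}^3 .$$ Let $\tilde\varphi\in\mathcal{S}(\mathbb{R}^3)$ be a radial function with $0\le\tilde\varphi\le1$, $\operatorname{supp}\tilde\varphi\subset\{\frac12\le|\xi|\le3\}$ and $\tilde\varphi=1$ on $\{\frac34\le|\xi|\le\frac83\}$. For $k\in\mathbb{Z}$ let $\tilde\varphi_k(\xi)=\tilde\varphi(2^{-k}\xi)$ and, for $f\in L^{\rho}(\mathbb{R}^3)$ with $1\le\rho\le2$ and Fourier transform $\hat f$ (normalized as $\hat f(\xi)=\int e^{-ix\cdot\xi}f(x)\,dx$), $$\Lambda_k(t)f(x)=\frac{1}{(2\pi)^3}\int_{\mathbb{R}^3}e^{ix\cdot\xi+i\frac{t}{\delta}p(\xi)}\,\tilde\varphi_k^2(\xi)\,\hat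 f(\xi)\,d\xi ,\qquad \mathcal{M}_k=\begin{cases}1, & k\ge\log_2\frac{\nu}{60},\\ \nu^3/2^{3k}, & k<\log_2\frac{\nu}{60}.\end{cases}$$ Write $L^q_tL^r_x=L^q(\mathbb{R};L^r(\mathbb{R}^3))$. Let $r,\tilde r,q,\tilde q$ satisfy $$2\le r,\tilde r\le\infty,\quad 4\le q\le\infty,\quad \frac2q\le\frac12\Big(1-\frac2r\Big),\quad \frac2{\tilde q}=\frac12\Big(1-\frac2{\tilde r}\Big),$$ and let $\tilde r',\tilde q'$ be the conjugate exponents, $\frac1{\tilde r}+\frac1{\tilde r'}=1$, $\frac1{\tilde q}+\frac1{\tilde q'}=1$. Then there is a constant $C>0$, independent of $\varepsilon,\delta,k,f,F$, such that for all $\varepsilon>0$, $\delta>0$, $k\in\mathbb{Z}$, $f\in L^2(\mathbb{R}^3)$ and $F\in L^{\tilde q'}(\mathbb{R};L^{\tilde r'}(\mathbb{R}^3))$, $$\|\Lambda_k(t)f\|_{L^q_tL^r_x}\le C\,2^{3k(\frac12-\frac1r)}(\mathcal{M}_k\varepsilon)^{\frac1q}\|f\|_{L^2(\mathbb{R}^3)},$$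 and the integral below converges absolutely for all $t$ and $x$, with $$\bigg\|\int_{-\infty}^t\Lambda_k(t-s)F(s)\,ds\bigg\|_{L^q_tL^r_x}\le C\,2^{3k(\frac12+\frac2{\tilde q}-\frac1r)}(\mathcal{M}_k\varepsilon)^{\frac1q+\frac1{\tilde q}}\|F\|_{L^{\tilde q'}_tL^{\tilde r'}_x}.$$ In particular the left-hand functions belong to $L^q_tL^r_x$. -/

import Mathlib

open MeasureTheory Set
open scoped ENNReal SchwartzMap FourierTransform

noncomputable section

namespace RotatingEuler

/-- Three-dimensional Euclidean space. -/
abbrev E3 : Type := EuclideanSpace ℝ (Fin 3)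

/-- The part of `f` where `|f| > 1`; it is integrable whenever `f ∈ L^p` with `1 ≤ p ≤ 2`. -/
def largePart (f : E3 → ℂ) : E3 → ℂ := {x | 1 < ‖f x‖}.indicator f

/-- The part of `f` where `|f| ≤ 1`; it is square integrable whenever `f ∈ L^p` with
`1 ≤ p ≤ 2`. -/
def smallPart (f : E3 → ℂ) : E3 → ℂ := {x | ‖f x‖ ≤ 1}.indicator f

open Classical in
/-- The Plancherel Fourier transform of a square integrable function, in Mathlib's normalization
`∫ exp (-2πi x·ξ) f x dx` (and `0` if `f` is not square integrable). -/
def plancherel (f : E3 → ℂ) : E3 → ℂ :=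
  if h : MemLp f 2 volume then ((𝓕 (h.toLp f) : Lp ℂ 2 (volume : Measure E3)) : E3 → ℂ) else 0

/-- The Fourier transform `f̂ ξ = ∫ exp (-i x·ξ) f x dx` on `L¹ + L²`, in particular on `L^p` for
`1 ≤ p ≤ 2`: the integral for the `L¹` part, Plancherel's extension for the `L²` part.
The factor `(2π)⁻¹` in the argument converts from Mathlib's normalization. -/
def fourierHat (f : E3 → ℂ) (ξ : E3) : ℂ :=
  𝓕 (largePart f) ((2 * Real.pi)⁻¹ • ξ) + plancherel (smallPart f) ((2 * Real.pi)⁻¹ • ξ)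

/-- The parameter `ν = δ / (γ̄ ε)` with `γ̄ = (γ - 1) / 2`. -/
def nu (γ ε δ : ℝ) : ℝ := δ / ((γ - 1) / 2 * ε)

/-- The phase `a (√(|ξ|² + ν² + 2νξ₃) ± √(|ξ|² + ν² - 2νξ₃))`, the sign being `s`. -/
def phase (a s ν : ℝ) (ξ : E3) : ℝ :=
  a * (√(‖ξ‖ ^ 2 + ν ^ 2 + 2 * ν * ξ 2) + s * √(‖ξ‖ ^ 2 + ν ^ 2 - 2 * ν * ξ 2))

/-- The conditions on the cut-off function: radial, with values in `[0, 1]`, supported in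
`1/2 ≤ |ξ| ≤ 3` and equal to `1` on `3/4 ≤ |ξ| ≤ 8/3`. -/
structure IsCutoff (φ : 𝓢(E3, ℝ)) : Prop where
  radial : ∀ ξ η : E3, ‖ξ‖ = ‖η‖ → φ ξ = φ η
  nonneg : ∀ ξ, 0 ≤ φ ξ
  le_one : ∀ ξ, φ ξ ≤ 1
  support_subset : tsupport φ ⊆ {ξ | 1 / 2 ≤ ‖ξ‖ ∧ ‖ξ‖ ≤ 3}
  eq_one : ∀ ξ : E3, 3 / 4 ≤ ‖ξ‖ → ‖ξ‖ ≤ 8 / 3 → φ ξ = 1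

/-- The frequency-localized propagator
`Λ_k(t) f x = (2π)⁻³ ∫ exp (i x·ξ + i (t/δ) p ξ) φ(2⁻ᵏ ξ)² f̂ ξ dξ` for a phase `p`. -/
def Lam (φ : 𝓢(E3, ℝ)) (p : E3 → ℝ) (δ : ℝ) (k : ℤ) (t : ℝ) (f : E3 → ℂ) (x : E3) : ℂ :=
  (1 / (2 * Real.pi) ^ 3 : ℝ) *
    ∫ ξ : E3, Complex.exp (Complex.I * ((inner ℝ x ξ + t / δ * p ξ : ℝ) : ℂ)) *
      ((φ ((2 : ℝ) ^ (-k) • ξ) ^ 2 : ℝ) : ℂ) * fourierHat f ξ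

/-- The factor `𝓜_k`. -/
def calM (ν : ℝ) (k : ℤ) : ℝ :=
  if Real.logb 2 (ν / 60) ≤ k then 1 else ν ^ 3 / (2 : ℝ) ^ (3 * k)

theorem memLp_largePart {p : ℝ≥0∞} (hp : 1 ≤ p) (hp2 : p ≤ 2) {f : E3 → ℂ}
    (hf : MemLp f p volume) : MemLp (largePart f) 1 volume := by
  have hpt : p ≠ ∞ := ne_top_of_le_ne_top (by simp) hp2
  have hp0 : p ≠ 0 := (lt_of_lt_of_le one_pos hp).ne'
  have hs : NullMeasurableSet {x | 1 < ‖f x‖} (volume : Measure E3) :=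
    nullMeasurableSet_lt aemeasurable_const hf.1.norm.aemeasurable
  have h1 : MemLp (largePart f) p volume := by
    refine hf.mono (hf.1.indicator₀ hs) (Filter.Eventually.of_forall fun x => ?_)
    exact norm_indicator_le_norm_self f x
  refine h1.mono_exponent_of_measure_support_ne_top (s := {x | 1 < ‖f x‖})
    (fun x hx => indicator_of_notMem hx f) ?_ hp
  refine ((measure_mono ?_).trans_lt (hf.meas_ge_lt_top hp0 hpt (ε := 1) one_ne_zero)).ne
  intro x hx
  have hx' : 1 < ‖f x‖ := hx
  have : (1 : ℝ) ≤ ‖f x‖ := hx'.le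
  exact_mod_cast this

theorem memLp_smallPart {p : ℝ≥0∞} (hp : 1 ≤ p) (hp2 : p ≤ 2) {f : E3 → ℂ}
    (hf : MemLp f p volume) : MemLp (smallPart f) 2 volume := by
  have hpt : p ≠ ∞ := ne_top_of_le_ne_top (by simp) hp2
  have hp0 : p ≠ 0 := (lt_of_lt_of_le one_pos hp).ne'
  have hs : NullMeasurableSet {x | ‖f x‖ ≤ 1} (volume : Measure E3) :=
    nullMeasurableSet_le hf.1.norm.aemeasurable aemeasurable_const
  refine ⟨hf.1.indicator₀ hs, ?_⟩
  have hfin := (eLpNorm_lt_top_iff_lintegral_rpow_enorm_lt_top hp0 hpt).1 hf.2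
  rw [eLpNorm_lt_top_iff_lintegral_rpow_enorm_lt_top (by simp) (by simp)]
  refine lt_of_le_of_lt (lintegral_mono fun x => ?_) hfin
  by_cases hx : ‖f x‖ ≤ 1
  · have hx' : smallPart f x = f x := indicator_of_mem (show x ∈ {x | ‖f x‖ ≤ 1} from hx) f
    have hle : ‖f x‖ₑ ≤ 1 := by
      rw [← ofReal_norm]
      exact ENNReal.ofReal_le_one.2 hx
    simp only [hx']
    exact ENNReal.rpow_le_rpow_of_exponent_ge hle
      (ENNReal.toReal_mono (by simp) hp2)
  · have hx' : smallPart f x = 0 := indicator_of_notMem (show x ∉ {x | ‖f x‖ ≤ 1} from hx) f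
    simp [hx']

end RotatingEuler

end

open RotatingEuler

noncomputable section

namespace RotatingEuler

/-! ### A second derivative test for oscillatory integrals -/

/-! The operator `Λ_k(t)` is convolution with a kernel, and both estimates follow from two facts
about that kernel. It is bounded by `N`, a multiple of `2^{3k}`, and it decays like `N
(T/|t|)^{1/2}` with `T = 𝓜_k ε`.

Dispersion. Rescaling `ξ = 2^k η` turns the phase into a multiple of `|η + μe₃| ± |η - μe₃|` on a
fixed annulus, with `μ = 2^{-k} ν`. Its Hessian may be degenerate, but its Hilbert-Schmidt norm is
at least a constant times `μ/(4+μ)³`. For the sign `+` the trace shows this; for the sign `-` the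
entries cannot all be small at once (`regHess_diff_lower`). A Hessian bounded below in norm only is
enough for the decay `|t|^{-1/2}` (`norm_integral_exp_mul_le`). The integration by parts is along
`∇Φ/(|∇Φ|² + Λ)`, and the remainder is controlled by terms `H²/(G² + Λ)`, which come from the
derivative of an arctangent. This costs one derivative of the amplitude and third derivatives of the
phase in `L¹` only. At the conical points `±μe₃` the third derivatives grow like the inverse square
of the distance, which is integrable in three dimensions. Hence the phase can be smoothed at scale
`κ` with bounds uniform in `κ`, and then `κ → 0`. The factor `𝓜_k` enters through `(4+μ)³ ≤ 64³
𝓜_k`.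

Strichartz. The `TT*` argument with the Hardy-Littlewood-Sobolev inequality for `|t|^{-1/2}`, which
pairs `L^{4/3}` with itself, gives the endpoint `L⁴L^∞`. The supremum in space is linearized by a
measurable choice of a point `ξ(t)`, so that the dual object is a superposition of plane waves
(`eLpNorm_superpose_le`, `lintegral_iSup_pow_four_le`). Plancherel gives `L^∞L²`, and Cauchy-Schwarz
on the compact frequency support gives `L^∞L^∞`. The inequality `‖v‖_r ≤ ‖v‖_2^{2/r} ‖v‖_∞^{1-2/r}`
at each time then yields every pair with `4/q ≤ 1 - 2/r` (`exists_Lp_of_bounds`).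

Retarded term. The same three bounds are proved for `∫_{s ≤ t}` by duality. After Fubini the cutoff
`s ≤ t` acts on the coefficients of the test superposition. Restricting these does not increase the
norms used, so the truncation costs nothing (`enorm_integral_mul_retarded_le`,
`lintegral_supNorm_retarded_le`). -/

theorem integral_eq_zero_of_hasLineDerivAt {F F' : E3 → ℂ} {v : E3} (hF : Continuous F)
    (hF' : Continuous F') (hc : HasCompactSupport F) (hc' : HasCompactSupport F')
    (h : ∀ x, HasLineDerivAt ℝ F (F' x) x v) : ∫ x, F' x = 0 := by
  have := integral_bilinear_hasLineDerivAt_right_eq_neg_left_of_integrable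
    (μ := (volume : Measure E3)) (f := fun _ : E3 => (1 : ℂ)) (f' := fun _ => (0 : ℂ))
    (g := F) (g' := F') (v := v) (B := ContinuousLinearMap.mul ℝ ℂ)
    (by simp) (by simpa using hF'.integrable_of_hasCompactSupport hc')
    (by simpa using hF.integrable_of_hasCompactSupport hc)
    (fun x _ => by simpa [HasLineDerivAt] using hasDerivAt_const (0 : ℝ) (1 : ℂ))
    (fun x _ => h x)
  simpa using this

theorem integral_eq_zero_of_hasLineDerivAt_real {F F' : E3 → ℝ} {v : E3} (hF : Continuous F)
    (hF' : Continuous F') (hc : HasCompactSupport F) (hc' : HasCompactSupport F')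
    (h : ∀ x, HasLineDerivAt ℝ F (F' x) x v) : ∫ x, F' x = 0 := by
  have := integral_bilinear_hasLineDerivAt_right_eq_neg_left_of_integrable
    (μ := (volume : Measure E3)) (f := fun _ : E3 => (1 : ℝ)) (f' := fun _ => (0 : ℝ))
    (g := F) (g' := F') (v := v) (B := ContinuousLinearMap.mul ℝ ℝ)
    (by simp) (by simpa using hF'.integrable_of_hasCompactSupport hc')
    (by simpa using hF.integrable_of_hasCompactSupport hc)
    (fun x _ => by simpa [HasLineDerivAt] using hasDerivAt_const (0 : ℝ) (1 : ℝ))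
    (fun x _ => h x)
  simpa using this

/-- The weight `ψ H² / (G² + Λ)` has integral `O(Λ^{-1/2})` because `H / (G² + Λ)` is a multiple
of the derivative of the bounded function `arctan (G / √Λ)`. -/
theorem integral_sq_div_le {v : E3} {ψ dψ G H T : E3 → ℝ} {Λ : ℝ} (hΛ : 0 < Λ)
    (cψ : Continuous ψ) (cdψ : Continuous dψ) (cG : Continuous G) (cH : Continuous H)
    (cT : Continuous T) (sψ : HasCompactSupport ψ) (sdψ : HasCompactSupport dψ)
    (hψ0 : ∀ x, 0 ≤ ψ x)
    (dG : ∀ x, HasLineDerivAt ℝ G (H x) x v) (dH : ∀ x, HasLineDerivAt ℝ H (T x) x v)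
    (hdψ : ∀ x, HasLineDerivAt ℝ ψ (dψ x) x v) :
    ∫ x, ψ x * H x ^ 2 / (G x ^ 2 + Λ) ≤
      Real.pi / 2 / √Λ * ∫ x, (|T x| * ψ x + |H x| * |dψ x|) := by
  set h := √Λ with hh
  have hpos : 0 < h := Real.sqrt_pos.2 hΛ
  have hsq : h ^ 2 = Λ := Real.sq_sqrt hΛ.le
  set A : E3 → ℝ := fun x => Real.arctan (G x / h)
  have cA : Continuous A := Real.continuous_arctan.comp (cG.div_const h)
  have hne : ∀ x, G x ^ 2 + Λ ≠ 0 := fun x => by positivity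
  have cQ : Continuous fun x => ψ x * H x ^ 2 / (G x ^ 2 + Λ) := by fun_prop (disch := simpa using hne)
  have cR : Continuous fun x => (dψ x * H x + ψ x * T x) * A x := by fun_prop
  have sQ : HasCompactSupport fun x => ψ x * H x ^ 2 / (G x ^ 2 + Λ) := by
    simp only [div_eq_mul_inv, mul_assoc]; exact sψ.mul_right
  have sR : HasCompactSupport fun x => (dψ x * H x + ψ x * T x) * A x :=
    (sdψ.mul_right.add sψ.mul_right).mul_right
  -- This is the integral of the derivative of `ψ H arctan(G/√Λ)`. Differentiating the arctangent
  -- produces `√Λ` times the wanted weight, and the other two terms carry an arctangent bounded by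
  -- `π/2`.
  have key : ∫ x, ((dψ x * H x + ψ x * T x) * A x + h * (ψ x * H x ^ 2 / (G x ^ 2 + Λ))) = 0 := by
    refine integral_eq_zero_of_hasLineDerivAt_real (F := fun x => ψ x * H x * A x) (v := v)
      (by fun_prop) (cR.add (cQ.const_smul h)) sψ.mul_right.mul_right
      (sR.add (sQ.mul_left)) fun x => ?_
    have h1 := ((hdψ x).mul (dH x)).mul (((dG x).div_const h).arctan)
    refine h1.congr_deriv ?_
    simp only [zero_smul, add_zero, A, Pi.mul_apply]
    have : 1 + (G x / h) ^ 2 ≠ 0 := by positivity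
    have h2 := hne x
    rw [← hsq] at h2 ⊢
    field_simp
    ring
  rw [integral_add (cR.integrable_of_hasCompactSupport sR)
    ((cQ.integrable_of_hasCompactSupport sQ).const_mul h), integral_const_mul] at key
  have hb : |∫ x, (dψ x * H x + ψ x * T x) * A x| ≤
      Real.pi / 2 * ∫ x, (|T x| * ψ x + |H x| * |dψ x|) := by
    rw [← integral_const_mul, ← Real.norm_eq_abs]
    refine norm_integral_le_of_norm_le ?_ (Filter.Eventually.of_forall fun x => ?_)
    · refine Integrable.const_mul (Continuous.integrable_of_hasCompactSupport (by fun_prop) ?_) _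
      exact (sψ.mul_left).add (HasCompactSupport.mul_left (sdψ.comp_left (g := abs) abs_zero))
    · rw [norm_mul, Real.norm_eq_abs, Real.norm_eq_abs, mul_comm]
      refine mul_le_mul ?_ ?_ (abs_nonneg _) (by positivity)
      · exact abs_le.2 ⟨by simpa [A] using (Real.neg_pi_div_two_lt_arctan _).le,
          (Real.arctan_lt_pi_div_two _).le⟩
      · refine (abs_add_le _ _).trans ?_
        rw [abs_mul, abs_mul, abs_of_nonneg (hψ0 x)]
        linarith [mul_comm |dψ x| |H x|, mul_comm (ψ x) |T x|]
  rw [div_mul_eq_mul_div, le_div_iff₀ hpos]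
  linarith [neg_abs_le (∫ x, (dψ x * H x + ψ x * T x) * A x), mul_comm h (∫ x, ψ x * H x ^ 2 / (G x ^ 2 + Λ))]

/-- This is the pointwise bound on what the integration by parts leaves over. By AM-GM, `|G j|/S ≤
1/(2√Λ)` for `S = |G|² + Λ`. The derivatives of `G j/S` cost at most `3 Σ|H|/S`. Where `ψ ≠ 0` the
lower bound on the Hessian allows both `Λ` and `Σ|H|` to be absorbed into `ΣH²/Λ`. -/
theorem remainder_le {dψ G : Fin 3 → ℝ} {H : Fin 3 → Fin 3 → ℝ} {ψ h Λ : ℝ} (hpos : 0 < h)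
    (hsq : h ^ 2 = Λ) (hψ : 0 ≤ ψ) (hlow : ψ ≠ 0 → Λ ^ 2 ≤ ∑ i, ∑ j, H i j ^ 2) :
    ψ * (Λ / (∑ j, G j ^ 2 + Λ)) + ∑ j, |dψ j * (G j / (∑ j, G j ^ 2 + Λ))
      + ψ * (H j j / (∑ j, G j ^ 2 + Λ))
      - ψ * (G j * (∑ i, 2 * G i * H j i) / (∑ j, G j ^ 2 + Λ) ^ 2)| ≤
    (∑ j, |dψ j|) * (1 / (2 * h)) + 10 / Λ * ∑ i, ∑ j, ψ * H i j ^ 2 / (G j ^ 2 + Λ) := by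
  have hΛ : 0 < Λ := by rw [← hsq]; positivity
  have hGj : ∀ j, G j ^ 2 ≤ ∑ j, G j ^ 2 := fun j =>
    Finset.single_le_sum (f := fun j => G j ^ 2) (fun i _ => sq_nonneg _) (Finset.mem_univ j)
  set S := ∑ j, G j ^ 2 + Λ with hS
  have hSΛ : ∀ j, G j ^ 2 + Λ ≤ S := fun j => by linarith [hGj j]
  have hS0 : 0 < S := lt_of_lt_of_le (by positivity) (hSΛ 0)
  have hterm : ∀ j, |dψ j * (G j / S) + ψ * (H j j / S)
      - ψ * (G j * (∑ i, 2 * G i * H j i) / S ^ 2)| ≤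
      |dψ j| * (1 / (2 * h)) + ψ / S * (3 * ∑ i, |H j i|) := by
    intro j
    have h1 : |dψ j * (G j / S)| ≤ |dψ j| * (1 / (2 * h)) := by
      rw [abs_mul]
      refine mul_le_mul_of_nonneg_left ?_ (abs_nonneg _)
      rw [abs_div, abs_of_pos hS0, div_le_div_iff₀ hS0 (by positivity)]
      nlinarith [hSΛ j, sq_nonneg (|G j| - h), sq_abs (G j)]
    have h2 : |ψ * (H j j / S)| ≤ ψ / S * ∑ i, |H j i| := by
      rw [abs_mul, abs_div, abs_of_pos hS0, abs_of_nonneg hψ, mul_div_assoc', mul_div_right_comm]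
      refine mul_le_mul_of_nonneg_left ?_ (by positivity)
      exact Finset.single_le_sum (f := fun i => |H j i|) (fun i _ => abs_nonneg _)
        (Finset.mem_univ j)
    have h3 : |ψ * (G j * (∑ i, 2 * G i * H j i) / S ^ 2)| ≤ ψ / S * (2 * ∑ i, |H j i|) := by
      have h4 : |G j * (∑ i, 2 * G i * H j i)| ≤ S * (2 * ∑ i, |H j i|) := by
        rw [Finset.mul_sum, Finset.mul_sum, Finset.mul_sum]
        refine (Finset.abs_sum_le_sum_abs _ _).trans (Finset.sum_le_sum fun i _ => ?_)
        have : |G j * (2 * G i * H j i)| = |G j| * |G i| * (2 * |H j i|) := by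
          simp only [abs_mul, abs_two]; ring
        rw [this]
        refine mul_le_mul_of_nonneg_right ?_ (by positivity)
        nlinarith [hSΛ j, hSΛ i, sq_nonneg (|G j| - |G i|), sq_abs (G j), sq_abs (G i)]
      rw [abs_mul, abs_div, abs_of_nonneg hψ, abs_of_pos (pow_pos hS0 2), div_mul_eq_mul_div,
        mul_div_assoc]
      refine mul_le_mul_of_nonneg_left ?_ hψ
      rw [div_le_div_iff₀ (by positivity) hS0]
      nlinarith
    have := (abs_sub _ _).trans (add_le_add ((abs_add_le _ _).trans (add_le_add h1 h2)) h3)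
    linarith
  have hsum := Finset.sum_le_sum fun j (_ : j ∈ Finset.univ) => hterm j
  rw [Finset.sum_add_distrib, ← Finset.sum_mul, ← Finset.mul_sum, ← Finset.mul_sum] at hsum
  -- The constant is `10 = 1 + 9`: the term `Λ/S` costs `1`, and the Hessian terms cost `3 · 3`, the
  -- second `3` coming from `hamgm`.
  have hmain : ψ * (Λ / S) + ψ / S * (3 * ∑ j, ∑ i, |H j i|) ≤
      10 / Λ * (ψ / S * ∑ i, ∑ j, H i j ^ 2) := by
    rcases hψ.eq_or_lt with h0 | h0
    · simp [← h0]
    have hl := hlow h0.ne'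
    have hamgm : ∑ j, ∑ i, |H j i| ≤ 3 / Λ * ∑ i, ∑ j, H i j ^ 2 := by
      -- AM-GM with weights chosen so that the nine constants `Λ/6` add up to `3Λ/2`, which is at
      -- most `3/(2Λ)` times `ΣH²`.
      have h5 : ∀ i j, |H i j| ≤ 3 / (2 * Λ) * H i j ^ 2 + Λ / 6 := fun i j => by
        rw [← sq_abs (H i j)]
        have : 3 / (2 * Λ) * |H i j| ^ 2 + Λ / 6 - |H i j|
            = 3 / (2 * Λ) * (|H i j| - Λ / 3) ^ 2 := by field_simp; ring
        have h6 : 0 ≤ 3 / (2 * Λ) * (|H i j| - Λ / 3) ^ 2 := by positivity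
        linarith
      have h7 := Finset.sum_le_sum fun i (_ : i ∈ Finset.univ) =>
        Finset.sum_le_sum fun j (_ : j ∈ Finset.univ) => h5 i j
      refine h7.trans ?_
      simp only [Finset.sum_add_distrib, ← Finset.mul_sum, Finset.sum_const, Finset.card_univ,
        Fintype.card_fin, nsmul_eq_mul]
      set Q := ∑ i, ∑ j, H i j ^ 2
      have : 3 / Λ * Q - (3 / (2 * Λ) * Q + (3 : ℕ) * ((3 : ℕ) * (Λ / 6)))
          = 3 / (2 * Λ) * (Q - Λ ^ 2) := by push_cast; field_simp; ring
      have h8 : 0 ≤ 3 / (2 * Λ) * (Q - Λ ^ 2) := mul_nonneg (by positivity) (by linarith)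
      linarith
    set Q := ∑ i, ∑ j, H i j ^ 2
    have e1 : ψ * (Λ / S) ≤ 1 / Λ * (ψ / S * Q) := by
      have : 1 / Λ * (ψ / S * Q) - ψ * (Λ / S) = ψ / S * (1 / Λ) * (Q - Λ ^ 2) := by
        field_simp
      have h8 : 0 ≤ ψ / S * (1 / Λ) * (Q - Λ ^ 2) := mul_nonneg (by positivity) (by linarith)
      linarith
    have e2 : ψ / S * (3 * ∑ j, ∑ i, |H j i|) ≤ ψ / S * (3 * (3 / Λ * Q)) := by gcongr
    have e3 : ψ / S * (3 * (3 / Λ * Q)) = 9 / Λ * (ψ / S * Q) := by ring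
    have e4 : 10 / Λ * (ψ / S * Q) = 1 / Λ * (ψ / S * Q) + 9 / Λ * (ψ / S * Q) := by ring
    linarith
  have hfin : ψ / S * ∑ i, ∑ j, H i j ^ 2 ≤ ∑ i, ∑ j, ψ * H i j ^ 2 / (G j ^ 2 + Λ) := by
    rw [Finset.mul_sum]
    refine Finset.sum_le_sum fun i _ => ?_
    rw [Finset.mul_sum]
    refine Finset.sum_le_sum fun j _ => ?_
    rw [div_mul_eq_mul_div]
    exact div_le_div_of_nonneg_left (by positivity) (by positivity) (hSΛ j)
  have := mul_le_mul_of_nonneg_left hfin (show 0 ≤ 10 / Λ by positivity)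
  linarith

/-- Integration by parts with the vector field `ψ ∇Φ/(|∇Φ|² + Λ)` recovers the integral up to a
remainder bounded by first derivatives of `ψ` and by the weights `ψ H²/(G² + Λ)`, whose integrals
are `O(Λ^{-1/2})` after use of `hB`. No entry of the Hessian has to be singled out: only the sum of
squares is bounded below, and which entry is large may vary with the point. -/
theorem norm_integral_exp_mul_le (e : Fin 3 → E3) {Φ ψ : E3 → ℝ} {G dψ : Fin 3 → E3 → ℝ}
    {H T : Fin 3 → Fin 3 → E3 → ℝ} {Λ B : ℝ} (hΛ : 0 < Λ)
    (cΦ : Continuous Φ) (cψ : Continuous ψ) (cdψ : ∀ i, Continuous (dψ i))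
    (cG : ∀ i, Continuous (G i)) (cH : ∀ i j, Continuous (H i j))
    (cT : ∀ i j, Continuous (T i j)) (sψ : HasCompactSupport ψ)
    (sdψ : ∀ i, HasCompactSupport (dψ i)) (hψ0 : ∀ x, 0 ≤ ψ x)
    (dΦ : ∀ i x, HasLineDerivAt ℝ Φ (G i x) x (e i))
    (dG : ∀ i j x, HasLineDerivAt ℝ (G j) (H i j x) x (e i))
    (dH : ∀ i j x, HasLineDerivAt ℝ (H i j) (T i j x) x (e i))
    (hdψ : ∀ i x, HasLineDerivAt ℝ ψ (dψ i x) x (e i))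
    (hlow : ∀ x, ψ x ≠ 0 → Λ ^ 2 ≤ ∑ i, ∑ j, H i j x ^ 2)
    (hB : ∑ i, ∑ j, ∫ x, (|T i j x| * ψ x + |H i j x| * |dψ i x|) ≤ B * Λ) :
    ‖∫ x, Complex.exp (Complex.I * (Φ x : ℂ)) * (ψ x : ℂ)‖ ≤
      ((∑ j, ∫ x, |dψ j x|) + 20 * B) / √Λ := by
  set h := √Λ with hh
  have hpos : 0 < h := Real.sqrt_pos.2 hΛ
  have hsq : h ^ 2 = Λ := Real.sq_sqrt hΛ.le
  set S : E3 → ℝ := fun x => ∑ j, G j x ^ 2 + Λ with hS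
  have cS : Continuous S := by fun_prop
  have hG2 : ∀ x, 0 ≤ ∑ j, G j x ^ 2 := fun x => Finset.sum_nonneg fun j _ => sq_nonneg _
  have hSpos : ∀ x, 0 < S x := fun x => by have := hG2 x; simp only [hS]; positivity
  have hSne : ∀ x, S x ≠ 0 := fun x => (hSpos x).ne'
  have dS : ∀ j x, HasLineDerivAt ℝ S (∑ i, 2 * G i x * H j i x) x (e j) := by
    intro j x
    have : HasDerivAt (fun t : ℝ => ∑ i, G i (x + t • e j) ^ 2 + Λ)
        (∑ i, 2 * G i (x + (0 : ℝ) • e j) * H j i x) 0 := by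
      refine HasDerivAt.add_const _ (HasDerivAt.fun_sum fun i _ => ?_)
      have := (show HasDerivAt (fun t : ℝ => G i (x + t • e j)) (H j i x) 0 from dG j i x).fun_pow 2
      exact this.congr_deriv (by simp)
    simpa [HasLineDerivAt, hS] using this
  -- the remainder of the integration by parts in the direction `e j`
  set R : Fin 3 → E3 → ℝ := fun j x => dψ j x * (G j x / S x) + ψ x * (H j j x / S x)
    - ψ x * (G j x * (∑ i, 2 * G i x * H j i x) / S x ^ 2) with hR
  have cR : ∀ j, Continuous (R j) := fun j => by
    simp only [hR]; fun_prop (disch := simpa using hSne)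
  have sR : ∀ j, HasCompactSupport (R j) := fun j =>
    ((sdψ j).mul_right.add sψ.mul_right).sub sψ.mul_right
  set E : E3 → ℂ := fun x => Complex.exp (Complex.I * (Φ x : ℂ)) with hE
  have cE : Continuous E := by fun_prop
  have nE : ∀ x, ‖E x‖ = 1 := fun x => by
    simp only [hE]; rw [mul_comm]; exact Complex.norm_exp_ofReal_mul_I _
  have dE : ∀ j x, HasLineDerivAt ℝ E (E x * (Complex.I * (G j x : ℂ))) x (e j) := by
    intro j x
    have h1 := ((HasDerivAt.ofReal_comp (dΦ j x)).const_mul Complex.I).cexp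
    simpa [HasLineDerivAt, hE] using h1
  -- The derivative of `E ψ G_j/S` in the direction `e j`; its last term comes from differentiating
  -- the exponential.
  set D : Fin 3 → E3 → ℂ := fun j x =>
    E x * (R j x : ℂ) + Complex.I * (E x * ((ψ x * (G j x ^ 2 / S x) : ℝ) : ℂ)) with hD
  have cψG : ∀ j, Continuous fun x => ψ x * (G j x ^ 2 / S x) := fun j => by
    fun_prop (disch := simpa using hSne)
  have iER : ∀ j, Integrable fun x => E x * (R j x : ℂ) := fun j =>
    Continuous.integrable_of_hasCompactSupport (cE.mul (Complex.continuous_ofReal.comp (cR j)))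
      (HasCompactSupport.mul_left ((sR j).comp_left (g := Complex.ofReal) Complex.ofReal_zero))
  have sψG : ∀ j, HasCompactSupport fun x => E x * ((ψ x * (G j x ^ 2 / S x) : ℝ) : ℂ) := fun j =>
    HasCompactSupport.mul_left
      (HasCompactSupport.comp_left (g := Complex.ofReal) sψ.mul_right Complex.ofReal_zero)
  have iEG : ∀ j, Integrable fun x => E x * ((ψ x * (G j x ^ 2 / S x) : ℝ) : ℂ) := fun j =>
    Continuous.integrable_of_hasCompactSupport
      (cE.mul (Complex.continuous_ofReal.comp (cψG j))) (sψG j)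
  have iD : ∀ j, Integrable (D j) := fun j => (iER j).add ((iEG j).const_mul _)
  have hD0 : ∀ j, ∫ x, D j x = 0 := by
    intro j
    have c1 : Continuous fun x => ψ x * (G j x / S x) := by
      fun_prop (disch := simpa using hSne)
    refine integral_eq_zero_of_hasLineDerivAt (v := e j)
      (F := fun x => E x * ((ψ x * (G j x / S x) : ℝ) : ℂ)) (by fun_prop) ?_ ?_ ?_ fun x => ?_
    · exact (cE.mul (Complex.continuous_ofReal.comp (cR j))).add
        (continuous_const.mul (cE.mul (Complex.continuous_ofReal.comp (cψG j))))
    · exact HasCompactSupport.mul_left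
        (HasCompactSupport.comp_left (g := Complex.ofReal) sψ.mul_right Complex.ofReal_zero)
    · exact (HasCompactSupport.mul_left ((sR j).comp_left (g := Complex.ofReal)
        Complex.ofReal_zero)).add ((sψG j).mul_left)
    · have h0 : S (x + (0 : ℝ) • e j) ≠ 0 := hSne _
      have h1 := HasDerivAt.mul (dE j x) (HasDerivAt.ofReal_comp
        (HasDerivAt.mul (hdψ j x) (HasDerivAt.div (dG j j x) (dS j x) h0)))
      refine h1.congr_deriv ?_
      simp only [zero_smul, add_zero, hD, hR, Pi.mul_apply, Pi.div_apply]
      have h2 : (S x : ℂ) ≠ 0 := by exact_mod_cast hSne x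
      push_cast
      field_simp
      ring
  -- Since `Σ G_j²/S = 1 - Λ/S`, summing the three identities over `j` gives back the amplitude `ψ`
  -- up to the small factor `Λ/S`.
  have hsum : ∀ x, ∑ j, ψ x * (G j x ^ 2 / S x) = ψ x - ψ x * (Λ / S x) := by
    intro x
    rw [← Finset.mul_sum, ← Finset.sum_div]
    have : ∑ j, G j x ^ 2 = S x - Λ := by simp [hS]
    rw [this, sub_div, div_self (hSne x)]; ring
  have cψΛ : Continuous fun x => ψ x * (Λ / S x) := by fun_prop (disch := simpa using hSne)
  have iEΛ : Integrable fun x => E x * ((ψ x * (Λ / S x) : ℝ) : ℂ) :=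
    Continuous.integrable_of_hasCompactSupport (cE.mul (Complex.continuous_ofReal.comp cψΛ))
      (HasCompactSupport.mul_left (HasCompactSupport.comp_left (g := Complex.ofReal)
        sψ.mul_right Complex.ofReal_zero))
  have hid : ∫ x, E x * (ψ x : ℂ) = ∫ x, (E x * ((ψ x * (Λ / S x) : ℝ) : ℂ)
      + Complex.I * ∑ j, E x * (R j x : ℂ)) := by
    have h1 : ∑ j, ∫ x, D j x = 0 := Finset.sum_eq_zero fun j _ => hD0 j
    rw [← integral_finsetSum _ fun j _ => iD j] at h1
    have h2 : ∀ x, E x * (ψ x : ℂ) = (E x * ((ψ x * (Λ / S x) : ℝ) : ℂ)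
        + Complex.I * ∑ j, E x * (R j x : ℂ)) - Complex.I * ∑ j, D j x := by
      intro x
      have h3 : ∑ j, D j x = ∑ j, E x * (R j x : ℂ)
          + Complex.I * (E x * ((ψ x - ψ x * (Λ / S x) : ℝ) : ℂ)) := by
        rw [← hsum x]
        simp only [hD, Finset.sum_add_distrib, Finset.mul_sum, Complex.ofReal_sum]
      rw [h3]; push_cast
      linear_combination (E x * (ψ x - ψ x * (Λ / S x)) : ℂ) * Complex.I_sq
    calc ∫ x, E x * (ψ x : ℂ) = ∫ x, ((E x * ((ψ x * (Λ / S x) : ℝ) : ℂ)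
        + Complex.I * ∑ j, E x * (R j x : ℂ)) - Complex.I * ∑ j, D j x) :=
          integral_congr_ae (Filter.Eventually.of_forall h2)
      _ = _ := by
        rw [integral_sub (f := fun x => E x * ((ψ x * (Λ / S x) : ℝ) : ℂ)
            + Complex.I * ∑ j, E x * (R j x : ℂ))
          (iEΛ.add ((integrable_finsetSum _ fun j _ => iER j).const_mul _))
          ((integrable_finsetSum _ fun j _ => iD j).const_mul _),
          integral_const_mul, h1, mul_zero, sub_zero]
  have cQ : ∀ i j, Continuous fun x => ψ x * H i j x ^ 2 / (G j x ^ 2 + Λ) := fun i j => by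
    fun_prop (disch := intros; positivity)
  have iQ : ∀ i j, Integrable fun x => ψ x * H i j x ^ 2 / (G j x ^ 2 + Λ) := fun i j => by
    refine (cQ i j).integrable_of_hasCompactSupport ?_
    simp only [div_eq_mul_inv, mul_assoc]; exact sψ.mul_right
  have idψ : ∀ j, Integrable fun x => |dψ j x| := fun j =>
    ((cdψ j).integrable_of_hasCompactSupport (sdψ j)).abs
  have hpt : ∀ x, ‖E x * ((ψ x * (Λ / S x) : ℝ) : ℂ) + Complex.I * ∑ j, E x * (R j x : ℂ)‖ ≤
      (∑ j, |dψ j x|) * (1 / (2 * h)) +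
        10 / Λ * ∑ i, ∑ j, ψ x * H i j x ^ 2 / (G j x ^ 2 + Λ) := by
    intro x
    refine (norm_add_le _ _).trans ?_
    rw [norm_mul (E x), nE, one_mul, Complex.norm_real, norm_mul Complex.I, Complex.norm_I, one_mul,
      Real.norm_of_nonneg (mul_nonneg (hψ0 x) (div_nonneg hΛ.le (hSpos x).le))]
    refine (add_le_add_right ((norm_sum_le _ _).trans (Finset.sum_le_sum fun j _ => ?_)) _).trans
      (remainder_le hpos hsq (hψ0 x) (hlow x) (dψ := fun j => dψ j x) (G := fun j => G j x))
    rw [norm_mul, nE, one_mul, Complex.norm_real, Real.norm_eq_abs]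
  rw [hid]
  refine (norm_integral_le_of_norm_le ?_ (Filter.Eventually.of_forall hpt)).trans ?_
  · exact ((integrable_finsetSum _ fun j _ => idψ j).mul_const _).add
      ((integrable_finsetSum _ fun i _ => integrable_finsetSum _ fun j _ => iQ i j).const_mul _)
  rw [integral_add ((integrable_finsetSum _ fun j _ => idψ j).mul_const _)
      ((integrable_finsetSum _ fun i _ => integrable_finsetSum _ fun j _ => iQ i j).const_mul _),
    integral_mul_const, integral_const_mul, integral_finsetSum _ fun j _ => idψ j,
    integral_finsetSum _ fun i _ => integrable_finsetSum _ fun j _ => iQ i j]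
  simp_rw [integral_finsetSum _ fun j _ => iQ _ j]
  have hq : ∑ i, ∑ j, ∫ x, ψ x * H i j x ^ 2 / (G j x ^ 2 + Λ) ≤ Real.pi / 2 / h * (B * Λ) := by
    refine le_trans ?_ (mul_le_mul_of_nonneg_left hB (by positivity))
    rw [Finset.mul_sum]
    refine Finset.sum_le_sum fun i _ => ?_
    rw [Finset.mul_sum]
    exact Finset.sum_le_sum fun j _ => integral_sq_div_le hΛ cψ (cdψ i) (cG j) (cH i j) (cT i j)
      sψ (sdψ i) hψ0 (dG i j) (dH i j) (hdψ i)
  have hB0 : 0 ≤ B := by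
    refine nonneg_of_mul_nonneg_left (le_trans ?_ hB) hΛ
    exact Finset.sum_nonneg fun i _ => Finset.sum_nonneg fun j _ => integral_nonneg fun x => by
      have := hψ0 x; positivity
  have hL : 0 ≤ ∑ j, ∫ x, |dψ j x| :=
    Finset.sum_nonneg fun j _ => integral_nonneg fun x => abs_nonneg _
  rw [add_div]
  refine add_le_add ?_ ?_
  · rw [mul_one_div]; exact div_le_div_of_nonneg_left hL hpos (by linarith)
  · refine (mul_le_mul_of_nonneg_left hq (by positivity)).trans ?_
    -- The factors `Λ` cancel, and `5π ≤ 20` gives the constant of the statement.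
    have : 10 / Λ * (Real.pi / 2 / h * (B * Λ)) = 5 * Real.pi * B / h := by field_simp; ring
    rw [this]
    gcongr
    linarith [Real.pi_lt_four]

/-! ### The regularized norm and its derivatives -/

/-- The smooth regularization `√(|ζ|² + κ²)` of the norm. -/
def regNorm (κ : ℝ) (ζ : E3) : ℝ := √(‖ζ‖ ^ 2 + κ ^ 2)

/-- The Kronecker symbol with real values. -/
def kron (i j : Fin 3) : ℝ := if i = j then 1 else 0

/-- The second derivative `∂ᵢ∂ⱼ` of the regularized norm. -/
def regHess (κ : ℝ) (i j : Fin 3) (ζ : E3) : ℝ :=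
  kron i j / regNorm κ ζ - ζ i * ζ j / regNorm κ ζ ^ 3

/-- The third derivative `∂ᵢ∂ᵢ∂ⱼ` of the regularized norm. -/
def regThird (κ : ℝ) (i j : Fin 3) (ζ : E3) : ℝ :=
  3 * ζ i ^ 2 * ζ j / regNorm κ ζ ^ 5 - (2 * kron i j * ζ i + ζ j) / regNorm κ ζ ^ 3

/-- The standard basis of `E3`. -/
def stdE (i : Fin 3) : E3 := EuclideanSpace.single i 1

theorem stdE_apply (i j : Fin 3) : stdE i j = kron i j := by
  simp [stdE, kron, eq_comm]

theorem norm_add_smul_stdE (ζ : E3) (i : Fin 3) (t : ℝ) :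
    ‖ζ + t • stdE i‖ ^ 2 = ‖ζ‖ ^ 2 + 2 * t * ζ i + t ^ 2 := by
  rw [norm_add_sq_real, norm_smul, inner_smul_right]
  simp [stdE, EuclideanSpace.inner_single_right]
  ring

theorem kron_self (i : Fin 3) : kron i i = 1 := by simp [kron]

theorem abs_kron_le (i j : Fin 3) : |kron i j| ≤ 1 := by
  unfold kron; split_ifs <;> simp

theorem regNorm_sq (κ : ℝ) (ζ : E3) : regNorm κ ζ ^ 2 = ‖ζ‖ ^ 2 + κ ^ 2 :=
  Real.sq_sqrt (by positivity)

theorem regNorm_neg (κ : ℝ) (ζ : E3) : regNorm κ (-ζ) = regNorm κ ζ := by simp [regNorm]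

theorem regHess_neg (κ : ℝ) (i j : Fin 3) (ζ : E3) : regHess κ i j (-ζ) = regHess κ i j ζ := by
  simp [regHess, regNorm_neg]

theorem norm_le_regNorm (κ : ℝ) (ζ : E3) : ‖ζ‖ ≤ regNorm κ ζ :=
  Real.le_sqrt_of_sq_le (by nlinarith [sq_nonneg κ])

theorem regNorm_le {κ : ℝ} (hκ : 0 ≤ κ) (ζ : E3) : regNorm κ ζ ≤ ‖ζ‖ + κ :=
  Real.sqrt_le_iff.2 ⟨by positivity, by nlinarith [norm_nonneg ζ]⟩

theorem abs_apply_le_norm (ζ : E3) (i : Fin 3) : |ζ i| ≤ ‖ζ‖ := by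
  simpa using PiLp.norm_apply_le ζ i

theorem abs_regNorm_sub_le {κ : ℝ} (hκ : 0 < κ) (ζ ζ' : E3) :
    |regNorm κ ζ - regNorm κ ζ'| ≤ ‖ζ - ζ'‖ := by
  have h0 : 0 < regNorm κ ζ := Real.sqrt_pos.2 (by positivity)
  have h1 : 0 < regNorm κ ζ' := Real.sqrt_pos.2 (by positivity)
  have h2 : (regNorm κ ζ - regNorm κ ζ') * (regNorm κ ζ + regNorm κ ζ')
      = (‖ζ‖ - ‖ζ'‖) * (‖ζ‖ + ‖ζ'‖) := by
    linear_combination regNorm_sq κ ζ - regNorm_sq κ ζ'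
  have h3 := abs_norm_sub_norm_le ζ ζ'
  have h4 : |regNorm κ ζ - regNorm κ ζ'| * (regNorm κ ζ + regNorm κ ζ') ≤
      ‖ζ - ζ'‖ * (regNorm κ ζ + regNorm κ ζ') := by
    calc _ = |‖ζ‖ - ‖ζ'‖| * (‖ζ‖ + ‖ζ'‖) := by
          rw [← abs_of_pos (add_pos h0 h1), ← abs_mul, h2, abs_mul,
            abs_of_nonneg (add_nonneg (norm_nonneg ζ) (norm_nonneg ζ'))]
      _ ≤ _ := mul_le_mul h3 (add_le_add (norm_le_regNorm κ ζ) (norm_le_regNorm κ ζ'))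
          (by positivity) (norm_nonneg _)
  exact le_of_mul_le_mul_right h4 (add_pos h0 h1)

theorem continuous_regNorm (κ : ℝ) : Continuous (regNorm κ) := by
  unfold regNorm; fun_prop

theorem regNorm_pos {κ : ℝ} (hκ : 0 < κ) (ζ : E3) : 0 < regNorm κ ζ := Real.sqrt_pos.2 (by positivity)

theorem continuous_regHess {κ : ℝ} (hκ : 0 < κ) (i j : Fin 3) : Continuous (regHess κ i j) := by
  have := continuous_regNorm κ
  have h := fun ζ => (regNorm_pos hκ ζ).ne'
  unfold regHess
  refine Continuous.sub (continuous_const.div this h)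
    (Continuous.div (by fun_prop) (this.pow 3) fun x => pow_ne_zero _ (h x))

theorem continuous_regThird {κ : ℝ} (hκ : 0 < κ) (i j : Fin 3) : Continuous (regThird κ i j) := by
  have := continuous_regNorm κ
  have h := fun ζ => (regNorm_pos hκ ζ).ne'
  unfold regThird
  exact Continuous.sub (Continuous.div (by fun_prop) (this.pow 5) fun x => pow_ne_zero _ (h x))
    (Continuous.div (by fun_prop) (this.pow 3) fun x => pow_ne_zero _ (h x))

theorem hasLineDerivAt_regNorm {κ : ℝ} (hκ : 0 < κ) (i : Fin 3) (ζ : E3) :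
    HasLineDerivAt ℝ (regNorm κ) (ζ i / regNorm κ ζ) ζ (stdE i) := by
  have h1 : HasDerivAt (fun t : ℝ => ‖ζ‖ ^ 2 + 2 * t * ζ i + t ^ 2 + κ ^ 2) (2 * ζ i) 0 := by
    have := ((((hasDerivAt_id (0 : ℝ)).const_mul 2).mul_const (ζ i)).const_add (‖ζ‖ ^ 2)).add
      ((hasDerivAt_id (0 : ℝ)).fun_pow 2)
    simpa using this.add_const (κ ^ 2)
  have h2 := h1.sqrt (by simp; positivity)
  have h3 : HasDerivAt (fun t : ℝ => regNorm κ (ζ + t • stdE i)) (2 * ζ i / (2 * regNorm κ ζ)) 0 := by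
    simpa [regNorm, norm_add_smul_stdE] using h2
  refine HasDerivAt.congr_deriv h3 ?_
  rw [mul_div_mul_left _ _ two_ne_zero]

theorem hasLineDerivAt_coord (i j : Fin 3) (ζ : E3) :
    HasLineDerivAt ℝ (fun ζ : E3 => ζ j) (kron i j) ζ (stdE i) := by
  have : HasDerivAt (fun t : ℝ => ζ j + t * kron i j) (kron i j) 0 := by
    simpa using ((hasDerivAt_id (0 : ℝ)).mul_const (kron i j)).const_add (ζ j)
  simpa [HasLineDerivAt, stdE_apply] using this

theorem hasLineDerivAt_regGrad {κ : ℝ} (hκ : 0 < κ) (i j : Fin 3) (ζ : E3) :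
    HasLineDerivAt ℝ (fun ζ : E3 => ζ j / regNorm κ ζ) (regHess κ i j ζ) ζ (stdE i) := by
  have h0 := (regNorm_pos hκ ζ).ne'
  have := HasDerivAt.div (hasLineDerivAt_coord i j ζ) (hasLineDerivAt_regNorm hκ i ζ)
    (regNorm_pos hκ _).ne'
  refine HasDerivAt.congr_deriv this ?_
  simp only [zero_smul, add_zero, regHess]
  field_simp

theorem hasLineDerivAt_regHess {κ : ℝ} (hκ : 0 < κ) (i j : Fin 3) (ζ : E3) :
    HasLineDerivAt ℝ (regHess κ i j) (regThird κ i j ζ) ζ (stdE i) := by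
  have h0 := (regNorm_pos hκ ζ).ne'
  have hq := hasLineDerivAt_regNorm hκ i ζ
  have h1 := HasDerivAt.div (hasDerivAt_const (0 : ℝ) (kron i j)) hq (regNorm_pos hκ _).ne'
  have h2 := HasDerivAt.div (HasDerivAt.mul (hasLineDerivAt_coord i i ζ)
    (hasLineDerivAt_coord i j ζ)) (HasDerivAt.pow hq 3) (pow_ne_zero 3 (regNorm_pos hκ _).ne')
  refine HasDerivAt.congr_deriv (HasDerivAt.sub h1 h2) ?_
  simp only [zero_smul, add_zero, regThird, kron_self, Pi.mul_apply, Pi.pow_apply]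
  field_simp
  ring

theorem HasLineDerivAt.shift {f : E3 → ℝ} {f' : ℝ} {x v : E3} (b : E3)
    (h : HasLineDerivAt ℝ f f' (x + b) v) : HasLineDerivAt ℝ (fun y => f (y + b)) f' x v := by
  unfold HasLineDerivAt at *
  simpa only [add_right_comm x _ b] using h

/-! ### Bounds for the derivatives of the regularized norm -/

theorem abs_mul_sub_mul_le {a a' b b' A B : ℝ} (ha : |a| ≤ 1) (hb : |b'| ≤ 1)
    (hA : |a - a'| ≤ A) (hB : |b - b'| ≤ B) : |a * b - a' * b'| ≤ A + B := by
  have : a * b - a' * b' = (a - a') * b' + a * (b - b') := by ring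
  rw [this]
  refine (abs_add_le _ _).trans (add_le_add ?_ ?_)
  · rw [abs_mul]; exact (mul_le_mul hA hb (abs_nonneg _) ((abs_nonneg _).trans hA)).trans (by simp)
  · rw [abs_mul]; exact (mul_le_mul ha hB (abs_nonneg _) zero_le_one).trans (by simp)

theorem abs_apply_div_regNorm_le {κ : ℝ} (hκ : 0 < κ) (i : Fin 3) (ζ : E3) : |ζ i / regNorm κ ζ| ≤ 1 := by
  rw [abs_div, abs_of_pos (regNorm_pos hκ ζ), div_le_one (regNorm_pos hκ ζ)]
  exact (abs_apply_le_norm ζ i).trans (norm_le_regNorm κ ζ)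

theorem regHess_eq {κ : ℝ} (hκ : 0 < κ) (i j : Fin 3) (ζ : E3) : regHess κ i j ζ =
    (kron i j - ζ i / regNorm κ ζ * (ζ j / regNorm κ ζ)) * (1 / regNorm κ ζ) := by
  have h0 := (regNorm_pos hκ ζ).ne'
  unfold regHess; field_simp

theorem regThird_eq {κ : ℝ} (hκ : 0 < κ) (i j : Fin 3) (ζ : E3) : regThird κ i j ζ =
    (3 * (ζ i / regNorm κ ζ * (ζ i / regNorm κ ζ * (ζ j / regNorm κ ζ)))
      - 2 * kron i j * (ζ i / regNorm κ ζ) - ζ j / regNorm κ ζ) * (1 / regNorm κ ζ) ^ 2 := by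
  have h0 := (regNorm_pos hκ ζ).ne'
  unfold regThird; field_simp; ring

theorem abs_mul_le_one {a b : ℝ} (ha : |a| ≤ 1) (hb : |b| ≤ 1) : |a * b| ≤ 1 := by
  rw [abs_mul]; exact mul_le_one₀ ha (abs_nonneg _) hb

theorem abs_regHess_coeff_le {κ : ℝ} (hκ : 0 < κ) (i j : Fin 3) (ζ : E3) :
    |kron i j - ζ i / regNorm κ ζ * (ζ j / regNorm κ ζ)| ≤ 2 := by
  refine (abs_sub _ _).trans ?_
  linarith [abs_kron_le i j, abs_mul_le_one (abs_apply_div_regNorm_le hκ i ζ)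
    (abs_apply_div_regNorm_le hκ j ζ)]

theorem abs_regThird_coeff_le {κ : ℝ} (hκ : 0 < κ) (i j : Fin 3) (ζ : E3) :
    |3 * (ζ i / regNorm κ ζ * (ζ i / regNorm κ ζ * (ζ j / regNorm κ ζ)))
      - 2 * kron i j * (ζ i / regNorm κ ζ) - ζ j / regNorm κ ζ| ≤ 6 := by
  have hi := abs_apply_div_regNorm_le hκ i ζ
  have hj := abs_apply_div_regNorm_le hκ j ζ
  have h1 := abs_mul_le_one hi (abs_mul_le_one hi hj)
  have h2 := abs_mul_le_one (abs_kron_le i j) hi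
  rw [abs_le] at *
  constructor <;> linarith [h1.1, h1.2, h2.1, h2.2, hj.1, hj.2]

theorem abs_regHess_le {κ : ℝ} (hκ : 0 < κ) (i j : Fin 3) (ζ : E3) : |regHess κ i j ζ| ≤ 2 / regNorm κ ζ := by
  have h0 := regNorm_pos hκ ζ
  rw [regHess_eq hκ, abs_mul, abs_of_pos (one_div_pos.2 h0), div_eq_mul_one_div 2]
  exact mul_le_mul_of_nonneg_right (abs_regHess_coeff_le hκ i j ζ) (by positivity)

theorem abs_regThird_le {κ : ℝ} (hκ : 0 < κ) (i j : Fin 3) (ζ : E3) : |regThird κ i j ζ| ≤ 6 / regNorm κ ζ ^ 2 := by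
  have h0 := regNorm_pos hκ ζ
  rw [regThird_eq hκ, abs_mul, abs_of_pos (pow_pos (one_div_pos.2 h0) 2), div_eq_mul_one_div 6,
    ← one_div_pow]
  exact mul_le_mul_of_nonneg_right (abs_regThird_coeff_le hκ i j ζ) (by positivity)

theorem abs_one_div_regNorm_sub_le {κ : ℝ} (hκ : 0 < κ) {ζ ζ' : E3} {d : ℝ} (hd : 0 < d) (h : d ≤ regNorm κ ζ)
    (h' : d ≤ regNorm κ ζ') : |1 / regNorm κ ζ - 1 / regNorm κ ζ'| ≤ ‖ζ - ζ'‖ / d ^ 2 := by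
  have h0 := regNorm_pos hκ ζ
  have h1 := regNorm_pos hκ ζ'
  rw [div_sub_div _ _ h0.ne' h1.ne', abs_div, abs_of_pos (mul_pos h0 h1)]
  refine div_le_div₀ (norm_nonneg _) ?_ (by positivity) (by nlinarith)
  rw [one_mul, mul_one, abs_sub_comm]
  exact abs_regNorm_sub_le hκ ζ ζ'

theorem abs_apply_div_regNorm_sub_le {κ : ℝ} (hκ : 0 < κ) {ζ ζ' : E3} {d : ℝ} (hd : 0 < d) (h : d ≤ regNorm κ ζ)
    (i : Fin 3) :
    |ζ i / regNorm κ ζ - ζ' i / regNorm κ ζ'| ≤ 2 * (‖ζ - ζ'‖ / d) := by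
  have h0 := regNorm_pos hκ ζ
  have h1 := regNorm_pos hκ ζ'
  have e : ζ i / regNorm κ ζ - ζ' i / regNorm κ ζ' = (ζ - ζ') i / regNorm κ ζ
      + ζ' i / regNorm κ ζ' * ((regNorm κ ζ' - regNorm κ ζ) / regNorm κ ζ) := by
    simp only [PiLp.sub_apply]; field_simp; ring
  rw [e, two_mul]
  refine (abs_add_le _ _).trans (add_le_add ?_ ?_)
  · rw [abs_div, abs_of_pos h0]
    exact div_le_div₀ (norm_nonneg _) (abs_apply_le_norm _ i) hd h
  · rw [abs_mul, abs_div (regNorm κ ζ' - _), abs_of_pos h0]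
    refine (mul_le_of_le_one_left (by positivity) (abs_apply_div_regNorm_le hκ i ζ')).trans ?_
    refine div_le_div₀ (norm_nonneg _) ?_ hd h
    rw [abs_sub_comm]; exact abs_regNorm_sub_le hκ ζ ζ'

/-- Only the two endpoints are assumed to be far from the origin, while the segment between them may
pass close to it. Algebraic identities for the unit vectors and the reciprocals therefore replace
the mean value theorem, here and for the third derivatives. -/
theorem abs_regHess_sub_le {κ : ℝ} (hκ : 0 < κ) {ζ ζ' : E3} {d : ℝ} (hd : 0 < d) (h : d ≤ regNorm κ ζ)
    (h' : d ≤ regNorm κ ζ') (i j : Fin 3) :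
    |regHess κ i j ζ - regHess κ i j ζ'| ≤ 6 * ‖ζ - ζ'‖ / d ^ 2 := by
  have h0 := regNorm_pos hκ ζ
  have h1 := regNorm_pos hκ ζ'
  have hi := abs_apply_div_regNorm_sub_le (ζ' := ζ') hκ hd h i
  have hj := abs_apply_div_regNorm_sub_le (ζ' := ζ') hκ hd h j
  have hm := abs_mul_sub_mul_le (abs_apply_div_regNorm_le hκ i ζ)
    (abs_apply_div_regNorm_le hκ j ζ') hi hj
  have hr := abs_one_div_regNorm_sub_le hκ hd h h'
  rw [regHess_eq hκ, regHess_eq hκ]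
  set m := ζ i / regNorm κ ζ * (ζ j / regNorm κ ζ)
  set m' := ζ' i / regNorm κ ζ' * (ζ' j / regNorm κ ζ')
  have e : (kron i j - m) * (1 / regNorm κ ζ) - (kron i j - m') * (1 / regNorm κ ζ') =
      -(m - m') * (1 / regNorm κ ζ) + (kron i j - m') * (1 / regNorm κ ζ - 1 / regNorm κ ζ') := by
    ring
  rw [e]
  refine (abs_add_le _ _).trans ?_
  rw [abs_mul, abs_mul, abs_neg, abs_of_pos (one_div_pos.2 h0)]
  have h3 : 1 / regNorm κ ζ ≤ 1 / d := one_div_le_one_div_of_le hd h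
  have h4 := mul_le_mul hm h3 (by positivity) (by positivity)
  have h5 := mul_le_mul (abs_regHess_coeff_le hκ i j ζ') hr (abs_nonneg _) (by norm_num)
  refine (add_le_add h4 h5).trans (le_of_eq ?_)
  field_simp; ring

theorem abs_regThird_sub_le {κ : ℝ} (hκ : 0 < κ) {ζ ζ' : E3} {d : ℝ} (hd : 0 < d) (h : d ≤ regNorm κ ζ)
    (h' : d ≤ regNorm κ ζ') (i j : Fin 3) :
    |regThird κ i j ζ - regThird κ i j ζ'| ≤ 36 * ‖ζ - ζ'‖ / d ^ 3 := by
  have h0 := regNorm_pos hκ ζ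
  have h1 := regNorm_pos hκ ζ'
  have hi := abs_apply_div_regNorm_sub_le (ζ' := ζ') hκ hd h i
  have hj := abs_apply_div_regNorm_sub_le (ζ' := ζ') hκ hd h j
  have hm := abs_mul_sub_mul_le (abs_apply_div_regNorm_le hκ i ζ)
    (abs_apply_div_regNorm_le hκ j ζ') hi hj
  have hm2 := abs_mul_sub_mul_le (abs_apply_div_regNorm_le hκ i ζ)
    (abs_mul_le_one (abs_apply_div_regNorm_le hκ i ζ') (abs_apply_div_regNorm_le hκ j ζ')) hi hm
  have hr := abs_one_div_regNorm_sub_le hκ hd h h'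
  have hc := abs_regThird_coeff_le hκ i j ζ'
  rw [regThird_eq hκ, regThird_eq hκ]
  set m := ζ i / regNorm κ ζ * (ζ i / regNorm κ ζ * (ζ j / regNorm κ ζ))
  set m' := ζ' i / regNorm κ ζ' * (ζ' i / regNorm κ ζ' * (ζ' j / regNorm κ ζ'))
  set D := ‖ζ - ζ'‖ with hD
  have hD0 : 0 ≤ D := norm_nonneg _
  have hk := abs_mul_sub_mul_le (abs_kron_le i j) (abs_apply_div_regNorm_le hκ i ζ')
    (show |kron i j - kron i j| ≤ 0 by simp) hi
  set c := 3 * m - 2 * kron i j * (ζ i / regNorm κ ζ) - ζ j / regNorm κ ζ with hcdef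
  set c' := 3 * m' - 2 * kron i j * (ζ' i / regNorm κ ζ') - ζ' j / regNorm κ ζ' with hcdef'
  have hcc : |c - c'| ≤ 24 * (D / d) := by
    rw [abs_le] at *
    constructor <;> linarith [hm2.1, hm2.2, hk.1, hk.2, hj.1, hj.2]
  have e : c * (1 / regNorm κ ζ) ^ 2 - c' * (1 / regNorm κ ζ') ^ 2 =
      (c - c') * (1 / regNorm κ ζ) ^ 2 + c' * ((1 / regNorm κ ζ - 1 / regNorm κ ζ')
        * (1 / regNorm κ ζ + 1 / regNorm κ ζ')) := by ring
  rw [e]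
  refine (abs_add_le _ _).trans ?_
  have h3 : 1 / regNorm κ ζ ≤ 1 / d := one_div_le_one_div_of_le hd h
  have h3' : 1 / regNorm κ ζ' ≤ 1 / d := one_div_le_one_div_of_le hd h'
  have p0 : 0 < 1 / regNorm κ ζ := one_div_pos.2 h0
  have p1 : 0 < 1 / regNorm κ ζ' := one_div_pos.2 h1
  rw [abs_mul, abs_mul, abs_mul, abs_of_pos (pow_pos p0 2), abs_of_pos (add_pos p0 p1)]
  have h4 := mul_le_mul hcc (pow_le_pow_left₀ p0.le h3 2) (by positivity) (by positivity)
  have h5 := mul_le_mul hc (mul_le_mul hr (add_le_add h3 h3') (by positivity) (by positivity))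
    (by positivity) (by norm_num)
  refine (add_le_add h4 h5).trans (le_of_eq ?_)
  field_simp; ring

/-! ### The Hessian of the phase on the unit annulus -/

/-- The combination `f (η + μ e₃) + s f (η - μ e₃)`. -/
def twoPoint (f : E3 → ℝ) (s μ : ℝ) (η : E3) : ℝ :=
  f (η + μ • stdE 2) + s * f (η - μ • stdE 2)

/-- The weight `1 + |η + μ e₃|⁻² + |η - μ e₃|⁻²`, regularized. -/
def twoPointWeight (κ μ : ℝ) (η : E3) : ℝ :=
  1 + 1 / regNorm κ (η + μ • stdE 2) ^ 2 + 1 / regNorm κ (η - μ • stdE 2) ^ 2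

theorem norm_smul_stdE {μ : ℝ} (hμ : 0 < μ) (i : Fin 3) : ‖μ • stdE i‖ = μ := by
  simp [stdE, norm_smul, abs_of_pos hμ]

theorem regNorm_shift_le {κ μ : ℝ} (hκ : 0 < κ) (hκ1 : κ ≤ 1) (hμ : 0 < μ) {η : E3}
    (h3 : ‖η‖ ≤ 3) :
    regNorm κ (η + μ • stdE 2) ≤ 4 + μ ∧ regNorm κ (η - μ • stdE 2) ≤ 4 + μ := by
  have h1 := norm_add_le η (μ • stdE 2)
  have h2 := norm_sub_le η (μ • stdE 2)
  rw [norm_smul_stdE hμ] at h1 h2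
  exact ⟨(regNorm_le hκ.le _).trans (by linarith), (regNorm_le hκ.le _).trans (by linarith)⟩

theorem le_regNorm_shift (κ : ℝ) {μ : ℝ} (hμ : 0 < μ) (η : E3) :
    |‖η‖ - μ| ≤ regNorm κ (η + μ • stdE 2) ∧ |‖η‖ - μ| ≤ regNorm κ (η - μ • stdE 2) := by
  have h1 := abs_norm_sub_norm_le η (-(μ • stdE 2))
  have h2 := abs_norm_sub_norm_le η (μ • stdE 2)
  rw [norm_neg, sub_neg_eq_add] at h1
  rw [norm_smul_stdE hμ] at h1 h2
  exact ⟨h1.trans (norm_le_regNorm κ _), h2.trans (norm_le_regNorm κ _)⟩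

theorem one_le_twoPointWeight (κ μ : ℝ) (η : E3) : 1 ≤ twoPointWeight κ μ η := by
  unfold twoPointWeight
  have h1 : 0 ≤ 1 / regNorm κ (η + μ • stdE 2) ^ 2 := by positivity
  have h2 : 0 ≤ 1 / regNorm κ (η - μ • stdE 2) ^ 2 := by positivity
  linarith

/-- The inequality `2/R ≤ 1 + 1/R²` lets one weight serve for the second and the third derivatives.
-/
theorem twoPoint_regHess_le_weight {κ s : ℝ} (hκ : 0 < κ) (hs : |s| = 1) (μ : ℝ) (η : E3)
    (i j : Fin 3) : |twoPoint (regHess κ i j) s μ η| ≤ 6 * twoPointWeight κ μ η := by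
  unfold twoPoint twoPointWeight
  refine (abs_add_le _ _).trans ?_
  rw [abs_mul, hs, one_mul]
  have key : ∀ ζ : E3, |regHess κ i j ζ| ≤ 1 + 1 / regNorm κ ζ ^ 2 := by
    intro ζ
    refine (abs_regHess_le hκ i j ζ).trans ?_
    have : 1 + 1 / regNorm κ ζ ^ 2 - 2 / regNorm κ ζ = (1 - 1 / regNorm κ ζ) ^ 2 := by ring
    nlinarith [sq_nonneg (1 - 1 / regNorm κ ζ)]
  have p1 : 0 ≤ 1 / regNorm κ (η + μ • stdE 2) ^ 2 := by positivity
  have p2 : 0 ≤ 1 / regNorm κ (η - μ • stdE 2) ^ 2 := by positivity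
  linarith [key (η + μ • stdE 2), key (η - μ • stdE 2)]

theorem twoPoint_regThird_le_weight {κ s : ℝ} (hκ : 0 < κ) (hs : |s| = 1) (μ : ℝ) (η : E3)
    (i j : Fin 3) : |twoPoint (regThird κ i j) s μ η| ≤ 6 * twoPointWeight κ μ η := by
  unfold twoPoint twoPointWeight
  refine (abs_add_le _ _).trans ?_
  rw [abs_mul, hs, one_mul]
  have h1 := abs_regThird_le hκ i j (η + μ • stdE 2)
  have h2 := abs_regThird_le hκ i j (η - μ • stdE 2)
  rw [div_eq_mul_one_div] at h1 h2
  linarith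

theorem twoPoint_regThird_le_far {κ s μ : ℝ} (hκ : 0 < κ) (hs : |s| = 1) (hμ : 6 ≤ μ) {η : E3}
    (h3 : ‖η‖ ≤ 3) (i j : Fin 3) : |twoPoint (regThird κ i j) s μ η| ≤ 48 / μ ^ 2 := by
  have hle := le_regNorm_shift κ (show 0 < μ by linarith) η
  have hd : μ / 2 ≤ |‖η‖ - μ| := by rw [abs_sub_comm]; exact le_trans (by linarith) (le_abs_self _)
  have key : ∀ ζ : E3, μ / 2 ≤ regNorm κ ζ → |regThird κ i j ζ| ≤ 24 / μ ^ 2 := by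
    intro ζ hζ
    refine (abs_regThird_le hκ i j ζ).trans ?_
    have h := pow_le_pow_left₀ (by linarith) hζ 2
    have : (24 : ℝ) / μ ^ 2 = 6 / (μ / 2) ^ 2 := by ring
    rw [this]
    exact div_le_div_of_nonneg_left (by norm_num) (by positivity) h
  unfold twoPoint
  refine (abs_add_le _ _).trans ?_
  rw [abs_mul, hs, one_mul]
  have e : (48 : ℝ) / μ ^ 2 = 24 / μ ^ 2 + 24 / μ ^ 2 := by ring
  rw [e]
  exact add_le_add (key _ (hd.trans hle.1)) (key _ (hd.trans hle.2))

theorem twoPoint_regHess_le_far {κ s μ : ℝ} (hκ : 0 < κ) (hs : |s| = 1) (hμ : 6 ≤ μ) {η : E3}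
    (h3 : ‖η‖ ≤ 3) (i j : Fin 3) : |twoPoint (regHess κ i j) s μ η| ≤ 8 / μ := by
  have hle := le_regNorm_shift κ (show 0 < μ by linarith) η
  have hd : μ / 2 ≤ |‖η‖ - μ| := by rw [abs_sub_comm]; exact le_trans (by linarith) (le_abs_self _)
  have key : ∀ ζ : E3, μ / 2 ≤ regNorm κ ζ → |regHess κ i j ζ| ≤ 4 / μ := by
    intro ζ hζ
    refine (abs_regHess_le hκ i j ζ).trans ?_
    have : (4 : ℝ) / μ = 2 / (μ / 2) := by ring
    rw [this]
    exact div_le_div_of_nonneg_left (by norm_num) (by linarith) hζ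
  unfold twoPoint
  refine (abs_add_le _ _).trans ?_
  rw [abs_mul, hs, one_mul]
  have e : (8 : ℝ) / μ = 4 / μ + 4 / μ := by ring
  rw [e]
  exact add_le_add (key _ (hd.trans hle.1)) (key _ (hd.trans hle.2))

/-- For the difference of the two square roots the leading terms of the Hessian cancel. -/
theorem twoPoint_regHess_neg_one_le_far {κ μ : ℝ} (hκ : 0 < κ) (hμ : 6 ≤ μ) {η : E3}
    (h3 : ‖η‖ ≤ 3) (i j : Fin 3) : |twoPoint (regHess κ i j) (-1) μ η| ≤ 144 / μ ^ 2 := by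
  have hle := le_regNorm_shift κ (show 0 < μ by linarith) η
  have hd : μ / 2 ≤ |‖η‖ - μ| := by rw [abs_sub_comm]; exact le_trans (by linarith) (le_abs_self _)
  -- The Hessian is even, so `η - μe₃` may be replaced by `μe₃ - η`, which lies at distance `2|η| ≤
  -- 6` from `η + μe₃`. Both points are at distance at least `μ/2` from the origin.
  have h2 : μ / 2 ≤ regNorm κ (-(η - μ • stdE 2)) := by
    rw [regNorm_neg]; exact hd.trans hle.2
  have h := abs_regHess_sub_le hκ (by linarith) (hd.trans hle.1) h2 i j
  rw [regHess_neg] at h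
  have e : η + μ • stdE 2 - -(η - μ • stdE 2) = (2 : ℝ) • η := by module
  rw [e, norm_smul] at h
  unfold twoPoint
  rw [neg_one_mul, ← sub_eq_add_neg]
  refine h.trans ?_
  have : (144 : ℝ) / μ ^ 2 = 6 * (2 * 3) / (μ / 2) ^ 2 := by ring
  rw [this, Real.norm_ofNat]
  gcongr

/-- For small `μ` the two points are `2μ` apart and at distance at least `1/4` from the origin, so
the differences are Lipschitz in `μ`. This gain matches the lower bound `μ/(4+μ)³`, which vanishes
as `μ → 0`. -/
theorem twoPoint_neg_one_le_near {κ μ : ℝ} (hκ : 0 < κ) (hμ : 0 < μ) (hμ4 : μ ≤ 1 / 4)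
    {η : E3} (h2 : 1 / 2 ≤ ‖η‖) (i j : Fin 3) :
    |twoPoint (regHess κ i j) (-1) μ η| ≤ 4608 * μ ∧
      |twoPoint (regThird κ i j) (-1) μ η| ≤ 4608 * μ := by
  have hle := le_regNorm_shift κ hμ η
  have hd : 1 / 4 ≤ |‖η‖ - μ| := le_trans (by linarith) (le_abs_self _)
  have e : η + μ • stdE 2 - (η - μ • stdE 2) = (2 : ℝ) • (μ • stdE 2) := by module
  have hH := abs_regHess_sub_le hκ (by norm_num) (hd.trans hle.1) (hd.trans hle.2) i j
  have hT := abs_regThird_sub_le hκ (by norm_num) (hd.trans hle.1) (hd.trans hle.2) i j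
  rw [e, norm_smul, norm_smul_stdE hμ, Real.norm_ofNat] at hH hT
  unfold twoPoint
  simp only [neg_one_mul, ← sub_eq_add_neg]
  have e1 : 6 * (2 * μ) / (1 / 4) ^ 2 = 192 * μ := by ring
  have e2 : 36 * (2 * μ) / (1 / 4) ^ 3 = 4608 * μ := by ring
  exact ⟨hH.trans (by linarith), hT.trans e2.le⟩

/-- Here `P` and `M` are the regularized distances and the five hypotheses are entries of the
Hessian of the difference. The entries in the plane `e₁, e₂` control `Δ₁ = 1/P - 1/M`, which is of
size `μ|z|`. The mixed entries with `e₃` control `μ(x² + y²)(1/P³ + 1/M³)`. The annulus excludes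
that `z` and `x² + y²` are both small. -/
theorem regHess_diff_lower {x y z μ P M N : ℝ} (hμ : 0 < μ) (hP : 0 < P) (hM : 0 < M)
    (hP4 : P ≤ 4 + μ) (hM4 : M ≤ 4 + μ) (hN : 0 ≤ N)
    (hPM : P ^ 2 - M ^ 2 = 4 * μ * z) (hlow : 1 / 4 ≤ x ^ 2 + y ^ 2 + z ^ 2)
    (hup : x ^ 2 + y ^ 2 + z ^ 2 ≤ 9)
    (h00 : |(1 / P - 1 / M) - x ^ 2 * (1 / P ^ 3 - 1 / M ^ 3)| ≤ N)
    (h11 : |(1 / P - 1 / M) - y ^ 2 * (1 / P ^ 3 - 1 / M ^ 3)| ≤ N)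
    (h01 : |x * y * (1 / P ^ 3 - 1 / M ^ 3)| ≤ N)
    (h02 : |x * (z * (1 / P ^ 3 - 1 / M ^ 3) + μ * (1 / P ^ 3 + 1 / M ^ 3))| ≤ N)
    (h12 : |y * (z * (1 / P ^ 3 - 1 / M ^ 3) + μ * (1 / P ^ 3 + 1 / M ^ 3))| ≤ N) :
    μ / (4 + μ) ^ 3 ≤ 105 * N := by
  set Δ₁ := 1 / P - 1 / M with hΔ₁
  set Δ₃ := 1 / P ^ 3 - 1 / M ^ 3 with hΔ₃
  set S₃ := 1 / P ^ 3 + 1 / M ^ 3 with hS₃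
  have hx3 : |x| ≤ 3 := abs_le_of_sq_le_sq (by nlinarith [sq_nonneg y, sq_nonneg z]) (by norm_num)
  have hy3 : |y| ≤ 3 := abs_le_of_sq_le_sq (by nlinarith [sq_nonneg x, sq_nonneg z]) (by norm_num)
  have hz3 : |z| ≤ 3 := abs_le_of_sq_le_sq (by nlinarith [sq_nonneg x, sq_nonneg y]) (by norm_num)
  -- From `(x² + y²)² = (x² - y²)² + 4x²y²` one gets the bound `√8 N`, rounded up to `3N`.
  have hρ3 : (x ^ 2 + y ^ 2) * |Δ₃| ≤ 3 * N := by
    have hd : |(x ^ 2 - y ^ 2) * Δ₃| ≤ 2 * N := by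
      rw [abs_le] at *
      constructor <;> linarith [h00.1, h00.2, h11.1, h11.2]
    have h1 : ((x ^ 2 - y ^ 2) * Δ₃) ^ 2 ≤ (2 * N) ^ 2 := sq_le_sq' (abs_le.1 hd).1 (abs_le.1 hd).2
    have h2 : (x * y * Δ₃) ^ 2 ≤ N ^ 2 := sq_le_sq' (abs_le.1 h01).1 (abs_le.1 h01).2
    refine abs_le_of_sq_le_sq' ?_ (by linarith) |>.2
    rw [mul_pow, sq_abs]
    nlinarith
  -- The sum of the first two entries is `2Δ₁ - (x² + y²)Δ₃`.
  have hΔ : |Δ₁| ≤ 5 / 2 * N := by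
    have hx : |(x ^ 2 + y ^ 2) * Δ₃| ≤ 3 * N := by
      rw [abs_mul, abs_of_nonneg (by positivity)]; exact hρ3
    rw [abs_le] at *
    constructor <;> linarith [h00.1, h00.2, h11.1, h11.2, hx.1, hx.2]
  have hS0 : 0 < S₃ := by positivity
  -- Contracting the mixed entries with `(x, y)` costs `3N + 3N`, and removing the part with `Δ₃`
  -- costs another `9N`.
  have hμS : (x ^ 2 + y ^ 2) * (μ * S₃) ≤ 15 * N := by
    have h1 : |x * (x * (z * Δ₃ + μ * S₃))| ≤ 3 * N := by
      rw [abs_mul]; exact mul_le_mul hx3 h02 (abs_nonneg _) (by norm_num)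
    have h2 : |y * (y * (z * Δ₃ + μ * S₃))| ≤ 3 * N := by
      rw [abs_mul]; exact mul_le_mul hy3 h12 (abs_nonneg _) (by norm_num)
    have h3 : |z * ((x ^ 2 + y ^ 2) * Δ₃)| ≤ 3 * (3 * N) := by
      rw [abs_mul, abs_mul (x ^ 2 + y ^ 2), abs_of_nonneg (show 0 ≤ x ^ 2 + y ^ 2 by positivity)]
      exact mul_le_mul hz3 hρ3 (by positivity) (by norm_num)
    rw [abs_le] at h1 h2 h3
    nlinarith [h1.2, h2.2, h3.1]
  have hlowS : 2 / (4 + μ) ^ 3 ≤ S₃ := by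
    have h1 : 1 / (4 + μ) ^ 3 ≤ 1 / P ^ 3 :=
      one_div_le_one_div_of_le (by positivity) (pow_le_pow_left₀ hP.le hP4 3)
    have h2 : 1 / (4 + μ) ^ 3 ≤ 1 / M ^ 3 :=
      one_div_le_one_div_of_le (by positivity) (pow_le_pow_left₀ hM.le hM4 3)
    have : 2 / (4 + μ) ^ 3 = 1 / (4 + μ) ^ 3 + 1 / (4 + μ) ^ 3 := by ring
    linarith
  have hlowΔ : 2 / (4 + μ) ^ 3 * (μ * |z|) ≤ |Δ₁| := by
    have e : Δ₁ = -(4 * μ * z) / (P * M * (P + M)) := by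
      rw [hΔ₁, ← hPM]; field_simp; ring
    rw [e, abs_div, abs_neg, abs_mul, abs_of_pos (by positivity : 0 < 4 * μ),
      abs_of_pos (by positivity : 0 < P * M * (P + M)), div_mul_eq_mul_div,
      div_le_div_iff₀ (by positivity) (by positivity)]
    have h1 : P * M * (P + M) ≤ (4 + μ) * (4 + μ) * ((4 + μ) + (4 + μ)) := by gcongr
    have h2 : 0 ≤ μ * |z| := by positivity
    have h3 := mul_le_mul_of_nonneg_left h1 h2
    linarith
  have hz : z ^ 2 ≤ 3 * |z| := by rw [← sq_abs]; nlinarith [abs_nonneg z]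
  have hρ0 : 0 ≤ x ^ 2 + y ^ 2 := by positivity
  have h1 : (x ^ 2 + y ^ 2) * (μ * (2 / (4 + μ) ^ 3)) ≤ 15 * N :=
    (mul_le_mul_of_nonneg_left (mul_le_mul_of_nonneg_left hlowS hμ.le) hρ0).trans hμS
  -- Since `z² ≤ 3|z|`, the lower bound `1/4` passes to `3(x² + y² + |z|)`. The constant of the
  -- conclusion is `105 = 6 (15 + 5/2)`.
  have h2 : 1 / 12 ≤ x ^ 2 + y ^ 2 + |z| := by linarith [abs_nonneg z]
  have e1 : μ / (4 + μ) ^ 3 = 6 * (2 / (4 + μ) ^ 3 * μ * (1 / 12)) := by ring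
  have h3 : 2 / (4 + μ) ^ 3 * μ * (1 / 12) ≤ 2 / (4 + μ) ^ 3 * μ * (x ^ 2 + y ^ 2 + |z|) := by
    gcongr
  rw [e1]
  linarith

theorem norm_sq_eq_coords (η : E3) : ‖η‖ ^ 2 = η 0 ^ 2 + η 1 ^ 2 + η 2 ^ 2 := by
  rw [EuclideanSpace.norm_sq_eq, Fin.sum_univ_three]; simp

theorem sum_sq_twoPoint_neg_one_lower {κ μ : ℝ} (hκ : 0 < κ) (hκ1 : κ ≤ 1) (hμ : 0 < μ)
    {η : E3} (h2 : 1 / 2 ≤ ‖η‖) (h3 : ‖η‖ ≤ 3) :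
    (μ / (4 + μ) ^ 3 / 105) ^ 2 ≤ ∑ i, ∑ j, twoPoint (regHess κ i j) (-1) μ η ^ 2 := by
  set Q := ∑ i, ∑ j, twoPoint (regHess κ i j) (-1) μ η ^ 2 with hQ
  have hQ0 : 0 ≤ Q := Finset.sum_nonneg fun i _ => Finset.sum_nonneg fun j _ => sq_nonneg _
  have hent : ∀ i j, |twoPoint (regHess κ i j) (-1) μ η| ≤ √Q := by
    intro i j
    refine Real.le_sqrt_of_sq_le ?_
    rw [sq_abs]
    exact (Finset.single_le_sum (f := fun j => twoPoint (regHess κ i j) (-1) μ η ^ 2)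
      (fun _ _ => sq_nonneg _) (Finset.mem_univ j)).trans
      (Finset.single_le_sum (f := fun i => ∑ j, twoPoint (regHess κ i j) (-1) μ η ^ 2)
        (fun _ _ => Finset.sum_nonneg fun _ _ => sq_nonneg _) (Finset.mem_univ i))
  have hP := regNorm_pos hκ (η + μ • stdE 2)
  have hM := regNorm_pos hκ (η - μ • stdE 2)
  obtain ⟨hP4, hM4⟩ := regNorm_shift_le hκ hκ1 hμ h3
  have hP2 := regNorm_sq κ (η + μ • stdE 2)
  have hM2 := regNorm_sq κ (η - μ • stdE 2)
  rw [norm_add_smul_stdE] at hP2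
  rw [sub_eq_add_neg, ← neg_smul, norm_add_smul_stdE, neg_smul, ← sub_eq_add_neg] at hM2
  have hn := norm_sq_eq_coords η
  have key : μ / (4 + μ) ^ 3 ≤ 105 * √Q := by
    have c : ∀ i, (η + μ • stdE 2) i = η i + μ * kron 2 i ∧ (η - μ • stdE 2) i = η i - μ * kron 2 i :=
      fun i => by simp [stdE_apply]
    refine regHess_diff_lower (x := η 0) (y := η 1) (z := η 2) hμ hP hM hP4 hM4 (Real.sqrt_nonneg Q)
      (by linear_combination hP2 - hM2) (by rw [← hn]; nlinarith) (by rw [← hn]; nlinarith [norm_nonneg η])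
      ?_ ?_ ?_ ?_ ?_
    · refine le_of_eq_of_le (congrArg abs ?_) (hent 0 0)
      simp only [twoPoint, regHess, (c _).1, (c _).2, kron]; simp; ring
    · refine le_of_eq_of_le (congrArg abs ?_) (hent 1 1)
      simp only [twoPoint, regHess, (c _).1, (c _).2, kron]; simp; ring
    · rw [← abs_neg]
      refine le_of_eq_of_le (congrArg abs ?_) (hent 0 1)
      simp only [twoPoint, regHess, (c _).1, (c _).2, kron]; simp; ring
    · rw [← abs_neg]
      refine le_of_eq_of_le (congrArg abs ?_) (hent 0 2)
      simp only [twoPoint, regHess, (c _).1, (c _).2, kron]; simp; ring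
    · rw [← abs_neg]
      refine le_of_eq_of_le (congrArg abs ?_) (hent 1 2)
      simp only [twoPoint, regHess, (c _).1, (c _).2, kron]; simp; ring
  calc (μ / (4 + μ) ^ 3 / 105) ^ 2 ≤ √Q ^ 2 :=
        pow_le_pow_left₀ (by positivity) (by linarith) 2
    _ = Q := Real.sq_sqrt hQ0

/-- The regularized norm has Laplacian at least `2/regNorm`, and for the sum of two such functions
nothing cancels. The trace is bounded below, and it bounds the Hilbert-Schmidt norm from below by
Cauchy-Schwarz. The factor `105` is not needed here and only matches the case of the difference. -/
theorem sum_sq_twoPoint_one_lower {κ μ : ℝ} (hκ : 0 < κ) (hκ1 : κ ≤ 1) (hμ : 0 < μ)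
    {η : E3} (h3 : ‖η‖ ≤ 3) :
    (1 / (4 + μ) / 105) ^ 2 ≤ ∑ i, ∑ j, twoPoint (regHess κ i j) 1 μ η ^ 2 := by
  have htr : ∀ ζ : E3, 2 / regNorm κ ζ ≤ ∑ i, regHess κ i i ζ := by
    intro ζ
    have h0 := regNorm_pos hκ ζ
    have e : ∑ i, regHess κ i i ζ = 3 / regNorm κ ζ - ‖ζ‖ ^ 2 / regNorm κ ζ ^ 3 := by
      rw [norm_sq_eq_coords, Fin.sum_univ_three]
      simp only [regHess, kron_self]; ring
    have h1 : ‖ζ‖ ^ 2 / regNorm κ ζ ^ 3 ≤ 1 / regNorm κ ζ := by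
      rw [div_le_div_iff₀ (by positivity) h0]
      nlinarith [pow_le_pow_left₀ (norm_nonneg ζ) (norm_le_regNorm κ ζ) 2]
    have e2 : 3 / regNorm κ ζ = 2 / regNorm κ ζ + 1 / regNorm κ ζ := by ring
    rw [e, e2]; linarith
  obtain ⟨hP4, hM4⟩ := regNorm_shift_le hκ hκ1 hμ h3
  have hP := regNorm_pos hκ (η + μ • stdE 2)
  have hM := regNorm_pos hκ (η - μ • stdE 2)
  have h1 : 4 / (4 + μ) ≤ ∑ i, twoPoint (regHess κ i i) 1 μ η := by
    simp only [twoPoint, one_mul, Finset.sum_add_distrib]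
    have a := div_le_div_of_nonneg_left (show (0 : ℝ) ≤ 2 by norm_num) hP hP4
    have b := div_le_div_of_nonneg_left (show (0 : ℝ) ≤ 2 by norm_num) hM hM4
    have e : 4 / (4 + μ) = 2 / (4 + μ) + 2 / (4 + μ) := by ring
    linarith [htr (η + μ • stdE 2), htr (η - μ • stdE 2)]
  have h2 : (∑ i, twoPoint (regHess κ i i) 1 μ η) ^ 2 ≤
      3 * ∑ i, twoPoint (regHess κ i i) 1 μ η ^ 2 := by
    simpa using sq_sum_le_card_mul_sum_sq (s := Finset.univ)
      (f := fun i : Fin 3 => twoPoint (regHess κ i i) 1 μ η)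
  have h3' : ∑ i, twoPoint (regHess κ i i) 1 μ η ^ 2 ≤
      ∑ i, ∑ j, twoPoint (regHess κ i j) 1 μ η ^ 2 := Finset.sum_le_sum fun i _ =>
    Finset.single_le_sum (f := fun j => twoPoint (regHess κ i j) 1 μ η ^ 2)
      (fun _ _ => sq_nonneg _) (Finset.mem_univ i)
  have h4 : (4 / (4 + μ)) ^ 2 ≤ (∑ i, twoPoint (regHess κ i i) 1 μ η) ^ 2 :=
    pow_le_pow_left₀ (by positivity) h1 2
  have e : (4 / (4 + μ)) ^ 2 = 16 * (1 / (4 + μ)) ^ 2 := by ring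
  have p : 0 ≤ (1 / (4 + μ)) ^ 2 := by positivity
  rw [div_pow]
  linarith

/-- The size of the Hessian of the phase on the annulus, together with a bound of the same order
for the Hessian and the third derivatives, in terms of an integrable weight. -/
theorem exists_twoPoint_bounds {s μ : ℝ} (hs : s = 1 ∨ s = -1) (hμ : 0 < μ) :
    ∃ l : ℝ, μ / (4 + μ) ^ 3 ≤ l ∧ ∀ κ : ℝ, 0 < κ → κ ≤ 1 → ∀ η : E3, 1 / 2 ≤ ‖η‖ → ‖η‖ ≤ 3 →
      (l / 105) ^ 2 ≤ ∑ i, ∑ j, twoPoint (regHess κ i j) s μ η ^ 2 ∧ ∀ i j,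
        |twoPoint (regHess κ i j) s μ η| ≤ 400000 * l * twoPointWeight κ μ η ∧
        |twoPoint (regThird κ i j) s μ η| ≤ 400000 * l * twoPointWeight κ μ η := by
  have habs : |s| = 1 := by rcases hs with rfl | rfl <;> simp
  have fin : ∀ {a l w : ℝ}, a ≤ 400000 * l → 0 ≤ l → 1 ≤ w → a ≤ 400000 * l * w :=
    fun h hl hw => h.trans (le_mul_of_one_le_right (by positivity) hw)
  -- The size `l` is `1/(4+μ)` for the sum and `μ/(4+μ)³` for the difference. For bounded `μ` away
  -- from `0` the integrable weight suffices, and for `μ ≥ 6` both points are far away. For the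
  -- difference, small `μ` and large `μ` need the cancellation. The constant `400000` is dictated by
  -- small `μ`, where `4608 · 77` must be absorbed.
  rcases hs with rfl | rfl
  · refine ⟨1 / (4 + μ), ?_, fun κ hκ hκ1 η h2 h3 =>
      ⟨sum_sq_twoPoint_one_lower hκ hκ1 hμ h3, fun i j => ?_⟩⟩
    · rw [div_le_div_iff₀ (by positivity) (by positivity)]; nlinarith [sq_nonneg μ]
    have hw := one_le_twoPointWeight κ μ η
    have hl0 : 0 ≤ 1 / (4 + μ) := by positivity
    rcases le_total μ 6 with h6 | h6
    · have hl : 1 / 10 ≤ 1 / (4 + μ) := one_div_le_one_div_of_le (by positivity) (by linarith)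
      have : 6 * twoPointWeight κ μ η ≤ 400000 * (1 / (4 + μ)) * twoPointWeight κ μ η := by
        gcongr; linarith
      exact ⟨(twoPoint_regHess_le_weight hκ habs μ η i j).trans this,
        (twoPoint_regThird_le_weight hκ habs μ η i j).trans this⟩
    · have hl : 1 / (2 * μ) ≤ 1 / (4 + μ) := one_div_le_one_div_of_le (by positivity) (by linarith)
      have e : 8 / μ = 16 * (1 / (2 * μ)) := by field_simp; norm_num
      have e2 : 48 / μ ^ 2 ≤ 8 / μ := by
        rw [div_le_div_iff₀ (by positivity) (by positivity)]; nlinarith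
      exact ⟨fin ((twoPoint_regHess_le_far hκ habs h6 h3 i j).trans (by linarith)) hl0 hw,
        fin ((twoPoint_regThird_le_far hκ habs h6 h3 i j).trans (by linarith)) hl0 hw⟩
  · refine ⟨μ / (4 + μ) ^ 3, le_rfl, fun κ hκ hκ1 η h2 h3 =>
      ⟨sum_sq_twoPoint_neg_one_lower hκ hκ1 hμ h2 h3, fun i j => ?_⟩⟩
    have hw := one_le_twoPointWeight κ μ η
    have hl0 : 0 ≤ μ / (4 + μ) ^ 3 := by positivity
    rcases le_total μ (1 / 4) with h4 | h4
    · have hl : μ / 77 ≤ μ / (4 + μ) ^ 3 := by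
        refine div_le_div_of_nonneg_left hμ.le (by positivity) ?_
        exact (pow_le_pow_left₀ (by positivity) (by linarith : 4 + μ ≤ 17 / 4) 3).trans (by norm_num)
      obtain ⟨hH, hT⟩ := twoPoint_neg_one_le_near hκ hμ h4 h2 i j
      exact ⟨fin (hH.trans (by linarith)) hl0 hw, fin (hT.trans (by linarith)) hl0 hw⟩
    rcases le_total μ 6 with h6 | h6
    · have hl : (1 / 4) / 1000 ≤ μ / (4 + μ) ^ 3 := by
        refine div_le_div₀ hμ.le h4 (by positivity) ?_
        exact (pow_le_pow_left₀ (by positivity) (by linarith : 4 + μ ≤ 10) 3).trans (by norm_num)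
      have : 6 * twoPointWeight κ μ η ≤ 400000 * (μ / (4 + μ) ^ 3) * twoPointWeight κ μ η := by
        gcongr; linarith
      exact ⟨(twoPoint_regHess_le_weight hκ habs μ η i j).trans this,
        (twoPoint_regThird_le_weight hκ habs μ η i j).trans this⟩
    · have hl : μ / (2 * μ) ^ 3 ≤ μ / (4 + μ) ^ 3 := by
        refine div_le_div_of_nonneg_left hμ.le (by positivity) ?_
        exact pow_le_pow_left₀ (by positivity) (by linarith) 3
      have e : 144 / μ ^ 2 = 1152 * (μ / (2 * μ) ^ 3) := by field_simp; norm_num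
      have e2 : 48 / μ ^ 2 ≤ 144 / μ ^ 2 := by gcongr; norm_num
      exact ⟨fin ((twoPoint_regHess_neg_one_le_far hκ h6 h3 i j).trans (by linarith)) hl0 hw,
        fin ((twoPoint_regThird_le_far hκ habs h6 h3 i j).trans (by linarith)) hl0 hw⟩

/-! ### The dispersive estimate -/

/-- The function `|ζ|^{-2}` is integrable near the origin of three-dimensional space, and its
integral over the unit ball does not depend on the translation `b`. Elsewhere the integrand is at
most `1`. -/
theorem exists_integral_one_div_regNorm_sq_le :
    ∃ A : ℝ, ∀ (κ : ℝ) (b : E3), 0 < κ →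
      ∫ η in Metric.closedBall (0 : E3) 3, 1 / regNorm κ (η + b) ^ 2 ≤ A := by
  set g : E3 → ℝ := (Metric.ball (0 : E3) 1).indicator fun ζ => ‖ζ‖ ^ (-2 : ℝ) with hg
  have gi : Integrable g := by
    rw [hg, integrable_indicator_iff Metric.isOpen_ball.measurableSet]
    refine integrableOn_ball_of_norm_le_rpow (C := 1) (α := 2) (by simp) (by simp; norm_num)
      (Filter.Eventually.of_forall fun x => ?_) ?_
    · rw [one_mul, Real.norm_of_nonneg (by positivity)]
    · exact (measurable_norm.pow_const _).aestronglyMeasurable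
  have g0 : ∀ ζ, 0 ≤ g ζ := fun ζ => indicator_nonneg (fun x _ => by positivity) ζ
  refine ⟨volume.real (Metric.closedBall (0 : E3) 3) + ∫ ζ, g ζ, fun κ b hκ => ?_⟩
  have gib : Integrable fun η => g (η + b) := gi.comp_add_right b
  have hfin : volume (Metric.closedBall (0 : E3) 3) ≠ ∞ := measure_closedBall_lt_top.ne
  have hone : Integrable (fun _ : E3 => (1 : ℝ)) (volume.restrict (Metric.closedBall (0 : E3) 3)) :=
    integrableOn_const hfin
  have cont : Continuous fun η : E3 => 1 / regNorm κ (η + b) ^ 2 :=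
    continuous_const.div (((continuous_regNorm κ).comp (by fun_prop)).pow 2)
      fun η => pow_ne_zero _ (regNorm_pos hκ _).ne'
  have hae : ∀ᵐ η ∂(volume : Measure E3), 1 / regNorm κ (η + b) ^ 2 ≤ 1 + g (η + b) := by
    -- The point `-b` must be left out: there the real power `0 ^ (-2)` has the value `0` and does
    -- not dominate `1/κ²`.
    have : ∀ᵐ η : E3 ∂volume, η ≠ -b := by
      simp [ae_iff]
    filter_upwards [this] with η hη
    have hne : η + b ≠ 0 := fun h => hη (eq_neg_of_add_eq_zero_left h)
    have hn : 0 < ‖η + b‖ := norm_pos_iff.2 hne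
    by_cases hb : η + b ∈ Metric.ball (0 : E3) 1
    · have : 1 / regNorm κ (η + b) ^ 2 ≤ g (η + b) := by
        rw [hg, indicator_of_mem hb, Real.rpow_neg hn.le, Real.rpow_two, ← one_div]
        exact one_div_le_one_div_of_le (by positivity)
          (pow_le_pow_left₀ hn.le (norm_le_regNorm κ _) 2)
      linarith
    · have h1 : 1 ≤ regNorm κ (η + b) :=
        le_trans (by simpa using hb) (norm_le_regNorm κ _)
      have : 1 / regNorm κ (η + b) ^ 2 ≤ 1 := by
        rw [div_le_one (by positivity)]; exact one_le_pow₀ h1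
      linarith [g0 (η + b)]
  calc ∫ η in Metric.closedBall (0 : E3) 3, 1 / regNorm κ (η + b) ^ 2
      ≤ ∫ η in Metric.closedBall (0 : E3) 3, (1 + g (η + b)) := by
        refine integral_mono_ae ?_ ?_ (ae_restrict_of_ae hae)
        · exact cont.continuousOn.integrableOn_compact (isCompact_closedBall _ _)
        · exact (integrableOn_const hfin).add gib.integrableOn
    _ = volume.real (Metric.closedBall (0 : E3) 3)
        + ∫ η in Metric.closedBall (0 : E3) 3, g (η + b) := by
        rw [integral_add hone gib.integrableOn]; simp
    _ ≤ _ := by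
        gcongr
        refine (setIntegral_le_integral gib (Filter.Eventually.of_forall fun η => g0 _)).trans ?_
        rw [integral_add_right_eq_self g b]

theorem continuous_twoPointWeight {κ : ℝ} (hκ : 0 < κ) (μ : ℝ) :
    Continuous (twoPointWeight κ μ) := by
  have h : ∀ b : E3, Continuous fun η : E3 => 1 / regNorm κ (η + b) ^ 2 := fun b =>
    continuous_const.div (((continuous_regNorm κ).comp (by fun_prop)).pow 2)
      fun η => pow_ne_zero _ (regNorm_pos hκ _).ne'
  exact (continuous_const.add (h _)).add (by simpa only [sub_eq_add_neg] using h (-(μ • stdE 2)))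

theorem exists_integral_twoPointWeight_le :
    ∃ A : ℝ, 0 < A ∧ ∀ κ μ : ℝ, 0 < κ →
      ∫ η in Metric.closedBall (0 : E3) 3, twoPointWeight κ μ η ≤ A := by
  obtain ⟨A, hA⟩ := exists_integral_one_div_regNorm_sq_le
  refine ⟨|volume.real (Metric.closedBall (0 : E3) 3) + A + A| + 1, by positivity,
    fun κ μ hκ => le_trans ?_ (le_trans (le_abs_self _) (by linarith))⟩
  have h : ∀ b : E3, IntegrableOn (fun η : E3 => 1 / regNorm κ (η + b) ^ 2)
      (Metric.closedBall (0 : E3) 3) := fun b =>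
    (continuous_const.div (((continuous_regNorm κ).comp (by fun_prop)).pow 2)
      fun η => pow_ne_zero _ (regNorm_pos hκ _).ne').continuousOn.integrableOn_compact
        (isCompact_closedBall _ _)
  have hfin : volume (Metric.closedBall (0 : E3) 3) ≠ ∞ := measure_closedBall_lt_top.ne
  have hone : Integrable (fun _ : E3 => (1 : ℝ)) (volume.restrict (Metric.closedBall (0 : E3) 3)) :=
    integrableOn_const hfin
  have h2 := h (-(μ • stdE 2))
  have h3 := hA κ (-(μ • stdE 2)) hκ
  simp only [← sub_eq_add_neg] at h2 h3
  unfold twoPointWeight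
  rw [integral_add (f := fun η : E3 => 1 + 1 / regNorm κ (η + μ • stdE 2) ^ 2)
    (hone.add (h _)) h2, integral_add hone (h _)]
  have h4 := hA κ (μ • stdE 2) hκ
  have h5 : ∫ _ in Metric.closedBall (0 : E3) 3, (1 : ℝ) = volume.real (Metric.closedBall (0 : E3) 3) := by
    simp
  rw [h5]; linarith

theorem twoPoint_hasLineDerivAt {f f' : E3 → ℝ} {v : E3} (s μ : ℝ)
    (h : ∀ x, HasLineDerivAt ℝ f (f' x) x v) (x : E3) :
    HasLineDerivAt ℝ (twoPoint f s μ) (twoPoint f' s μ x) x v := by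
  have h1 := HasLineDerivAt.shift (μ • stdE 2) (h (x + μ • stdE 2))
  have h2 := HasLineDerivAt.shift (-(μ • stdE 2)) (h (x + -(μ • stdE 2)))
  simp only [← sub_eq_add_neg] at h2
  exact HasDerivAt.add h1 (HasDerivAt.const_mul s h2)

theorem continuous_twoPoint {f : E3 → ℝ} (s μ : ℝ) (h : Continuous f) :
    Continuous (twoPoint f s μ) := by
  unfold twoPoint; fun_prop

theorem phase_eq_twoPoint (a s μ : ℝ) (η : E3) :
    phase a s μ η = a * twoPoint (regNorm 0) s μ η := by
  have h1 := norm_add_smul_stdE η 2 μ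
  have h2 := norm_add_smul_stdE η 2 (-μ)
  rw [neg_smul, ← sub_eq_add_neg] at h2
  unfold phase twoPoint regNorm
  rw [h1, h2]
  ring_nf

theorem hasLineDerivAt_inner (x η : E3) (i : Fin 3) :
    HasLineDerivAt ℝ (fun η : E3 => inner ℝ x η) (x i) η (stdE i) := by
  have : HasDerivAt (fun t : ℝ => inner ℝ x η + t * x i) (x i) 0 := by
    simpa using ((hasDerivAt_id (0 : ℝ)).mul_const (x i)).const_add (inner ℝ x η)
  simpa [HasLineDerivAt, inner_add_right, inner_smul_right, stdE,
    EuclideanSpace.inner_single_right] using this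

/-- The vector `x` enters only the gradient of the phase, not its higher derivatives, and the bounds
on these do not depend on `κ`. Hence the constant is uniform in both. The Hessian and the third
derivatives are of the same order `l |τ|` up to an integrable weight, as the second derivative test
requires. -/
theorem exists_regularized_dispersive {ψ : E3 → ℝ} (hψ : ContDiff ℝ 1 ψ) (h0 : ∀ η, 0 ≤ ψ η)
    (hsupp : tsupport ψ ⊆ {η | 1 / 2 ≤ ‖η‖ ∧ ‖η‖ ≤ 3}) {s : ℝ} (hs : s = 1 ∨ s = -1) :
    ∃ C : ℝ, 0 ≤ C ∧ ∀ (κ μ τ : ℝ) (x : E3), 0 < κ → κ ≤ 1 → 0 < μ → τ ≠ 0 →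
      ‖∫ η : E3, Complex.exp (Complex.I *
        ((inner ℝ x η + τ * twoPoint (regNorm κ) s μ η : ℝ) : ℂ)) * (ψ η : ℂ)‖ ≤
      C / √(μ / (4 + μ) ^ 3 * |τ|) := by
  obtain ⟨A, hA0, hA⟩ := exists_integral_twoPointWeight_le
  have hball : tsupport ψ ⊆ Metric.closedBall 0 3 := fun η hη => by simpa using (hsupp hη).2
  have sψ : HasCompactSupport ψ :=
    (isCompact_closedBall (0 : E3) 3).of_isClosed_subset (isClosed_tsupport ψ) hball
  set dψ : Fin 3 → E3 → ℝ := fun i η => fderiv ℝ ψ η (stdE i) with hdψdef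
  have cdψ : ∀ i, Continuous (dψ i) := fun i =>
    (hψ.continuous_fderiv one_ne_zero).clm_apply continuous_const
  have sdψ : ∀ i, HasCompactSupport (dψ i) := fun i => sψ.fderiv_apply ℝ (stdE i)
  have hdψ : ∀ i η, HasLineDerivAt ℝ ψ (dψ i η) η (stdE i) := fun i η =>
    ((hψ.differentiable one_ne_zero) η).hasFDerivAt.hasLineDerivAt _
  have dψ0 : ∀ i η, η ∉ tsupport ψ → dψ i η = 0 := fun i η hη => by
    simp [hdψdef, fderiv_of_notMem_tsupport ℝ hη]
  obtain ⟨M₀, hM₀⟩ := hψ.continuous.bounded_above_of_compact_support sψ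
  choose M₁ hM₁ using fun i => (cdψ i).bounded_above_of_compact_support (sdψ i)
  set M := |M₀| + ∑ i, |M₁ i| with hM
  have hMsum : ∀ i, |M₁ i| ≤ ∑ i, |M₁ i| := fun i =>
    Finset.single_le_sum (f := fun i => |M₁ i|) (fun _ _ => abs_nonneg _) (Finset.mem_univ i)
  have hMψ : ∀ η, ψ η ≤ M := fun η => by
    have := hM₀ η
    rw [Real.norm_of_nonneg (h0 η)] at this
    linarith [le_abs_self M₀, hMsum 0, abs_nonneg (M₁ 0)]
  have hMd : ∀ i η, |dψ i η| ≤ M := fun i η => by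
    have := hM₁ i η
    rw [Real.norm_eq_abs] at this
    linarith [le_abs_self (M₁ i), hMsum i, abs_nonneg M₀]
  have hM0 : 0 ≤ M := (h0 0).trans (hMψ 0)
  set L := ∑ j, ∫ x, |dψ j x|
  have hL : 0 ≤ L := Finset.sum_nonneg fun j _ => integral_nonneg fun x => abs_nonneg _
  -- Nine entries, two terms of size `400000` each, and `105` to pass from `|τ| l` to `Λ = |τ| l /
  -- 105`.
  set B := 105 * 9 * 800000 * M * A with hB
  have hB0 : 0 ≤ B := by positivity
  refine ⟨(L + 20 * B) * √105, by positivity, fun κ μ τ x hκ hκ1 hμ hτ => ?_⟩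
  obtain ⟨l, hl, hbd⟩ := exists_twoPoint_bounds hs hμ
  have hμ3 : 0 < μ / (4 + μ) ^ 3 := by positivity
  have hl0 : 0 < l := hμ3.trans_le hl
  have hτ0 : 0 < |τ| := abs_pos.2 hτ
  have main := norm_integral_exp_mul_le stdE (Λ := |τ| * (l / 105)) (B := B)
    (Φ := fun η => inner ℝ x η + τ * twoPoint (regNorm κ) s μ η) (ψ := ψ) (dψ := dψ)
    (G := fun j η => x j + τ * twoPoint (fun ζ : E3 => ζ j / regNorm κ ζ) s μ η)
    (H := fun i j η => τ * twoPoint (regHess κ i j) s μ η)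
    (T := fun i j η => τ * twoPoint (regThird κ i j) s μ η) (by positivity)
    ((continuous_const.inner continuous_id).add
      (continuous_const.mul (continuous_twoPoint s μ (continuous_regNorm κ))))
    hψ.continuous cdψ
    (fun j => continuous_const.add (continuous_const.mul (continuous_twoPoint s μ
      (Continuous.div (by fun_prop) (continuous_regNorm κ) fun ζ => (regNorm_pos hκ ζ).ne'))))
    (fun i j => continuous_const.mul (continuous_twoPoint s μ (continuous_regHess hκ i j)))
    (fun i j => continuous_const.mul (continuous_twoPoint s μ (continuous_regThird hκ i j)))
    sψ sdψ h0
    (fun i η => HasDerivAt.add (hasLineDerivAt_inner x η i) (HasDerivAt.const_mul τ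
      (twoPoint_hasLineDerivAt s μ (hasLineDerivAt_regNorm hκ i) η)))
    (fun i j η => HasDerivAt.const_add (x j) (HasDerivAt.const_mul τ
      (twoPoint_hasLineDerivAt s μ (hasLineDerivAt_regGrad hκ i j) η)))
    (fun i j η => HasDerivAt.const_mul τ
      (twoPoint_hasLineDerivAt s μ (hasLineDerivAt_regHess hκ i j) η))
    hdψ ?_ ?_
  · refine main.trans ?_
    rw [div_le_div_iff₀ (Real.sqrt_pos.2 (by positivity)) (Real.sqrt_pos.2 (by positivity)),
      mul_assoc]
    refine mul_le_mul_of_nonneg_left ?_ (by positivity)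
    rw [← Real.sqrt_mul (by norm_num)]
    refine Real.sqrt_le_sqrt ?_
    nlinarith [mul_le_mul_of_nonneg_right hl hτ0.le]
  · intro η hη
    have hmem := hsupp (subset_tsupport ψ hη)
    have := (hbd κ hκ hκ1 η hmem.1 hmem.2).1
    simp only [mul_pow, ← Finset.mul_sum, sq_abs]
    exact mul_le_mul_of_nonneg_left (by simpa [mul_pow] using this) (sq_nonneg τ)
  · have hij : ∀ i j, ∫ η, (|τ * twoPoint (regThird κ i j) s μ η| * ψ η
        + |τ * twoPoint (regHess κ i j) s μ η| * |dψ i η|) ≤ 800000 * M * A * |τ| * l := by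
      intro i j
      rw [← setIntegral_eq_integral_of_forall_compl_eq_zero (s := Metric.closedBall (0 : E3) 3)]
      swap
      · intro η hη
        have h1 : η ∉ tsupport ψ := fun h => hη (hball h)
        rw [dψ0 i η h1, image_eq_zero_of_notMem_tsupport h1]; simp
      calc _ ≤ ∫ η in Metric.closedBall (0 : E3) 3,
            (800000 * M * |τ| * l) * twoPointWeight κ μ η := by
            refine integral_mono_of_nonneg (Filter.Eventually.of_forall fun η => ?_) ?_
              (Filter.Eventually.of_forall fun η => ?_)
            · have := h0 η; positivity
            · exact ((continuous_twoPointWeight hκ μ).continuousOn.integrableOn_compact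
                (isCompact_closedBall _ _)).const_mul _
            · have hw := one_le_twoPointWeight κ μ η
              by_cases h1 : η ∈ tsupport ψ
              · obtain ⟨hH, hT⟩ := (hbd κ hκ hκ1 η (hsupp h1).1 (hsupp h1).2).2 i j
                simp only [abs_mul]
                have a1 := mul_le_mul (mul_le_mul_of_nonneg_left hT hτ0.le) (hMψ η) (h0 η)
                  (by positivity)
                have a2 := mul_le_mul (mul_le_mul_of_nonneg_left hH hτ0.le) (hMd i η)
                  (abs_nonneg _) (by positivity)
                refine (add_le_add a1 a2).trans (le_of_eq ?_)
                ring
              · simp only [dψ0 i η h1, image_eq_zero_of_notMem_tsupport h1, abs_zero, mul_zero,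
                  add_zero]
                positivity
        _ ≤ _ := by
            rw [integral_const_mul]
            have := mul_le_mul_of_nonneg_left (hA κ μ hκ)
              (show 0 ≤ 800000 * M * |τ| * l by positivity)
            linarith
    refine (Finset.sum_le_sum fun i _ => Finset.sum_le_sum fun j _ => hij i j).trans (le_of_eq ?_)
    simp only [Finset.sum_const, Finset.card_univ, Fintype.card_fin, nsmul_eq_mul, hB]
    push_cast; ring

/-- The regularization is removed by dominated convergence along `κ = 1/(n+1)`, since the integrand
is always bounded by `|ψ|`. -/
theorem exists_dispersive_unit {ψ : E3 → ℝ} (hψ : ContDiff ℝ 1 ψ) (h0 : ∀ η, 0 ≤ ψ η)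
    (hsupp : tsupport ψ ⊆ {η | 1 / 2 ≤ ‖η‖ ∧ ‖η‖ ≤ 3}) {s : ℝ} (hs : s = 1 ∨ s = -1) :
    ∃ C : ℝ, 0 ≤ C ∧ ∀ (μ τ : ℝ) (x : E3), 0 < μ → τ ≠ 0 →
      ‖∫ η : E3, Complex.exp (Complex.I *
        ((inner ℝ x η + τ * phase 1 s μ η : ℝ) : ℂ)) * (ψ η : ℂ)‖ ≤
      C / √(μ / (4 + μ) ^ 3 * |τ|) := by
  obtain ⟨C, hC, h⟩ := exists_regularized_dispersive hψ h0 hsupp hs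
  refine ⟨C, hC, fun μ τ x hμ hτ => ?_⟩
  simp only [phase_eq_twoPoint, one_mul]
  have sψ : HasCompactSupport ψ :=
    (isCompact_closedBall (0 : E3) 3).of_isClosed_subset (isClosed_tsupport ψ)
      fun η hη => by simpa using (hsupp hη).2
  have hlim : Filter.Tendsto (fun n : ℕ => ∫ η : E3, Complex.exp (Complex.I *
      ((inner ℝ x η + τ * twoPoint (regNorm (1 / ((n : ℝ) + 1))) s μ η : ℝ) : ℂ)) * (ψ η : ℂ))
      Filter.atTop (nhds (∫ η : E3, Complex.exp (Complex.I *
      ((inner ℝ x η + τ * twoPoint (regNorm 0) s μ η : ℝ) : ℂ)) * (ψ η : ℂ))) := by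
    refine tendsto_integral_of_dominated_convergence (fun η => ‖ψ η‖) (fun n => ?_)
      (hψ.continuous.integrable_of_hasCompactSupport sψ).norm
      (fun n => Filter.Eventually.of_forall fun η => ?_)
      (Filter.Eventually.of_forall fun η => ?_)
    · refine Continuous.aestronglyMeasurable (Continuous.mul (Complex.continuous_exp.comp
        (continuous_const.mul (Complex.continuous_ofReal.comp
          ((continuous_const.inner continuous_id).add
          (continuous_const.mul (continuous_twoPoint s μ (continuous_regNorm _)))))))
        (Complex.continuous_ofReal.comp hψ.continuous))
    · rw [norm_mul, mul_comm Complex.I, Complex.norm_exp_ofReal_mul_I, one_mul, Complex.norm_real]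
    · have hc : Continuous fun κ : ℝ => Complex.exp (Complex.I *
          ((inner ℝ x η + τ * twoPoint (regNorm κ) s μ η : ℝ) : ℂ)) * (ψ η : ℂ) := by
        unfold twoPoint regNorm; fun_prop
      exact (hc.tendsto 0).comp tendsto_one_div_add_atTop_nhds_zero_nat
  refine le_of_tendsto hlim.norm (Filter.Eventually.of_forall fun n => ?_)
  refine h _ μ τ x (by positivity) ?_ hμ hτ
  rw [div_le_one (by positivity)]
  linarith [Nat.cast_nonneg (α := ℝ) n]

/-! ### Rescaling to frequency `2^k` and the factor `𝓜_k` -/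

theorem nu_pos {γ ε δ : ℝ} (hγ : 1 < γ) (hε : 0 < ε) (hδ : 0 < δ) : 0 < nu γ ε δ := by
  have : 0 < γ - 1 := by linarith
  unfold nu; positivity

theorem calM_pos {ν : ℝ} (hν : 0 < ν) (k : ℤ) : 0 < calM ν k := by
  unfold calM; split_ifs <;> positivity

/-- With `μ = 2^{-k} ν`, the two cases of `𝓜_k` are `μ ≤ 60`, where `4 + μ ≤ 64`, and `μ > 60`,
where `4 + μ ≤ 64 μ` and `𝓜_k = μ³`. -/
theorem cube_le_calM {ν : ℝ} (hν : 0 < ν) (k : ℤ) :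
    (4 + (2 : ℝ) ^ (-k) * ν) ^ 3 ≤ 64 ^ 3 * calM ν k := by
  set μ := (2 : ℝ) ^ (-k) * ν with hμ
  have hμ0 : 0 < μ := by positivity
  unfold calM
  split_ifs with h
  · rw [mul_one]
    refine pow_le_pow_left₀ (by positivity) ?_ 3
    rw [Real.logb_le_iff_le_rpow (by norm_num) (by positivity), Real.rpow_intCast] at h
    have : μ ≤ 60 := by
      rw [hμ, zpow_neg, inv_mul_le_iff₀ (by positivity)]; linarith
    linarith
  · rw [not_le, Real.lt_logb_iff_rpow_lt (by norm_num) (by positivity), Real.rpow_intCast] at h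
    have h60 : 60 < μ := by
      rw [hμ, zpow_neg, lt_inv_mul_iff₀ (by positivity)]; linarith
    have e : ν ^ 3 / (2 : ℝ) ^ (3 * k) = μ ^ 3 := by
      rw [hμ, mul_pow, zpow_neg, inv_pow, ← zpow_natCast ((2 : ℝ) ^ k), ← zpow_mul, mul_comm k]
      field_simp
      rfl
    rw [e, ← mul_pow]
    exact pow_le_pow_left₀ (by positivity) (by linarith) 3

/-- The phase is homogeneous of degree one in `(ξ, ν)` jointly. -/
theorem phase_scale (a s ν : ℝ) {c : ℝ} (hc : 0 < c) (ξ : E3) :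
    phase a s ν ξ = a * c⁻¹ * phase 1 s (c * ν) (c • ξ) := by
  have h : ∀ u v w : ℝ, √(u ^ 2 + v ^ 2 + w) = c⁻¹ * √((c * u) ^ 2 + (c * v) ^ 2 + c ^ 2 * w) := by
    intro u v w
    have : (c * u) ^ 2 + (c * v) ^ 2 + c ^ 2 * w = c ^ 2 * (u ^ 2 + v ^ 2 + w) := by ring
    rw [this, Real.sqrt_mul (by positivity), Real.sqrt_sq hc.le]
    field_simp
  have h1 := h ‖ξ‖ ν (2 * ν * ξ 2)
  have h2 := h ‖ξ‖ ν (-(2 * ν * ξ 2))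
  simp only [← sub_eq_add_neg, mul_neg] at h2
  unfold phase
  rw [h1, h2, norm_smul, Real.norm_of_nonneg hc.le, PiLp.smul_apply, smul_eq_mul]
  ring_nf

/-- After rescaling by `c = 2^{-k}`, the parameters are `μ = cν` and `τ = a t/(cδ)`. The powers of
`c` cancel in `μ τ`, and `δ/ν = (γ-1)ε/2` leaves `ε (4 + cν)³/|t|` up to a constant. The Jacobian
gives `2^{3k}`. -/
theorem exists_dispersive {γ : ℝ} (hγ : 1 < γ) {a : ℝ} (ha : a ≠ 0) {s : ℝ} (hs : s = 1 ∨ s = -1)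
    {ψ : E3 → ℝ} (hψ : ContDiff ℝ 1 ψ) (h0 : ∀ η, 0 ≤ ψ η)
    (hsupp : tsupport ψ ⊆ {η | 1 / 2 ≤ ‖η‖ ∧ ‖η‖ ≤ 3}) :
    ∃ C : ℝ, 0 ≤ C ∧ ∀ (ε δ : ℝ), 0 < ε → 0 < δ → ∀ (k : ℤ) (t : ℝ) (x : E3), t ≠ 0 →
      ‖∫ ξ : E3, Complex.exp (Complex.I *
        ((inner ℝ x ξ + t / δ * phase a s (nu γ ε δ) ξ : ℝ) : ℂ)) *
          (ψ ((2 : ℝ) ^ (-k) • ξ) : ℂ)‖ ≤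
      C * (2 : ℝ) ^ (3 * k) * √(calM (nu γ ε δ) k * ε / |t|) := by
  obtain ⟨C, hC, h⟩ := exists_dispersive_unit hψ h0 hsupp hs
  have hg1 : γ - 1 ≠ 0 := sub_ne_zero.2 hγ.ne'
  have hg : 0 < (γ - 1) / 2 := by linarith
  set K := 64 ^ 3 * ((γ - 1) / 2) / |a| with hK
  have ha0 : 0 < |a| := abs_pos.2 ha
  refine ⟨C * √K, by positivity, fun ε δ hε hδ k t x ht => ?_⟩
  set ν := nu γ ε δ with hν
  have hν0 : 0 < ν := nu_pos hγ hε hδ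
  set c := (2 : ℝ) ^ (-k) with hc
  have hc0 : 0 < c := by positivity
  have ht0 : 0 < |t| := abs_pos.2 ht
  have hτ : t / δ * (a * c⁻¹) ≠ 0 := by positivity
  set f : E3 → ℂ := fun η : E3 => Complex.exp (Complex.I * ((inner ℝ (c⁻¹ • x) η
    + t / δ * (a * c⁻¹) * phase 1 s (c * ν) η : ℝ) : ℂ)) * (ψ η : ℂ) with hf
  have hscale : ∀ ξ : E3, Complex.exp (Complex.I *
        ((inner ℝ x ξ + t / δ * phase a s ν ξ : ℝ) : ℂ)) * (ψ (c • ξ) : ℂ) =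
      f (c • ξ) := by
    intro ξ
    simp only [hf, phase_scale a s ν hc0, inner_smul_left, inner_smul_right, mul_assoc]
    simp [hc0.ne']
  rw [integral_congr_ae (Filter.Eventually.of_forall hscale), 
    Measure.integral_comp_smul volume f c, norm_smul]
  have h1 := h (c * ν) (t / δ * (a * c⁻¹)) (c⁻¹ • x) (by positivity) hτ
  have e3 : ‖|(c ^ Module.finrank ℝ E3)⁻¹|‖ = (2 : ℝ) ^ (3 * k) := by
    simp only [norm_abs_eq_norm, finrank_euclideanSpace_fin]
    rw [Real.norm_of_nonneg (by positivity), hc, ← zpow_natCast, ← zpow_mul, ← zpow_neg]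
    congr 1; push_cast; ring
  rw [e3]
  have h2 : C / √(c * ν / (4 + c * ν) ^ 3 * |t / δ * (a * c⁻¹)|) ≤
      C * √K * √(calM ν k * ε / |t|) := by
    rw [mul_assoc, ← Real.sqrt_mul (by positivity), div_eq_mul_inv, ← Real.sqrt_inv]
    refine mul_le_mul_of_nonneg_left (Real.sqrt_le_sqrt ?_) hC
    have habs : |t / δ * (a * c⁻¹)| = |t| / δ * (|a| * c⁻¹) := by
      rw [abs_mul, abs_div, abs_mul, abs_of_pos hδ, abs_of_pos (inv_pos.2 hc0)]
    have hνε : δ = (γ - 1) / 2 * ε * ν := by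
      rw [hν, nu]; field_simp
    have e : (c * ν / (4 + c * ν) ^ 3 * (|t| / δ * (|a| * c⁻¹)))⁻¹ =
        (4 + c * ν) ^ 3 * (((γ - 1) / 2) / |a| * (ε / |t|)) := by
      have : δ / ν = (γ - 1) / 2 * ε := by rw [hνε]; field_simp
      calc _ = (4 + c * ν) ^ 3 * (δ / ν) / (|a| * |t|) := by field_simp
        _ = _ := by rw [this]; field_simp
    rw [habs, e]
    have h3 := mul_le_mul_of_nonneg_right (cube_le_calM hν0 k)
      (show 0 ≤ ((γ - 1) / 2) / |a| * (ε / |t|) by positivity)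
    refine h3.trans (le_of_eq ?_)
    rw [hK]; ring
  calc _ ≤ (2 : ℝ) ^ (3 * k) * (C * √K * √(calM ν k * ε / |t|)) :=
        mul_le_mul_of_nonneg_left (h1.trans h2) (by positivity)
    _ = _ := by ring

/-! ### The Hardy–Littlewood–Sobolev inequality with kernel `|t|^{-1/2}` -/

/-- The kernel `|t|^{-1/2}`. -/
def sqrtKernel (t : ℝ) : ℝ≥0∞ := ENNReal.ofReal (|t| ^ (-(1 / 2) : ℝ))

theorem measurable_sqrtKernel : Measurable sqrtKernel := by
  unfold sqrtKernel; fun_prop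

theorem sqrtKernel_sub_comm (s t : ℝ) : sqrtKernel (s - t) = sqrtKernel (t - s) := by
  simp [sqrtKernel, abs_sub_comm]

theorem lintegral_comp_abs_eq {h : ℝ → ℝ≥0∞} :
    ∫⁻ u, h |u| = 2 * ∫⁻ u in Ioi 0, h u := by
  rw [← lintegral_add_compl _ (measurableSet_Ioi (a := (0 : ℝ))), compl_Ioi, two_mul]
  congr 1
  · exact setLIntegral_congr_fun measurableSet_Ioi fun u hu => by simp [abs_of_pos (mem_Ioi.1 hu)]
  · rw [setLIntegral_congr Iio_ae_eq_Iic.symm]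
    have e : Iio (0 : ℝ) = (fun x => -x) ⁻¹' (Ioi 0) := by ext; simp
    have := (Measure.measurePreserving_neg (volume : Measure ℝ)).setLIntegral_comp_preimage_emb
      (MeasurableEquiv.neg ℝ).measurableEmbedding h (Ioi 0)
    rw [← this]
    change _ = ∫⁻ a in (fun x => -x) ⁻¹' (Ioi (0 : ℝ)), h (-a)
    rw [← e]
    exact setLIntegral_congr_fun measurableSet_Iio fun u hu => by simp [abs_of_neg (mem_Iio.1 hu)]

/-- The kernel is split at `|u| = R` into a part in `L¹` and a part in `L⁴`, the exponent dual to
`4/3`; the kernel itself lies only in weak `L²`. -/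
theorem lintegral_sqrtKernel_near {R : ℝ} (hR : 0 < R) :
    ∫⁻ u, (if |u| ≤ R then sqrtKernel u else 0) = ENNReal.ofReal (4 * R ^ (1 / 2 : ℝ)) := by
  have h1 : ∀ u : ℝ, (if |u| ≤ R then sqrtKernel u else 0) =
      (fun v : ℝ => if v ≤ R then ENNReal.ofReal (v ^ (-(1 / 2) : ℝ)) else 0) |u| := fun u => by
    simp [sqrtKernel]
  simp_rw [h1]
  rw [lintegral_comp_abs_eq (h := fun v : ℝ => if v ≤ R then ENNReal.ofReal (v ^ (-(1 / 2) : ℝ)) else 0)]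
  have h2 : ∫⁻ u in Ioi (0 : ℝ), (if u ≤ R then ENNReal.ofReal (u ^ (-(1 / 2) : ℝ)) else 0) =
      ∫⁻ u in Ioc 0 R, ENNReal.ofReal (u ^ (-(1 / 2) : ℝ)) := by
    rw [← Ioi_inter_Iic, inter_comm, ← Measure.restrict_restrict measurableSet_Iic,
      ← lintegral_indicator measurableSet_Iic]
    simp [indicator]
  have hi : IntegrableOn (fun u : ℝ => u ^ (-(1 / 2) : ℝ)) (Ioc 0 R) :=
    (intervalIntegrable_iff_integrableOn_Ioc_of_le hR.le).1
      (intervalIntegral.intervalIntegrable_rpow' (by norm_num))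
  rw [h2, ← ofReal_integral_eq_lintegral_ofReal hi
    ((ae_restrict_iff' measurableSet_Ioc).2 (Filter.Eventually.of_forall fun u hu =>
      Real.rpow_nonneg hu.1.le _)), ← intervalIntegral.integral_of_le hR.le,
    integral_rpow (Or.inl (by norm_num))]
  rw [← ENNReal.ofReal_ofNat, ← ENNReal.ofReal_mul (by norm_num)]
  congr 1
  norm_num
  ring

theorem lintegral_sqrtKernel_far {R : ℝ} (hR : 0 < R) :
    ∫⁻ u, (if |u| ≤ R then 0 else sqrtKernel u) ^ (4 : ℝ) = ENNReal.ofReal (2 / R) := by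
  have h1 : ∀ u : ℝ, (if |u| ≤ R then 0 else sqrtKernel u) ^ (4 : ℝ) =
      (fun v : ℝ => if v ≤ R then 0 else ENNReal.ofReal (v ^ (-(1 / 2) : ℝ)) ^ (4 : ℝ)) |u| :=
    fun u => by
      by_cases h : |u| ≤ R <;> simp [sqrtKernel, h]
  simp_rw [h1]
  rw [lintegral_comp_abs_eq
    (h := fun v : ℝ => if v ≤ R then 0 else ENNReal.ofReal (v ^ (-(1 / 2) : ℝ)) ^ (4 : ℝ))]
  have h2 : ∫⁻ u in Ioi (0 : ℝ), (if u ≤ R then 0 else ENNReal.ofReal (u ^ (-(1 / 2) : ℝ)) ^ (4 : ℝ)) =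
      ∫⁻ u in Ioi R, ENNReal.ofReal (u ^ (-2 : ℝ)) := by
    have e : Ioi R = Ioi R ∩ Ioi 0 := by
      rw [Ioi_inter_Ioi, max_eq_left hR.le]
    rw [e, ← Measure.restrict_restrict (measurableSet_Ioi (a := R)),
      ← lintegral_indicator (measurableSet_Ioi (a := R))]
    refine setLIntegral_congr_fun measurableSet_Ioi fun u hu => ?_
    have hu0 : 0 < u := hu
    by_cases h : u ≤ R
    · simp [h, indicator]
    · have h' : R < u := not_le.1 h
      simp only [h, if_false, indicator, mem_Ioi, h', if_true]
      rw [ENNReal.ofReal_rpow_of_nonneg (by positivity) (by norm_num), ← Real.rpow_mul hu0.le]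
      norm_num
  rw [h2, ← ofReal_integral_eq_lintegral_ofReal (integrableOn_Ioi_rpow_of_lt (by norm_num) hR)
    ((ae_restrict_iff' measurableSet_Ioi).2 (Filter.Eventually.of_forall fun u hu =>
      Real.rpow_nonneg (hR.le.trans (le_of_lt hu)) _)), integral_Ioi_rpow_of_lt (by norm_num) hR]
  rw [← ENNReal.ofReal_ofNat, ← ENNReal.ofReal_mul (by norm_num)]
  congr 1
  norm_num
  rw [Real.rpow_neg_one]
  ring

/-- Truncated potentials are bounded by a power of the truncation height. -/
theorem lintegral_truncated_mul_sqrtKernel_le {g : ℝ → ℝ≥0∞} (hg : Measurable g)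
    (hg1 : ∫⁻ s, g s ^ (4 / 3 : ℝ) ≤ 1) (t : ℝ) (a : ℝ≥0∞) :
    ∫⁻ s, (if g s ≤ a then g s else 0) * sqrtKernel (t - s) ≤ 6 * a ^ (1 / 3 : ℝ) := by
  rcases eq_or_ne a 0 with rfl | ha0
  · refine le_of_eq_of_le (lintegral_eq_zero_of_ae_eq_zero ?_) zero_le
    refine Filter.Eventually.of_forall fun s => ?_
    by_cases h : g s ≤ 0
    · simp [nonpos_iff_eq_zero.1 h]
    · simp [h]
  rcases eq_or_ne a ∞ with rfl | hat
  · simp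
  lift a to NNReal using hat
  have ha : 0 < (a : ℝ) := by
    have : a ≠ 0 := by simpa using ha0
    positivity
  -- This radius balances the two parts: `4 a R^{1/2} = 4 a^{1/3}` and `(2/R)^{1/4} = 2^{1/4}
  -- a^{1/3}`.
  set R : ℝ := (a : ℝ) ^ (-(4 / 3) : ℝ) with hRdef
  have hR : 0 < R := by positivity
  have hsplit : ∀ s, (if g s ≤ a then g s else 0) * sqrtKernel (t - s) ≤
      a * (if |t - s| ≤ R then sqrtKernel (t - s) else 0)
        + g s * (if |t - s| ≤ R then 0 else sqrtKernel (t - s)) := by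
    intro s
    by_cases h : g s ≤ a <;> by_cases h' : |t - s| ≤ R <;> simp [h, h']
    · gcongr
  have hmk : Measurable fun u : ℝ => if |u| ≤ R then sqrtKernel u else 0 :=
    Measurable.ite (measurableSet_le (by fun_prop) measurable_const) measurable_sqrtKernel
      measurable_const
  have hmk' : Measurable fun u : ℝ => if |u| ≤ R then 0 else sqrtKernel u :=
    Measurable.ite (measurableSet_le (by fun_prop) measurable_const) measurable_const
      measurable_sqrtKernel
  have hms : Measurable fun s : ℝ => t - s := by fun_prop
  have hmN : Measurable fun s : ℝ => if |t - s| ≤ R then sqrtKernel (t - s) else 0 := hmk.comp hms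
  have hN : ∫⁻ s, (if |t - s| ≤ R then sqrtKernel (t - s) else 0)
      = ENNReal.ofReal (4 * R ^ (1 / 2 : ℝ)) := by
    rw [← lintegral_sqrtKernel_near hR]
    exact lintegral_sub_left_eq_self (fun u => if |u| ≤ R then sqrtKernel u else 0) t
  have hF : ∫⁻ s, (if |t - s| ≤ R then 0 else sqrtKernel (t - s)) ^ (4 : ℝ)
      = ENNReal.ofReal (2 / R) := by
    rw [← lintegral_sqrtKernel_far hR]
    exact lintegral_sub_left_eq_self (fun u => (if |u| ≤ R then 0 else sqrtKernel u) ^ (4 : ℝ)) t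
  have hH : ∫⁻ s, g s * (if |t - s| ≤ R then 0 else sqrtKernel (t - s)) ≤
      ENNReal.ofReal (2 / R) ^ (1 / 4 : ℝ) := by
    have hpq : (4 / 3 : ℝ).HolderConjugate 4 := by
      rw [Real.holderConjugate_iff]; norm_num
    refine (ENNReal.lintegral_mul_le_Lp_mul_Lq volume hpq hg.aemeasurable
      (hmk'.comp hms).aemeasurable).trans ?_
    refine (mul_le_mul' (ENNReal.rpow_le_one hg1 (by norm_num)) le_rfl).trans ?_
    rw [one_mul]
    exact (congrArg (· ^ (1 / 4 : ℝ)) hF).le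
  calc _ ≤ ∫⁻ s, (a * (if |t - s| ≤ R then sqrtKernel (t - s) else 0)
        + g s * (if |t - s| ≤ R then 0 else sqrtKernel (t - s))) := lintegral_mono hsplit
    _ ≤ a * ENNReal.ofReal (4 * R ^ (1 / 2 : ℝ)) + ENNReal.ofReal (2 / R) ^ (1 / 4 : ℝ) := by
        rw [lintegral_add_left (hmN.const_mul _), lintegral_const_mul _ hmN]
        exact add_le_add (mul_le_mul' le_rfl hN.le) hH
    _ ≤ ENNReal.ofReal (6 * (a : ℝ) ^ (1 / 3 : ℝ)) := by
        rw [ENNReal.ofReal_rpow_of_nonneg (by positivity) (by norm_num),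
          ← ENNReal.ofReal_coe_nnreal (p := a), ← ENNReal.ofReal_mul (by positivity),
          ← ENNReal.ofReal_add (by positivity) (by positivity)]
        refine ENNReal.ofReal_le_ofReal ?_
        have e1 : (a : ℝ) * (4 * R ^ (1 / 2 : ℝ)) = 4 * (a : ℝ) ^ (1 / 3 : ℝ) := by
          rw [hRdef, ← Real.rpow_mul ha.le, mul_left_comm]
          congr 1
          nth_rewrite 1 [← Real.rpow_one (a : ℝ)]
          rw [← Real.rpow_add ha]; norm_num
        have e2 : (2 / R) ^ (1 / 4 : ℝ) = 2 ^ (1 / 4 : ℝ) * (a : ℝ) ^ (1 / 3 : ℝ) := by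
          rw [hRdef, Real.rpow_neg ha.le, div_inv_eq_mul, Real.mul_rpow (by norm_num) (by positivity),
            ← Real.rpow_mul ha.le]
          norm_num
        have e3 : (2 : ℝ) ^ (1 / 4 : ℝ) ≤ 2 :=
          (Real.rpow_le_rpow_of_exponent_le (by norm_num) (by norm_num)).trans (Real.rpow_one 2).le
        rw [e1, e2]
        nlinarith [Real.rpow_nonneg ha.le (1 / 3 : ℝ)]
    _ = _ := by
        rw [ENNReal.ofReal_mul (by norm_num), ENNReal.ofReal_ofNat,
          ← ENNReal.ofReal_rpow_of_nonneg ha.le (by norm_num), ENNReal.ofReal_coe_nnreal]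

/-- The plane is split according to which of `f t` and `g s` is larger. Where `g s ≤ f t`, the
potential of the truncated `g` is at most `6 f(t)^{1/3}`, and multiplying by `f t` gives exactly `6
f(t)^{4/3}`. The other half is the same with the roles exchanged, since the kernel is even. -/
theorem lintegral_lintegral_sqrtKernel_le_of_le_one {f g : ℝ → ℝ≥0∞} (hf : Measurable f)
    (hg : Measurable g) (hf1 : ∫⁻ t, f t ^ (4 / 3 : ℝ) ≤ 1) (hg1 : ∫⁻ s, g s ^ (4 / 3 : ℝ) ≤ 1) :
    ∫⁻ t, ∫⁻ s, f t * g s * sqrtKernel (t - s) ≤ 12 := by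
  have half : ∀ {f g : ℝ → ℝ≥0∞}, Measurable f → Measurable g → ∫⁻ t, f t ^ (4 / 3 : ℝ) ≤ 1 →
      ∫⁻ s, g s ^ (4 / 3 : ℝ) ≤ 1 →
      ∫⁻ t, ∫⁻ s, f t * ((if g s ≤ f t then g s else 0) * sqrtKernel (t - s)) ≤ 6 := by
    intro f g hf hg hf1 hg1
    calc _ ≤ ∫⁻ t, 6 * f t ^ (4 / 3 : ℝ) := by
          refine lintegral_mono fun t => ?_
          have hm : Measurable fun s => (if g s ≤ f t then g s else 0) * sqrtKernel (t - s) :=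
            (Measurable.ite (measurableSet_le hg measurable_const) hg measurable_const).mul
              (measurable_sqrtKernel.comp (by fun_prop))
          rw [lintegral_const_mul _ hm]
          refine (mul_le_mul' le_rfl
            (lintegral_truncated_mul_sqrtKernel_le hg hg1 t (f t))).trans (le_of_eq ?_)
          rw [mul_left_comm]
          congr 1
          have : (4 / 3 : ℝ) = 1 + 1 / 3 := by norm_num
          rw [this, ENNReal.rpow_add_of_nonneg _ _ (by norm_num) (by norm_num), ENNReal.rpow_one]
      _ ≤ 6 := by
          rw [lintegral_const_mul _ (hf.pow_const _)]
          exact (mul_le_mul' le_rfl hf1).trans (by simp)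
  have m2 : ∀ {f g : ℝ → ℝ≥0∞}, Measurable f → Measurable g → Measurable fun p : ℝ × ℝ =>
      f p.1 * ((if g p.2 ≤ f p.1 then g p.2 else 0) * sqrtKernel (p.1 - p.2)) := by
    intro f g hf hg
    refine (hf.comp measurable_fst).mul (Measurable.mul (Measurable.ite
      (measurableSet_le (hg.comp measurable_snd) (hf.comp measurable_fst))
      (hg.comp measurable_snd) measurable_const) (measurable_sqrtKernel.comp (by fun_prop)))
  calc ∫⁻ t, ∫⁻ s, f t * g s * sqrtKernel (t - s)
      ≤ ∫⁻ t, ∫⁻ s, (f t * ((if g s ≤ f t then g s else 0) * sqrtKernel (t - s))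
          + g s * ((if f t ≤ g s then f t else 0) * sqrtKernel (s - t))) := by
        refine lintegral_mono fun t => lintegral_mono fun s => ?_
        rcases le_total (g s) (f t) with h | h
        · simp only [h, if_true]
          exact le_add_right (by rw [mul_assoc])
        · simp only [h, if_true]
          refine le_add_left ?_
          rw [sqrtKernel_sub_comm s t, mul_assoc, mul_left_comm]
    _ = (∫⁻ t, ∫⁻ s, f t * ((if g s ≤ f t then g s else 0) * sqrtKernel (t - s)))
        + ∫⁻ t, ∫⁻ s, g s * ((if f t ≤ g s then f t else 0) * sqrtKernel (s - t)) := by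
        have m1 : Measurable fun t =>
            ∫⁻ s, f t * ((if g s ≤ f t then g s else 0) * sqrtKernel (t - s)) :=
          (m2 hf hg).lintegral_prod_right'
        rw [← lintegral_add_left m1]
        refine lintegral_congr fun t => ?_
        exact lintegral_add_left ((m2 hf hg).comp measurable_prodMk_left) _
    _ ≤ 6 + 6 := by
        refine add_le_add (half hf hg hf1 hg1) ?_
        rw [lintegral_lintegral_swap
          (f := fun t s => g s * ((if f t ≤ g s then f t else 0) * sqrtKernel (s - t)))
          ((m2 hg hf).comp measurable_swap).aemeasurable]
        exact half hg hf hg1 hf1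
    _ = 12 := by norm_num

theorem lintegral_lintegral_sqrtKernel_le {f g : ℝ → ℝ≥0∞} (hf : Measurable f)
    (hg : Measurable g) :
    ∫⁻ t, ∫⁻ s, f t * g s * sqrtKernel (t - s) ≤
      12 * ((∫⁻ t, f t ^ (4 / 3 : ℝ)) ^ (3 / 4 : ℝ) * (∫⁻ s, g s ^ (4 / 3 : ℝ)) ^ (3 / 4 : ℝ)) := by
  set F := ∫⁻ t, f t ^ (4 / 3 : ℝ) with hF
  set G := ∫⁻ t, g t ^ (4 / 3 : ℝ) with hG
  have zero_of : ∀ {f : ℝ → ℝ≥0∞}, Measurable f → ∫⁻ t, f t ^ (4 / 3 : ℝ) = 0 → f =ᵐ[volume] 0 := by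
    intro f hf h
    rw [lintegral_eq_zero_iff (hf.pow_const _)] at h
    filter_upwards [h] with t ht
    exact (ENNReal.rpow_eq_zero_iff_of_pos (by norm_num)).1 ht
  rcases eq_or_ne F 0 with hF0 | hF0
  · refine le_of_eq_of_le (lintegral_eq_zero_of_ae_eq_zero ?_) zero_le
    filter_upwards [zero_of hf hF0] with t ht
    simp [ht]
  rcases eq_or_ne G 0 with hG0 | hG0
  · refine le_of_eq_of_le (lintegral_eq_zero_of_ae_eq_zero ?_) zero_le
    refine Filter.Eventually.of_forall fun t => lintegral_eq_zero_of_ae_eq_zero ?_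
    filter_upwards [zero_of hg hG0] with s hs
    simp [hs]
  rcases eq_or_ne F ∞ with hFt | hFt
  · rw [hFt, ENNReal.top_rpow_of_pos (by norm_num), ENNReal.top_mul
      ((ENNReal.rpow_eq_zero_iff_of_pos (by norm_num)).not.2 hG0), ENNReal.mul_top (by norm_num)]
    exact le_top
  rcases eq_or_ne G ∞ with hGt | hGt
  · rw [hGt, ENNReal.top_rpow_of_pos (by norm_num), ENNReal.mul_top
      ((ENNReal.rpow_eq_zero_iff_of_pos (by norm_num)).not.2 hF0), ENNReal.mul_top (by norm_num)]
    exact le_top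
  have pw : ∀ {F : ℝ≥0∞}, F ≠ 0 → F ≠ ∞ → F ^ (-(3 / 4) : ℝ) * F ^ (3 / 4 : ℝ) = 1 := by
    intro F h0 ht
    rw [← ENNReal.rpow_add _ _ h0 ht]; norm_num
  have norm_one : ∀ {f : ℝ → ℝ≥0∞}, Measurable f → ∫⁻ t, f t ^ (4 / 3 : ℝ) ≠ 0 →
      ∫⁻ t, f t ^ (4 / 3 : ℝ) ≠ ∞ →
      ∫⁻ t, ((∫⁻ t, f t ^ (4 / 3 : ℝ)) ^ (-(3 / 4) : ℝ) * f t) ^ (4 / 3 : ℝ) ≤ 1 := by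
    intro f hf h0 ht
    simp_rw [ENNReal.mul_rpow_of_nonneg _ _ (show (0 : ℝ) ≤ 4 / 3 by norm_num), ← ENNReal.rpow_mul]
    rw [lintegral_const_mul _ (hf.pow_const _)]
    norm_num
    rw [ENNReal.rpow_neg_one]
    exact ENNReal.inv_mul_le_one _
  have main := lintegral_lintegral_sqrtKernel_le_of_le_one (hf.const_mul (F ^ (-(3 / 4) : ℝ)))
    (hg.const_mul (G ^ (-(3 / 4) : ℝ))) (norm_one hf hF0 hFt) (norm_one hg hG0 hGt)
  have e : ∀ t s, F ^ (-(3 / 4) : ℝ) * f t * (G ^ (-(3 / 4) : ℝ) * g s) * sqrtKernel (t - s) =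
      F ^ (-(3 / 4) : ℝ) * G ^ (-(3 / 4) : ℝ) * (f t * g s * sqrtKernel (t - s)) := fun t s => by
    ring
  have m : Measurable fun p : ℝ × ℝ => f p.1 * g p.2 * sqrtKernel (p.1 - p.2) :=
    ((hf.comp measurable_fst).mul (hg.comp measurable_snd)).mul
      (measurable_sqrtKernel.comp (by fun_prop))
  have e2 : ∫⁻ t, ∫⁻ s, F ^ (-(3 / 4) : ℝ) * f t * (G ^ (-(3 / 4) : ℝ) * g s) * sqrtKernel (t - s) =
      F ^ (-(3 / 4) : ℝ) * G ^ (-(3 / 4) : ℝ) *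
        ∫⁻ t, ∫⁻ s, f t * g s * sqrtKernel (t - s) := by
    rw [← lintegral_const_mul _ m.lintegral_prod_right']
    refine lintegral_congr fun t => ?_
    have mt : Measurable fun s => f t * g s * sqrtKernel (t - s) := m.comp measurable_prodMk_left
    rw [← lintegral_const_mul _ mt]
    exact lintegral_congr fun s => e t s
  rw [e2] at main
  set X := ∫⁻ t, ∫⁻ s, f t * g s * sqrtKernel (t - s)
  calc X = (F ^ (-(3 / 4) : ℝ) * F ^ (3 / 4 : ℝ)) * (G ^ (-(3 / 4) : ℝ) * G ^ (3 / 4 : ℝ)) * X := by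
        rw [pw hF0 hFt, pw hG0 hGt]; simp
    _ = (F ^ (-(3 / 4) : ℝ) * G ^ (-(3 / 4) : ℝ) * X) * (F ^ (3 / 4 : ℝ) * G ^ (3 / 4 : ℝ)) := by ring
    _ ≤ 12 * (F ^ (3 / 4 : ℝ) * G ^ (3 / 4 : ℝ)) := by gcongr

/-- The last step of the duality arguments for `L⁴`: testing with the cube of a function bounds its
fourth power integral by a power `3/4` of itself. Division needs `X` finite, hence the truncations
where this is used. -/
theorem le_pow_four_of_le_mul_rpow {X K : ℝ≥0∞} (hX : X ≠ ∞) (h : X ≤ K * X ^ (3 / 4 : ℝ)) :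
    X ≤ K ^ 4 := by
  rcases eq_or_ne X 0 with rfl | h0
  · exact zero_le
  have e : X = X ^ (1 / 4 : ℝ) * X ^ (3 / 4 : ℝ) := by
    rw [← ENNReal.rpow_add _ _ h0 hX]; norm_num
  have h1 : X ^ (1 / 4 : ℝ) ≤ K := by
    have hp0 : X ^ (3 / 4 : ℝ) ≠ 0 := (ENNReal.rpow_eq_zero_iff_of_pos (by norm_num)).not.2 h0
    have hpt : X ^ (3 / 4 : ℝ) ≠ ∞ := ENNReal.rpow_ne_top_of_nonneg (by norm_num) hX
    rw [← ENNReal.mul_le_mul_iff_left hp0 hpt]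
    exact e ▸ h
  calc X = (X ^ (1 / 4 : ℝ)) ^ 4 := by
        rw [← ENNReal.rpow_natCast, ← ENNReal.rpow_mul]; norm_num
    _ ≤ K ^ 4 := by gcongr

/-- The bilinear inequality is turned into a bound `L^{4/3} → L⁴` by testing with the cube of the
potential. -/
theorem lintegral_potential_pow_four_le {c : ℝ → ℝ≥0∞} (hc : Measurable c) :
    ∫⁻ s, (∫⁻ t, c t * sqrtKernel (t - s)) ^ 4 ≤
      (12 * (∫⁻ t, c t ^ (4 / 3 : ℝ)) ^ (3 / 4 : ℝ)) ^ 4 := by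
  set I : ℝ → ℝ≥0∞ := fun s => ∫⁻ t, c t * sqrtKernel (t - s) with hI
  have mI : Measurable I := by
    have : Measurable fun p : ℝ × ℝ => c p.2 * sqrtKernel (p.2 - p.1) :=
      (hc.comp measurable_snd).mul (measurable_sqrtKernel.comp (by fun_prop))
    exact this.lintegral_prod_right'
  -- The potential cut off in height and restricted to a bounded interval, so that `∫ J⁴` is finite
  -- and can be divided out.
  set J : ℕ → ℝ → ℝ≥0∞ := fun n => (Icc (-n : ℝ) n).indicator fun s => min (I s) n with hJ
  have mJ : ∀ n, Measurable (J n) := fun n =>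
    (mI.min measurable_const).indicator measurableSet_Icc
  have hJI : ∀ n s, J n s ≤ I s := fun n s =>
    (indicator_le_self _ _ s).trans (min_le_left _ _)
  have bound : ∀ n, ∫⁻ s, J n s ^ 4 ≤ (12 * (∫⁻ t, c t ^ (4 / 3 : ℝ)) ^ (3 / 4 : ℝ)) ^ 4 := by
    intro n
    refine le_pow_four_of_le_mul_rpow ?_ ?_
    · refine ne_top_of_le_ne_top ?_ (lintegral_mono
        (g := (Icc (-n : ℝ) n).indicator fun _ => (n : ℝ≥0∞) ^ 4) fun s => ?_)
      · rw [lintegral_indicator measurableSet_Icc, setLIntegral_const, Real.volume_Icc]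
        exact ENNReal.mul_ne_top (by simp) ENNReal.ofReal_ne_top
      · by_cases hs : s ∈ Icc (-n : ℝ) n
        · simp only [hJ, indicator_of_mem hs]
          gcongr; exact min_le_right _ _
        · simp [hJ, indicator_of_notMem hs]
    · have h1 := lintegral_lintegral_sqrtKernel_le ((mJ n).pow_const 3) hc
      have e1 : ∀ s, (J n s ^ 3) ^ (4 / 3 : ℝ) = J n s ^ 4 := fun s => by
        rw [← ENNReal.rpow_natCast, ← ENNReal.rpow_mul, ← ENNReal.rpow_natCast]; norm_num
      simp_rw [e1] at h1
      calc ∫⁻ s, J n s ^ 4 ≤ ∫⁻ s, J n s ^ 3 * I s := by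
            refine lintegral_mono fun s => ?_
            rw [pow_succ]; gcongr; exact hJI n s
        _ = ∫⁻ s, ∫⁻ t, J n s ^ 3 * c t * sqrtKernel (s - t) := by
            refine lintegral_congr fun s => ?_
            have m : Measurable fun t => c t * sqrtKernel (t - s) :=
              hc.mul (measurable_sqrtKernel.comp (by fun_prop))
            rw [hI, ← lintegral_const_mul _ m]
            refine lintegral_congr fun t => ?_
            rw [sqrtKernel_sub_comm s t, mul_assoc]
        _ ≤ _ := h1.trans (le_of_eq (by ring))
  have mono : ∀ s, Monotone fun n => J n s ^ 4 := by
    intro s m n hmn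
    have hmn' : (m : ℝ) ≤ n := by exact_mod_cast hmn
    have : J m s ≤ J n s := by
      by_cases hs : s ∈ Icc (-m : ℝ) m
      · have hs' : s ∈ Icc (-n : ℝ) n := ⟨by linarith [hs.1], by linarith [hs.2]⟩
        simp only [hJ, indicator_of_mem hs, indicator_of_mem hs']
        gcongr
      · simp [hJ, indicator_of_notMem hs]
    dsimp only
    gcongr
  have hlim : ∀ s, Filter.Tendsto (fun n => J n s ^ 4) Filter.atTop (nhds (I s ^ 4)) := by
    intro s
    have h1 : Filter.Tendsto (fun n : ℕ => min (I s) (n : ℝ≥0∞)) Filter.atTop (nhds (I s)) := by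
      have := (tendsto_const_nhds (x := I s)).min ENNReal.tendsto_nat_nhds_top
      simpa using this
    have h2 : (fun n : ℕ => min (I s) (n : ℝ≥0∞)) =ᶠ[Filter.atTop] fun n => J n s := by
      obtain ⟨N, hN⟩ := exists_nat_ge |s|
      filter_upwards [Filter.eventually_ge_atTop N] with n hn
      have hn' : (N : ℝ) ≤ n := by exact_mod_cast hn
      have hs : s ∈ Icc (-n : ℝ) n := abs_le.1 (hN.trans hn')
      simp [hJ, indicator_of_mem hs]
    exact ((ENNReal.continuous_pow 4).tendsto _).comp (h1.congr' h2)
  exact le_of_tendsto' (lintegral_tendsto_of_tendsto_of_monotone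
    (fun n => ((mJ n).pow_const 4).aemeasurable) (Filter.Eventually.of_forall mono)
    (Filter.Eventually.of_forall hlim)) bound

/-! ### The Fourier transform on `L¹ ∩ L²` and Parseval's formula -/

theorem integral_fourier_mul_eq {f g : E3 → ℂ} (hf : Integrable f) (hg : Integrable g) :
    ∫ ξ, 𝓕 f ξ * g ξ = ∫ x, f x * 𝓕 g x := by
  have := VectorFourier.integral_fourierIntegral_smul_eq_flip (μ := (volume : Measure E3))
    (ν := (volume : Measure E3)) (L := innerₗ E3) (e := Real.fourierChar)
    Real.continuous_fourierChar continuous_inner hf hg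
  simpa only [flip_innerₗ, smul_eq_mul] using! this

theorem continuous_fourier {f : E3 → ℂ} (hf : Integrable f) : Continuous (𝓕 f) :=
  VectorFourier.fourierIntegral_continuous Real.continuous_fourierChar continuous_inner hf

theorem norm_fourier_le {f : E3 → ℂ} (ξ : E3) : ‖𝓕 f ξ‖ ≤ ∫ x, ‖f x‖ :=
  VectorFourier.norm_fourierIntegral_le_integral_norm _ _ _ _ _

/-- The integral and the Plancherel transform agree because both have the same pairing with every
smooth compactly supported function: for the former by exchanging the integrals, for the latter
through tempered distributions. -/
theorem fourier_ae_eq_toLp {w : E3 → ℂ} (h1 : Integrable w) (h2 : MemLp w 2 volume) :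
    𝓕 w =ᵐ[volume] ((𝓕 (h2.toLp w) : Lp ℂ 2 (volume : Measure E3)) : E3 → ℂ) := by
  refine ae_eq_of_integral_contDiff_smul_eq (continuous_fourier h1).locallyIntegrable
    ((Lp.memLp (𝓕 (h2.toLp w))).locallyIntegrable one_le_two) fun g hg hgs => ?_
  have hgc : HasCompactSupport fun x => (g x : ℂ) := hgs.comp_left Complex.ofReal_zero
  have hgd : ContDiff ℝ (↑(⊤ : ℕ∞)) fun x => (g x : ℂ) := Complex.ofRealCLM.contDiff.comp hg
  set G : 𝓢(E3, ℂ) := hgc.toSchwartzMap hgd with hG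
  have hGg : ∀ x, G x = (g x : ℂ) := fun x => rfl
  have hd := congrArg (fun T : 𝓢'(E3, ℂ) => T G)
    (Lp.fourier_toTemperedDistribution_eq (h2.toLp w))
  simp only [TemperedDistribution.fourier_apply, Lp.toTemperedDistribution_apply,
    smul_eq_mul] at hd
  simp only [Complex.real_smul]
  simp_rw [hGg] at hd
  rw [← hd]
  have h3 := integral_fourier_mul_eq h1 G.integrable
  calc ∫ x, (g x : ℂ) * 𝓕 w x = ∫ x, 𝓕 w x * G x := by simp_rw [hGg, mul_comm]
    _ = ∫ x, w x * 𝓕 (G : E3 → ℂ) x := h3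
    _ = _ := by
      refine integral_congr_ae ?_
      filter_upwards [h2.coeFn_toLp] with x hx
      rw [hx, mul_comm, SchwartzMap.fourier_coe]

theorem memLp_fourier {w : E3 → ℂ} (h1 : Integrable w) (h2 : MemLp w 2 volume) :
    MemLp (𝓕 w) 2 volume :=
  (memLp_congr_ae (fourier_ae_eq_toLp h1 h2)).2 (Lp.memLp _)

theorem eLpNorm_fourier {w : E3 → ℂ} (h1 : Integrable w) (h2 : MemLp w 2 volume) :
    eLpNorm (𝓕 w) 2 volume = eLpNorm w 2 volume := by
  rw [eLpNorm_congr_ae (fourier_ae_eq_toLp h1 h2), ← Lp.enorm_def, ← Lp.enorm_toLp (hf := h2),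
    ← ofReal_norm, ← ofReal_norm, Lp.norm_fourier_eq]

theorem plancherel_memLp (f : E3 → ℂ) : MemLp (plancherel f) 2 volume := by
  unfold plancherel
  split_ifs with h
  · exact Lp.memLp _
  · exact MemLp.zero

theorem integral_plancherel_mul_eq {f w : E3 → ℂ} (hf : MemLp f 2 volume) (h1 : Integrable w)
    (h2 : MemLp w 2 volume) : ∫ η, plancherel f η * w η = ∫ y, f y * 𝓕 w y := by
  have key : ∀ F : Lp ℂ 2 (volume : Measure E3),
      (ContinuousLinearMap.mul ℂ ℂ).lpPairing volume 2 2 (𝓕 F) (h2.toLp w) =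
      (ContinuousLinearMap.mul ℂ ℂ).lpPairing volume 2 2 F (𝓕 (h2.toLp w)) := by
    intro F
    -- Both sides are continuous in `F` for the `L²` norm, so it suffices to treat Schwartz
    -- functions, where the transform is an absolutely convergent integral.
    refine DenseRange.induction_on (p := fun F : Lp ℂ 2 (volume : Measure E3) =>
      (ContinuousLinearMap.mul ℂ ℂ).lpPairing volume 2 2 (𝓕 F) (h2.toLp w) =
      (ContinuousLinearMap.mul ℂ ℂ).lpPairing volume 2 2 F (𝓕 (h2.toLp w)))
      (SchwartzMap.denseRange_toLpCLM (F := ℂ) (μ := (volume : Measure E3)) (p := 2)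
        ENNReal.ofNat_ne_top) F ?_ ?_
    · refine isClosed_eq ?_ ?_
      · exact (((ContinuousLinearMap.mul ℂ ℂ).lpPairing volume 2 2).continuous.comp
          (Lp.fourierTransformₗᵢ E3 ℂ).continuous).clm_apply continuous_const
      · exact (ContinuousLinearMap.continuous _).clm_apply continuous_const
    · intro G
      simp only [SchwartzMap.toLpCLM_apply, SchwartzMap.toLp_fourier_eq]
      rw [ContinuousLinearMap.lpPairing_eq_integral, ContinuousLinearMap.lpPairing_eq_integral]
      simp only [ContinuousLinearMap.mul_apply']
      calc _ = ∫ x, 𝓕 (G : E3 → ℂ) x * w x := by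
            refine integral_congr_ae ?_
            filter_upwards [(𝓕 G).coeFn_toLp 2 volume, h2.coeFn_toLp] with x hx hx'
            rw [hx, hx', SchwartzMap.fourier_coe]
        _ = ∫ x, G x * 𝓕 w x := integral_fourier_mul_eq G.integrable h1
        _ = _ := by
            refine integral_congr_ae ?_
            filter_upwards [G.coeFn_toLp 2 volume, fourier_ae_eq_toLp h1 h2] with x hx hx'
            rw [hx, hx']
  have := key (hf.toLp f)
  rw [ContinuousLinearMap.lpPairing_eq_integral, ContinuousLinearMap.lpPairing_eq_integral] at this
  simp only [ContinuousLinearMap.mul_apply'] at this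
  rw [plancherel, dif_pos hf]
  calc _ = _ := by
        refine integral_congr_ae ?_
        filter_upwards [h2.coeFn_toLp] with x hx
        rw [← hx]
    _ = _ := this
    _ = _ := by
        refine integral_congr_ae ?_
        filter_upwards [hf.coeFn_toLp, fourier_ae_eq_toLp h1 h2] with x hx hx'
        rw [hx, hx']

theorem largePart_add_smallPart (f : E3 → ℂ) (x : E3) : largePart f x + smallPart f x = f x := by
  unfold largePart smallPart
  by_cases h : 1 < ‖f x‖
  · simp [indicator, h]
  · simp [indicator, h, not_lt.1 h]

/-- The multiplication formula on `L¹ + L²`. The large part is treated by Fubini and the small part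
by Plancherel, so the Hausdorff-Young theorem for `L^ρ` is not needed. -/
theorem integral_fourierHat_mul_eq {ρ : ℝ≥0∞} (hρ : 1 ≤ ρ) (hρ2 : ρ ≤ 2) {f w : E3 → ℂ}
    (hf : MemLp f ρ volume) (h1 : Integrable w) (h2 : MemLp w 2 volume) :
    ∫ η, fourierHat f ((2 * Real.pi) • η) * w η = ∫ y, f y * 𝓕 w y := by
  have hl := memLp_one_iff_integrable.1 (memLp_largePart hρ hρ2 hf)
  have hs := memLp_smallPart hρ hρ2 hf
  have hpi : (2 * Real.pi) ≠ 0 := by positivity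
  have e : ∀ η : E3, fourierHat f ((2 * Real.pi) • η) * w η =
      𝓕 (largePart f) η * w η + plancherel (smallPart f) η * w η := fun η => by
    rw [fourierHat, smul_smul, inv_mul_cancel₀ hpi, one_smul, add_mul]
  have i1 : Integrable fun η => 𝓕 (largePart f) η * w η :=
    h1.bdd_mul (continuous_fourier hl).aestronglyMeasurable
      (Filter.Eventually.of_forall fun ξ => norm_fourier_le ξ)
  have i2 : Integrable fun η => plancherel (smallPart f) η * w η :=
    (plancherel_memLp _).integrable_mul h2
  have i3 : Integrable fun y => largePart f y * 𝓕 w y :=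
    hl.mul_bdd (continuous_fourier h1).aestronglyMeasurable
      (Filter.Eventually.of_forall fun ξ => norm_fourier_le ξ)
  have i4 : Integrable fun y => smallPart f y * 𝓕 w y := hs.integrable_mul (memLp_fourier h1 h2)
  simp_rw [e]
  rw [integral_add i1 i2, integral_fourier_mul_eq hl h1, integral_plancherel_mul_eq hs h1 h2,
    ← integral_add i3 i4]
  simp_rw [← add_mul, largePart_add_smallPart]

/-! ### Plane waves with a dispersive symbol -/

/-- The function `η ↦ exp (i (2π x·η + t P η)) m η`, whose Fourier transform at `y` is the kernel of
the propagator with phase `P` and amplitude `m` at time `t` and position `x - y`. -/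
def wave (P m : E3 → ℝ) (t : ℝ) (x η : E3) : ℂ :=
  Complex.exp (Complex.I * ((2 * Real.pi * inner ℝ x η + t * P η : ℝ) : ℂ)) * (m η : ℂ)

/-- A phase `P` and an amplitude `m` of mass at most `N` whose propagator decays like
`N (T / |t|)^{1/2}`. -/
structure IsDispersive (P m : E3 → ℝ) (N T : ℝ) : Prop where
  cont_phase : Continuous P
  cont_amp : Continuous m
  compact : HasCompactSupport m
  nonneg : ∀ η, 0 ≤ m η
  le_one : ∀ η, m η ≤ 1
  N_pos : 0 < N
  T_pos : 0 < T
  integral_le : ∫ η, m η ≤ N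
  decay : ∀ (t : ℝ) (x : E3), t ≠ 0 → ‖∫ η, wave P m t x η‖ ≤ N * √(T / |t|)
  decay_sq : ∀ (t : ℝ) (x : E3), t ≠ 0 →
    ‖∫ η, wave P (fun η => m η ^ 2) t x η‖ ≤ N * √(T / |t|)

theorem norm_wave (P m : E3 → ℝ) (t : ℝ) (x η : E3) : ‖wave P m t x η‖ = |m η| := by
  rw [wave, norm_mul, mul_comm Complex.I, Complex.norm_exp_ofReal_mul_I, one_mul,
    Complex.norm_real, Real.norm_eq_abs]

theorem fourier_wave (P m : E3 → ℝ) (t : ℝ) (x y : E3) :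
    𝓕 (wave P m t x) y = ∫ η, wave P m t (x - y) η := by
  rw [Real.fourier_eq']
  refine integral_congr_ae (Filter.Eventually.of_forall fun η => ?_)
  simp only [wave, smul_eq_mul]
  rw [← mul_assoc, ← Complex.exp_add, inner_sub_left, real_inner_comm η y]
  congr 2
  push_cast
  ring

namespace IsDispersive

variable {P m : E3 → ℝ} {N T : ℝ}

theorem continuous_wave (h : IsDispersive P m N T) :
    Continuous fun p : (ℝ × E3) × E3 => wave P m p.1.1 p.1.2 p.2 := by
  have := h.cont_phase
  have := h.cont_amp
  unfold wave
  fun_prop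

theorem continuous_wave_apply (h : IsDispersive P m N T) (t : ℝ) (x : E3) :
    Continuous (wave P m t x) := by
  have := h.cont_phase
  have := h.cont_amp
  unfold wave
  fun_prop

theorem hasCompactSupport_wave (h : IsDispersive P m N T) (t : ℝ) (x : E3) :
    HasCompactSupport (wave P m t x) :=
  HasCompactSupport.mul_left (h.compact.comp_left (g := Complex.ofReal) Complex.ofReal_zero)

theorem integrable_amp (h : IsDispersive P m N T) : Integrable m :=
  h.cont_amp.integrable_of_hasCompactSupport h.compact

theorem integrable_wave (h : IsDispersive P m N T) (t : ℝ) (x : E3) : Integrable (wave P m t x) :=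
  (h.continuous_wave_apply t x).integrable_of_hasCompactSupport (h.hasCompactSupport_wave t x)

theorem memLp_wave (h : IsDispersive P m N T) (p : ℝ≥0∞) (t : ℝ) (x : E3) :
    MemLp (wave P m t x) p volume :=
  (h.continuous_wave_apply t x).memLp_of_hasCompactSupport (h.hasCompactSupport_wave t x)

theorem norm_fourier_wave_le (h : IsDispersive P m N T) (t : ℝ) (x y : E3) :
    ‖𝓕 (wave P m t x) y‖ ≤ N := by
  refine (norm_fourier_le y).trans ?_
  simp_rw [norm_wave, abs_of_nonneg (h.nonneg _)]
  exact h.integral_le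

theorem norm_fourier_wave_le_decay (h : IsDispersive P m N T) {t : ℝ} (ht : t ≠ 0) (x y : E3) :
    ‖𝓕 (wave P m t x) y‖ ≤ N * √(T / |t|) := by
  rw [fourier_wave]; exact h.decay t _ ht

theorem integral_sq_le (h : IsDispersive P m N T) : ∫ η, m η ^ 2 ≤ N := by
  refine (integral_mono_of_nonneg (Filter.Eventually.of_forall fun η => sq_nonneg _)
    h.integrable_amp (Filter.Eventually.of_forall fun η => ?_)).trans h.integral_le
  have h0 := h.nonneg η
  have h1 := h.le_one η
  nlinarith

end IsDispersive

theorem eLpNorm_two_le_of_integral_le {f : E3 → ℂ} (hf : MemLp f 2 volume) {A : ℝ} (hA : 0 ≤ A)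
    (h : ∫ x, ‖f x‖ ^ 2 ≤ A ^ 2) : eLpNorm f 2 volume ≤ ENNReal.ofReal A := by
  rw [hf.eLpNorm_eq_integral_rpow_norm two_ne_zero ENNReal.ofNat_ne_top]
  refine ENNReal.ofReal_le_ofReal ?_
  simp only [ENNReal.toReal_ofNat, Real.rpow_two]
  calc _ ≤ (A ^ 2) ^ (2⁻¹ : ℝ) :=
        Real.rpow_le_rpow (integral_nonneg fun x => by positivity) h (by norm_num)
    _ = A := by rw [← Real.rpow_two, ← Real.rpow_mul hA]; norm_num

theorem IsDispersive.eLpNorm_fourier_wave_le {P m : E3 → ℝ} {N T : ℝ} (h : IsDispersive P m N T)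
    (t : ℝ) (x : E3) : eLpNorm (𝓕 (wave P m t x)) 2 volume ≤ ENNReal.ofReal (√N) := by
  rw [eLpNorm_fourier (h.integrable_wave t x) (h.memLp_wave 2 t x)]
  refine eLpNorm_two_le_of_integral_le (h.memLp_wave 2 t x) (Real.sqrt_nonneg N) ?_
  rw [Real.sq_sqrt h.N_pos.le]
  simp_rw [norm_wave, sq_abs]
  exact h.integral_sq_le

/-- Interpolation between `L²` and `L^∞` for a single function. -/
theorem eLpNorm_le_rpow_mul_rpow {r : ℝ≥0∞} (hr : 2 ≤ r) {f : E3 → ℂ}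
    (hf : AEStronglyMeasurable f volume) {b : ℝ≥0∞} (hb : ∀ x, ‖f x‖ₑ ≤ b) :
    eLpNorm f r volume ≤
      eLpNorm f 2 volume ^ (2 * (1 / r).toReal) * b ^ (1 - 2 * (1 / r).toReal) := by
  rcases eq_or_ne r ∞ with rfl | hrt
  · simp only [eLpNorm_exponent_top, one_div, ENNReal.inv_top, ENNReal.toReal_zero, mul_zero,
      ENNReal.rpow_zero, sub_zero, ENNReal.rpow_one, one_mul]
    exact eLpNormEssSup_le_of_ae_enorm_bound (Filter.Eventually.of_forall hb)
  have hr0 : r ≠ 0 := (lt_of_lt_of_le (by norm_num) hr).ne'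
  have hr2 : 2 ≤ r.toReal := by
    simpa using (ENNReal.toReal_le_toReal (by norm_num) hrt).2 hr
  have hrpos : 0 < r.toReal := by linarith
  rw [eLpNorm_eq_lintegral_rpow_enorm_toReal hr0 hrt,
    eLpNorm_eq_lintegral_rpow_enorm_toReal two_ne_zero ENNReal.ofNat_ne_top, ← ENNReal.rpow_mul]
  simp only [ENNReal.toReal_ofNat, one_div, ENNReal.toReal_inv]
  have e1 : (2⁻¹ : ℝ) * (2 * r.toReal⁻¹) = r.toReal⁻¹ := by ring
  have e2 : 1 - 2 * r.toReal⁻¹ = (r.toReal - 2) * r.toReal⁻¹ := by field_simp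
  rw [e1, e2, ENNReal.rpow_mul, ← ENNReal.mul_rpow_of_nonneg _ _ (by positivity)]
  refine ENNReal.rpow_le_rpow ?_ (by positivity)
  rw [mul_comm]
  rcases eq_or_ne b ∞ with hbt | hbt
  -- For `b = ∞` and `r > 2` the right side is infinite unless `f` vanishes almost everywhere; in
  -- that case it is zero times infinity, and so is the left side zero.
  · rcases eq_or_lt_of_le hr2 with h2 | h2
    · simp [← h2]
    · rw [hbt, ENNReal.top_rpow_of_pos (by linarith)]
      by_cases h0 : ∫⁻ x, ‖f x‖ₑ ^ (2 : ℝ) = 0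
      · rw [lintegral_eq_zero_iff' (hf.enorm.pow_const _)] at h0
        refine le_of_eq_of_le (lintegral_eq_zero_of_ae_eq_zero ?_) zero_le
        filter_upwards [h0] with x hx
        have hx0 : ‖f x‖ₑ = 0 := (ENNReal.rpow_eq_zero_iff_of_pos (by norm_num)).1 hx
        simp [hx0, hrpos]
      · rw [ENNReal.top_mul h0]; exact le_top
  · rw [← lintegral_const_mul' _ _ (ENNReal.rpow_ne_top_of_nonneg (by linarith) hbt)]
    refine lintegral_mono fun x => ?_
    have : r.toReal = (r.toReal - 2) + 2 := by ring
    rw [this, ENNReal.rpow_add_of_nonneg _ _ (by linarith) (by norm_num), add_sub_cancel_right]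
    exact mul_le_mul' (ENNReal.rpow_le_rpow (hb x) (by linarith)) le_rfl

/-! ### Superpositions of waves -/

/-- This is the group property behind `TT*`: the amplitude is squared and only differences of times
and positions remain. -/
theorem wave_mul_conj_wave (P m : E3 → ℝ) (t s : ℝ) (x y η : E3) :
    wave P m t x η * (starRingEnd ℂ) (wave P m s y η) =
      wave P (fun η => m η ^ 2) (t - s) (x - y) η := by
  simp only [wave, map_mul, Complex.conj_ofReal, ← Complex.exp_conj, Complex.conj_I]
  rw [mul_mul_mul_comm, ← Complex.exp_add, inner_sub_left]
  congr 2
  · push_cast; ring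
  · push_cast; ring

theorem wave_eq_exp_mul_wave_zero (P m : E3 → ℝ) (t : ℝ) (x η : E3) :
    wave P m t x η =
      Complex.exp (Complex.I * ((2 * Real.pi * inner ℝ x η : ℝ) : ℂ)) * wave P m t 0 η := by
  simp only [wave, inner_zero_left]
  rw [← mul_assoc, ← Complex.exp_add]
  congr 2
  push_cast; ring

theorem ofReal_mul_sqrt_div {N T t : ℝ} (hN : 0 ≤ N) (hT : 0 ≤ T) :
    ENNReal.ofReal (N * √(T / |t|)) = ENNReal.ofReal (N * √T) * sqrtKernel t := by
  rw [sqrtKernel, ← ENNReal.ofReal_mul (by positivity), Real.sqrt_div hT, Real.rpow_neg (abs_nonneg t),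
    ← Real.sqrt_eq_rpow]
  congr 1
  ring

namespace IsDispersive

variable {P m : E3 → ℝ} {N T : ℝ}

theorem enorm_fourier_wave_le (h : IsDispersive P m N T) {t : ℝ} (ht : t ≠ 0) (x y : E3) :
    ‖𝓕 (wave P m t x) y‖ₑ ≤ ENNReal.ofReal (N * √T) * sqrtKernel t := by
  rw [← ofReal_mul_sqrt_div h.N_pos.le h.T_pos.le, ← ofReal_norm]
  exact ENNReal.ofReal_le_ofReal (h.norm_fourier_wave_le_decay ht x y)

theorem enorm_integral_wave_sq_le (h : IsDispersive P m N T) {t : ℝ} (ht : t ≠ 0) (x : E3) :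
    ‖∫ η, wave P (fun η => m η ^ 2) t x η‖ₑ ≤ ENNReal.ofReal (N * √T) * sqrtKernel t := by
  rw [← ofReal_mul_sqrt_div h.N_pos.le h.T_pos.le, ← ofReal_norm]
  exact ENNReal.ofReal_le_ofReal (h.decay_sq t x ht)

theorem norm_wave_eq (h : IsDispersive P m N T) (t : ℝ) (x η : E3) : ‖wave P m t x η‖ = m η := by
  rw [norm_wave, abs_of_nonneg (h.nonneg η)]

theorem memLp_amp (h : IsDispersive P m N T) (p : ℝ≥0∞) : MemLp m p volume :=
  h.cont_amp.memLp_of_hasCompactSupport h.compact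

theorem eLpNorm_wave_two_le (h : IsDispersive P m N T) (t : ℝ) (x : E3) :
    eLpNorm (wave P m t x) 2 volume ≤ ENNReal.ofReal (√N) := by
  rw [← eLpNorm_fourier (h.integrable_wave t x) (h.memLp_wave 2 t x)]
  exact h.eLpNorm_fourier_wave_le t x

section superposition

variable {A : Type*} [MeasurableSpace A] {μ : Measure A} {c : A → ℂ} {τ : A → ℝ}
  {ξ : A → E3}

theorem integrable_prod_mul_wave (h : IsDispersive P m N T) (hc : Integrable c μ)
    (hτ : Measurable τ) (hξ : Measurable ξ) {G : E3 → ℂ}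
    (hG : AEStronglyMeasurable G volume) (hGm : Integrable fun η => ‖G η‖ * m η) :
    Integrable (fun p : A × E3 => c p.1 * (G p.2 * wave P m (τ p.1) (ξ p.1) p.2))
      (μ.prod volume) := by
  have hmeas : Measurable fun p : A × E3 => wave P m (τ p.1) (ξ p.1) p.2 := by
    have h1 := h.cont_phase.measurable
    have h2 := h.cont_amp.measurable
    unfold wave
    fun_prop
  have hc1 : AEStronglyMeasurable (fun p : A × E3 => c p.1) (μ.prod volume) := hc.1.comp_fst
  have hG1 : AEStronglyMeasurable (fun p : A × E3 => G p.2) (μ.prod volume) := hG.comp_snd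
  refine (hc.norm.mul_prod hGm).mono (hc1.mul (hG1.mul hmeas.aestronglyMeasurable))
    (Filter.Eventually.of_forall fun p => ?_)
  rw [norm_mul, norm_mul, h.norm_wave_eq, norm_mul, norm_norm, norm_mul, norm_norm,
    Real.norm_of_nonneg (h.nonneg _)]

/-- The superposition `η ↦ ∫ c α wave (τ α) (ξ α) η dα`. -/
def _root_.RotatingEuler.superpose (P m : E3 → ℝ) (μ : Measure A) (c : A → ℂ) (τ : A → ℝ)
    (ξ : A → E3) (η : E3) : ℂ := ∫ α, c α * wave P m (τ α) (ξ α) η ∂μ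

theorem integrable_prod_wave (h : IsDispersive P m N T) (hc : Integrable c μ)
    (hτ : Measurable τ) (hξ : Measurable ξ) :
    Integrable (fun p : A × E3 => c p.1 * wave P m (τ p.1) (ξ p.1) p.2) (μ.prod volume) := by
  simpa using h.integrable_prod_mul_wave hc hτ hξ (G := fun _ => 1)
    aestronglyMeasurable_const (by simpa using h.integrable_amp)

theorem integrable_superpose [SFinite μ] (h : IsDispersive P m N T) (hc : Integrable c μ)
    (hτ : Measurable τ) (hξ : Measurable ξ) : Integrable (superpose P m μ c τ ξ) :=
  (h.integrable_prod_wave hc hτ hξ).integral_prod_right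

theorem norm_superpose_le (h : IsDispersive P m N T) (η : E3) :
    ‖superpose P m μ c τ ξ η‖ ≤ (∫ α, ‖c α‖ ∂μ) * m η := by
  refine (norm_integral_le_integral_norm _).trans_eq ?_
  simp_rw [norm_mul, h.norm_wave_eq]
  rw [integral_mul_const]

theorem memLp_superpose [SFinite μ] (h : IsDispersive P m N T) (hc : Integrable c μ)
    (hτ : Measurable τ) (hξ : Measurable ξ) : MemLp (superpose P m μ c τ ξ) 2 volume :=
  ((h.memLp_amp 2).const_mul (∫ α, ‖c α‖ ∂μ)).mono (h.integrable_superpose hc hτ hξ).1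
    (Filter.Eventually.of_forall fun η => (h.norm_superpose_le η).trans (le_abs_self _))

theorem integral_mul_superpose [SFinite μ] (h : IsDispersive P m N T) (hc : Integrable c μ)
    (hτ : Measurable τ) (hξ : Measurable ξ) {G : E3 → ℂ} (hG : AEStronglyMeasurable G volume)
    (hGm : Integrable fun η => ‖G η‖ * m η) :
    ∫ η, G η * superpose P m μ c τ ξ η =
      ∫ α, c α * (∫ η, G η * wave P m (τ α) (ξ α) η) ∂μ := by
  have hI : Integrable (Function.uncurry fun α η => c α * (G η * wave P m (τ α) (ξ α) η))
      (μ.prod volume) := h.integrable_prod_mul_wave hc hτ hξ hG hGm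
  simp only [superpose, ← integral_const_mul]
  rw [integral_integral_swap hI]
  refine integral_congr_ae (Filter.Eventually.of_forall fun η =>
    integral_congr_ae (Filter.Eventually.of_forall fun α => ?_))
  exact mul_left_comm _ _ _

theorem fourier_superpose [SFinite μ] (h : IsDispersive P m N T) (hc : Integrable c μ)
    (hτ : Measurable τ) (hξ : Measurable ξ) (y : E3) :
    𝓕 (superpose P m μ c τ ξ) y = ∫ α, c α * 𝓕 (wave P m (τ α) (ξ α)) y ∂μ := by
  simp only [Real.fourier_eq', smul_eq_mul]
  refine h.integral_mul_superpose hc hτ hξ ?_ ?_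
  · exact Continuous.aestronglyMeasurable (by fun_prop)
  · simpa only [Complex.norm_exp_ofReal_mul_I, one_mul] using h.integrable_amp

end superposition

/-- The dual endpoint estimate: superpositions of waves are bounded in `L²` by the `L^{4/3}` norm of
their coefficients. -/
theorem eLpNorm_superpose_le (h : IsDispersive P m N T) {c : ℝ → ℂ} (hcm : Measurable c)
    (hc : Integrable c) {ξ : ℝ → E3} (hξ : Measurable ξ) (s₀ : ℝ) :
    eLpNorm (superpose P m volume c (fun t => t - s₀) ξ) 2 volume ≤
      ENNReal.ofReal (12 * (N * √T)) ^ (1 / 2 : ℝ) * (∫⁻ t, ‖c t‖ₑ ^ (4 / 3 : ℝ)) ^ (3 / 4 : ℝ) := by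
  set ω := superpose P m volume c (fun t => t - s₀) ξ with hω
  have hτ : Measurable fun t : ℝ => t - s₀ := by fun_prop
  have hsq : (∫⁻ η, ‖ω η‖ₑ ^ 2) ≤ ENNReal.ofReal (12 * (N * √T)) *
      ((∫⁻ t, ‖c t‖ₑ ^ (4 / 3 : ℝ)) ^ (3 / 4 : ℝ)) ^ 2 := by
    have hm2 : Integrable fun η => m η ^ 2 := (h.memLp_amp 2).integrable_sq
    have hmeas : Measurable fun p : (ℝ × ℝ) × E3 =>
        wave P (fun η => m η ^ 2) (p.1.1 - p.1.2) (ξ p.1.1 - ξ p.1.2) p.2 := by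
      have h1 := h.cont_phase.measurable
      have h2 := h.cont_amp.measurable
      unfold wave
      fun_prop
    have hJ : Integrable (fun p : (ℝ × ℝ) × E3 => c p.1.1 * (starRingEnd ℂ) (c p.1.2) *
        wave P (fun η => m η ^ 2) (p.1.1 - p.1.2) (ξ p.1.1 - ξ p.1.2) p.2)
        ((volume.prod volume).prod volume) := by
      have hcs : Measurable fun t => (starRingEnd ℂ) (c t) :=
        Complex.continuous_conj.measurable.comp hcm
      have hm1 : Measurable fun p : (ℝ × ℝ) × E3 => c p.1.1 * (starRingEnd ℂ) (c p.1.2) :=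
        (hcm.comp (measurable_fst.comp measurable_fst)).mul
          (hcs.comp (measurable_snd.comp measurable_fst))
      refine ((hc.norm.mul_prod hc.norm).mul_prod hm2).mono (hm1.mul hmeas).aestronglyMeasurable
        (Filter.Eventually.of_forall fun p => ?_)
      simp only [norm_mul, norm_wave, RCLike.norm_conj, Real.norm_eq_abs, abs_norm]
      exact le_rfl
    -- The square is a double integral over pairs of times, in which the origin `s₀` cancels. After
    -- integration in `η` each pair contributes a kernel of size `N √T |t - t'|^{-1/2}`.
    have hprod : ∀ η, ω η * (starRingEnd ℂ) (ω η) = ∫ p : ℝ × ℝ,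
        c p.1 * (starRingEnd ℂ) (c p.2) *
          wave P (fun η => m η ^ 2) (p.1 - p.2) (ξ p.1 - ξ p.2) η := fun η => by
      rw [hω, superpose, ← integral_conj, ← integral_prod_mul]
      refine integral_congr_ae (Filter.Eventually.of_forall fun p => ?_)
      simp only [map_mul]
      rw [mul_mul_mul_comm, wave_mul_conj_wave, sub_sub_sub_cancel_right]
    have hω2 := h.memLp_superpose hc hτ hξ
    have hint : Integrable fun η => ‖ω η‖ ^ 2 := hω2.integrable_norm_pow two_ne_zero
    have e1 : (∫⁻ η, ‖ω η‖ₑ ^ 2) = ‖∫ η, ω η * (starRingEnd ℂ) (ω η)‖ₑ := by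
      have : ∀ η, ω η * (starRingEnd ℂ) (ω η) = ((‖ω η‖ ^ 2 : ℝ) : ℂ) := fun η => by
        rw [Complex.mul_conj, Complex.normSq_eq_norm_sq]
      simp_rw [this]
      rw [integral_complex_ofReal, ← ofReal_norm, Complex.norm_real,
        Real.norm_of_nonneg (integral_nonneg fun η => by positivity),
        ofReal_integral_eq_lintegral_ofReal hint (Filter.Eventually.of_forall fun η => by positivity)]
      refine lintegral_congr fun η => ?_
      rw [ENNReal.ofReal_pow (norm_nonneg _), ofReal_norm]
    rw [e1]
    simp_rw [hprod]
    rw [← integral_integral_swap hJ]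
    refine (enorm_integral_le_lintegral_enorm _).trans ?_
    have e2 : ∀ᵐ p : ℝ × ℝ, ‖∫ η, c p.1 * (starRingEnd ℂ) (c p.2) *
          wave P (fun η => m η ^ 2) (p.1 - p.2) (ξ p.1 - ξ p.2) η‖ₑ ≤
        ENNReal.ofReal (N * √T) * (‖c p.1‖ₑ * ‖c p.2‖ₑ * sqrtKernel (p.1 - p.2)) := by
      -- The dispersive bound requires distinct times, and the diagonal is a null set.
      have hne : ∀ᵐ p : ℝ × ℝ, p.1 - p.2 ≠ 0 := by
        rw [Measure.volume_eq_prod]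
        refine (Measure.ae_prod_iff_ae_ae ?_).2 (Filter.Eventually.of_forall fun t => ?_)
        · exact (measurableSet_singleton (0 : ℝ)).compl.preimage (by fun_prop :
            Measurable fun p : ℝ × ℝ => p.1 - p.2)
        · filter_upwards [Measure.ae_ne volume t] with s hs
          exact sub_ne_zero.2 (Ne.symm hs)
      filter_upwards [hne] with p hp
      rw [integral_const_mul, enorm_mul, enorm_mul]
      have : ‖(starRingEnd ℂ) (c p.2)‖ₑ = ‖c p.2‖ₑ := by
        rw [← ofReal_norm, RCLike.norm_conj, ofReal_norm]
      rw [this]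
      refine (mul_le_mul' le_rfl (h.enorm_integral_wave_sq_le hp _)).trans_eq (by ring)
    refine (lintegral_mono_ae e2).trans ?_
    have hcm' : Measurable fun t => ‖c t‖ₑ := hcm.enorm
    have hk := measurable_sqrtKernel
    rw [lintegral_const_mul _ (by fun_prop), Measure.volume_eq_prod, lintegral_prod _ (by fun_prop)]
    refine (mul_le_mul' le_rfl (lintegral_lintegral_sqrtKernel_le hcm' hcm')).trans_eq ?_
    rw [ENNReal.ofReal_mul (by norm_num : (0:ℝ) ≤ 12)]
    norm_num
    ring
  rw [eLpNorm_eq_lintegral_rpow_enorm_toReal two_ne_zero ENNReal.ofNat_ne_top]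
  simp only [ENNReal.toReal_ofNat, ENNReal.rpow_two]
  refine (ENNReal.rpow_le_rpow hsq (by norm_num)).trans_eq ?_
  rw [ENNReal.mul_rpow_of_nonneg _ _ (by norm_num)]
  congr 1
  rw [← ENNReal.rpow_two, ← ENNReal.rpow_mul]
  norm_num

end IsDispersive

/-! ### Maximal functions by duality -/

/-- A point among the first `n + 1` terms of the sequence `p` at which `‖u t ·‖` is largest. -/
def argmaxSeq (u : ℝ → E3 → ℂ) (p : ℕ → E3) : ℕ → ℝ → E3
  | 0, _ => p 0
  | n + 1, t => if ‖u t (argmaxSeq u p n t)‖ < ‖u t (p (n + 1))‖ then p (n + 1)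
      else argmaxSeq u p n t

theorem measurable_argmaxSeq {u : ℝ → E3 → ℂ} (hu : Measurable (Function.uncurry u)) (p : ℕ → E3)
    (n : ℕ) : Measurable (argmaxSeq u p n) := by
  induction n with
  | zero => exact measurable_const
  | succ n ih =>
    refine Measurable.ite (measurableSet_lt ?_ ?_) measurable_const ih
    · exact (hu.comp (measurable_id.prodMk ih)).norm
    · exact (hu.comp (measurable_id.prodMk measurable_const)).norm

theorem norm_argmaxSeq_le_succ (u : ℝ → E3 → ℂ) (p : ℕ → E3) (t : ℝ) (n : ℕ) :
    ‖u t (argmaxSeq u p n t)‖ ≤ ‖u t (argmaxSeq u p (n + 1) t)‖ := by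
  rw [argmaxSeq]
  split_ifs with h
  · exact h.le
  · exact le_rfl

theorem monotone_norm_argmaxSeq (u : ℝ → E3 → ℂ) (p : ℕ → E3) (t : ℝ) :
    Monotone fun n => ‖u t (argmaxSeq u p n t)‖ :=
  monotone_nat_of_le_succ (norm_argmaxSeq_le_succ u p t)

theorem norm_le_norm_argmaxSeq (u : ℝ → E3 → ℂ) (p : ℕ → E3) (t : ℝ) (n : ℕ) :
    ‖u t (p n)‖ ≤ ‖u t (argmaxSeq u p n t)‖ := by
  cases n with
  | zero => exact le_rfl
  | succ n =>
    rw [argmaxSeq]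
    split_ifs with h
    · exact le_rfl
    · exact not_lt.1 h

/-- A weak-type test against all measurable selections bounds the maximal function in `L⁴`. -/
theorem lintegral_iSup_pow_four_le {u : ℝ → E3 → ℂ} (hu : Measurable (Function.uncurry u)) {M : ℝ}
    (hM : ∀ t x, ‖u t x‖ ≤ M) {B : ℝ≥0∞}
    (h : ∀ (c : ℝ → ℂ) (ξ : ℝ → E3), Measurable c → Integrable c → Measurable ξ →
      ‖∫ t, c t * u t (ξ t)‖ₑ ≤ B * (∫⁻ t, ‖c t‖ₑ ^ (4 / 3 : ℝ)) ^ (3 / 4 : ℝ)) (p : ℕ → E3) :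
    ∫⁻ t, (⨆ n, ‖u t (p n)‖ₑ) ^ 4 ≤ B ^ 4 := by
  set I : ℕ → Set ℝ := fun n => Icc (-n) n with hI
  set a : ℕ → ℝ → ℝ≥0∞ := fun n => (I n).indicator fun t => ‖u t (argmaxSeq u p n t)‖ₑ ^ 4 with ha
  have hum : ∀ n, Measurable fun t => u t (argmaxSeq u p n t) := fun n =>
    hu.comp (measurable_id.prodMk (measurable_argmaxSeq hu p n))
  have ham : ∀ n, Measurable (a n) := fun n =>
    ((hum n).enorm.pow_const 4).indicator measurableSet_Icc
  have hImono : Monotone I := fun i j hij => by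
    have : (i : ℝ) ≤ j := by exact_mod_cast hij
    exact Icc_subset_Icc (by linarith) this
  have hamono : Monotone a := fun i j hij t => by
    simp only [ha, indicator]
    split_ifs with h1 h2
    · gcongr 1
      rw [← ofReal_norm, ← ofReal_norm]
      exact ENNReal.ofReal_le_ofReal (monotone_norm_argmaxSeq u p t hij)
    · exact absurd (hImono hij h1) h2
    · exact zero_le
    · exact le_rfl
  have hbound : ∀ n, ∫⁻ t, a n t ≤ B ^ 4 := by
    intro n
    set w : ℝ → ℂ := fun t => u t (argmaxSeq u p n t) with hw
    -- The dual function of `w` in `L⁴`, on a bounded interval: both `c w` and `|c|^{4/3}` equal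
    -- `|w|⁴` there, so the hypothesis reads `X ≤ B X^{3/4}`.
    set c : ℝ → ℂ := (I n).indicator fun t => (‖w t‖ ^ 2 : ℝ) * (starRingEnd ℂ) (w t) with hcdef
    have hwm : Measurable w := hum n
    have hcm : Measurable c := by
      refine Measurable.indicator ?_ measurableSet_Icc
      exact (Complex.measurable_ofReal.comp (hwm.norm.pow_const 2)).mul
        (Complex.continuous_conj.measurable.comp hwm)
    have hci : Integrable c := by
      rw [integrable_indicator_iff measurableSet_Icc]
      refine Measure.integrableOn_of_bounded (M := M ^ 3) (by simp) ?_
        (Filter.Eventually.of_forall fun t => ?_)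
      · exact ((Complex.measurable_ofReal.comp (hwm.norm.pow_const 2)).mul
          (Complex.continuous_conj.measurable.comp hwm)).aestronglyMeasurable
      · rw [norm_mul, Complex.norm_real, RCLike.norm_conj, norm_pow, norm_norm]
        calc ‖w t‖ ^ 2 * ‖w t‖ = ‖w t‖ ^ 3 := by ring
          _ ≤ M ^ 3 := pow_le_pow_left₀ (norm_nonneg _) (hM _ _) 3
    have hfin : ∫⁻ t, a n t ≠ ∞ := by
      simp only [ha]
      rw [lintegral_indicator measurableSet_Icc]
      refine ((setLIntegral_mono measurable_const (g := fun _ => ENNReal.ofReal M ^ 4)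
        fun t _ => ?_).trans_lt ?_).ne
      · gcongr 1
        rw [← ofReal_norm]
        exact ENNReal.ofReal_le_ofReal (hM _ _)
      · rw [setLIntegral_const]
        exact ENNReal.mul_lt_top (by simp) (by simp)
    have e1 : ∀ t, c t * u t (argmaxSeq u p n t) =
        (((I n).indicator (fun t => ‖w t‖ ^ 4) t : ℝ) : ℂ) := by
      intro t
      simp only [hcdef, indicator]
      split_ifs
      · change _ * w t = _
        rw [mul_assoc, mul_comm _ (w t), Complex.mul_conj, Complex.normSq_eq_norm_sq]
        push_cast; ring
      · simp
    have e2 : ‖∫ t, c t * u t (argmaxSeq u p n t)‖ₑ = ∫⁻ t, a n t := by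
      simp_rw [e1]
      have hnn : ∀ t, 0 ≤ (I n).indicator (fun t => ‖w t‖ ^ 4) t := fun t =>
        indicator_nonneg (fun t _ => by positivity) t
      have hint : Integrable fun t => (I n).indicator (fun t => ‖w t‖ ^ 4) t := by
        refine (integrable_indicator_iff measurableSet_Icc).2 ?_
        refine Measure.integrableOn_of_bounded (M := M ^ 4) (by simp)
          (hwm.norm.pow_const 4).aestronglyMeasurable (Filter.Eventually.of_forall fun t => ?_)
        rw [norm_pow, norm_norm]
        exact pow_le_pow_left₀ (norm_nonneg _) (hM _ _) 4
      rw [integral_complex_ofReal, ← ofReal_norm, Complex.norm_real,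
        Real.norm_of_nonneg (integral_nonneg hnn),
        ofReal_integral_eq_lintegral_ofReal hint (Filter.Eventually.of_forall hnn)]
      refine lintegral_congr fun t => ?_
      simp only [ha, indicator]
      split_ifs
      · rw [ENNReal.ofReal_pow (norm_nonneg _), ofReal_norm]
      · simp
    have e3 : ∫⁻ t, ‖c t‖ₑ ^ (4 / 3 : ℝ) = ∫⁻ t, a n t := by
      refine lintegral_congr fun t => ?_
      simp only [ha, hcdef, indicator]
      split_ifs
      · have : ‖((‖w t‖ ^ 2 : ℝ) : ℂ) * (starRingEnd ℂ) (w t)‖ₑ = ‖w t‖ₑ ^ (3 : ℝ) := by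
          rw [← ofReal_norm, norm_mul, Complex.norm_real, RCLike.norm_conj, norm_pow, norm_norm,
            ← pow_succ, ENNReal.ofReal_pow (norm_nonneg _), ofReal_norm]
          norm_cast
        rw [this, ← ENNReal.rpow_mul, ← ENNReal.rpow_natCast]
        norm_num
        rfl
      · simp
    refine le_pow_four_of_le_mul_rpow hfin ?_
    have := h c (argmaxSeq u p n) hcm hci (measurable_argmaxSeq hu p n)
    rwa [e2, e3] at this
  calc ∫⁻ t, (⨆ n, ‖u t (p n)‖ₑ) ^ 4 ≤ ∫⁻ t, ⨆ n, a n t := by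
        refine lintegral_mono fun t => ?_
        simp only []
        rw [ENNReal.iSup_pow]
        refine iSup_le fun i => ?_
        obtain ⟨k, hk⟩ := exists_nat_ge |t|
        -- The index has to exceed `i`, so that the point `p i` competes, and `|t|`, so that `t`
        -- lies in the interval.
        refine le_iSup_of_le (max i k) ?_
        have ht : t ∈ I (max i k) := hImono (le_max_right i k) (abs_le.1 hk)
        simp only [ha, indicator_of_mem ht]
        gcongr 1
        rw [← ofReal_norm, ← ofReal_norm]
        exact ENNReal.ofReal_le_ofReal ((norm_le_norm_argmaxSeq u p t i).trans
          (monotone_norm_argmaxSeq u p t (le_max_left i k)))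
    _ = ⨆ n, ∫⁻ t, a n t := lintegral_iSup ham hamono
    _ ≤ B ^ 4 := iSup_le hbound

/-- The supremum of `‖u ·‖` over a fixed dense sequence. -/
def supNorm (u : E3 → ℂ) : ℝ≥0∞ := ⨆ n, ‖u (TopologicalSpace.denseSeq E3 n)‖ₑ

theorem enorm_le_supNorm {u : E3 → ℂ} (hu : Continuous u) (x : E3) : ‖u x‖ₑ ≤ supNorm u := by
  have hcl : IsClosed {x | ‖u x‖ₑ ≤ supNorm u} := isClosed_le hu.enorm continuous_const
  have hd : range (TopologicalSpace.denseSeq E3) ⊆ {x | ‖u x‖ₑ ≤ supNorm u} := by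
    rintro _ ⟨n, rfl⟩
    exact le_iSup (fun n => ‖u (TopologicalSpace.denseSeq E3 n)‖ₑ) n
  exact hcl.closure_subset_iff.2 hd (TopologicalSpace.denseRange_denseSeq E3 x)

theorem supNorm_le {u : E3 → ℂ} {b : ℝ≥0∞} (h : ∀ x, ‖u x‖ₑ ≤ b) : supNorm u ≤ b :=
  iSup_le fun _ => h _

theorem measurable_supNorm {u : ℝ → E3 → ℂ} (hu : Measurable (Function.uncurry u)) :
    Measurable fun t => supNorm (u t) :=
  Measurable.iSup fun _ => (hu.comp (measurable_id.prodMk measurable_const)).enorm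

/-! ### The evolution of an `L²` function -/

theorem enorm_integral_mul_le {A : Type*} [MeasurableSpace A] {μ : Measure A} {p q : ℝ≥0∞}
    [ENNReal.HolderConjugate p q] {f g : A → ℂ} (hf : AEStronglyMeasurable f μ)
    (hg : AEStronglyMeasurable g μ) :
    ‖∫ x, f x * g x ∂μ‖ₑ ≤ eLpNorm f p μ * eLpNorm g q μ := by
  refine (enorm_integral_le_lintegral_enorm _).trans ?_
  have e : ∫⁻ x, ‖f x * g x‖ₑ ∂μ = eLpNorm (f • g) 1 μ := eLpNorm_one_eq_lintegral_enorm.symm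
  rw [e]
  exact eLpNorm_smul_le_mul_eLpNorm (p := p) (q := q) (r := 1) hg hf

/-- The solution at time `t` with Fourier transform `G` at time zero, localized by `m`. -/
def evol (P m : E3 → ℝ) (G : E3 → ℂ) (t : ℝ) (x : E3) : ℂ := ∫ η, G η * wave P m t x η

theorem evol_eq_fourier (P m : E3 → ℝ) (G : E3 → ℂ) (t : ℝ) (x : E3) :
    evol P m G t x = 𝓕 (fun η => G η * wave P m t 0 η) (-x) := by
  rw [evol, Real.fourier_eq']
  refine integral_congr_ae (Filter.Eventually.of_forall fun η => ?_)
  simp only [smul_eq_mul]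
  rw [wave_eq_exp_mul_wave_zero, mul_left_comm, inner_neg_right, real_inner_comm x η]
  congr 2
  push_cast; ring

theorem eLpNorm_comp_neg {p : ℝ≥0∞} {f : E3 → ℂ} (hf : AEStronglyMeasurable f volume) :
    eLpNorm (fun x => f (-x)) p volume = eLpNorm f p volume :=
  eLpNorm_comp_measurePreserving hf (Measure.measurePreserving_neg volume)

/-- The Hausdorff-Young inequality by interpolation of a single function. -/
theorem eLpNorm_fourier_le {r : ℝ≥0∞} (hr : 2 ≤ r) {w : E3 → ℂ} (h1 : Integrable w)
    (h2 : MemLp w 2 volume) : eLpNorm (𝓕 w) r volume ≤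
      eLpNorm w 2 volume ^ (2 * (1 / r).toReal) * eLpNorm w 1 volume ^ (1 - 2 * (1 / r).toReal) := by
  have h := eLpNorm_le_rpow_mul_rpow hr (continuous_fourier h1).aestronglyMeasurable
    (b := eLpNorm w 1 volume) fun x => by
      rw [Real.fourier_eq', eLpNorm_one_eq_lintegral_enorm]
      refine (enorm_integral_le_lintegral_enorm _).trans_eq (lintegral_congr fun η => ?_)
      rw [enorm_smul, ← ofReal_norm (Complex.exp _), Complex.norm_exp_ofReal_mul_I]
      simp
  rwa [eLpNorm_fourier h1 h2] at h

namespace IsDispersive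

variable {P m : E3 → ℝ} {N T : ℝ} {G : E3 → ℂ}

theorem integrable_mul_wave (h : IsDispersive P m N T) (hG : MemLp G 2 volume) (t : ℝ) (x : E3) :
    Integrable fun η => G η * wave P m t x η :=
  hG.integrable_mul (h.memLp_wave 2 t x)

theorem integrable_norm_mul_amp (h : IsDispersive P m N T) (hG : MemLp G 2 volume) :
    Integrable fun η => ‖G η‖ * m η :=
  hG.norm.integrable_mul (h.memLp_amp 2)

theorem memLp_mul_wave (h : IsDispersive P m N T) (hG : MemLp G 2 volume) (t : ℝ) (x : E3) :
    MemLp (fun η => G η * wave P m t x η) 2 volume := by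
  refine hG.mono (h.integrable_mul_wave hG t x).1 (Filter.Eventually.of_forall fun η => ?_)
  rw [norm_mul, h.norm_wave_eq]
  exact mul_le_of_le_one_right (norm_nonneg _) (h.le_one η)

theorem enorm_evol_le (h : IsDispersive P m N T) (hG : MemLp G 2 volume) (t : ℝ) (x : E3) :
    ‖evol P m G t x‖ₑ ≤ ENNReal.ofReal (√N) * eLpNorm G 2 volume := by
  refine (enorm_integral_mul_le (p := 2) (q := 2) hG.1 (h.memLp_wave 2 t x).1).trans ?_
  rw [mul_comm]
  exact mul_le_mul' (h.eLpNorm_wave_two_le t x) le_rfl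

theorem eLpNorm_evol_le (h : IsDispersive P m N T) (hG : MemLp G 2 volume) (t : ℝ) :
    eLpNorm (evol P m G t) 2 volume ≤ eLpNorm G 2 volume := by
  have e : evol P m G t = fun x => 𝓕 (fun η => G η * wave P m t 0 η) (-x) :=
    funext fun x => evol_eq_fourier P m G t x
  rw [e, eLpNorm_comp_neg (continuous_fourier (h.integrable_mul_wave hG t 0)).aestronglyMeasurable,
    eLpNorm_fourier (h.integrable_mul_wave hG t 0) (h.memLp_mul_wave hG t 0)]
  refine eLpNorm_mono fun η => ?_
  rw [norm_mul, h.norm_wave_eq]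
  exact mul_le_of_le_one_right (norm_nonneg _) (h.le_one η)

theorem continuous_evol (h : IsDispersive P m N T) (hG : MemLp G 2 volume) :
    Continuous (Function.uncurry (evol P m G)) := by
  refine continuous_of_dominated (F := fun (p : ℝ × E3) η => G η * wave P m p.1 p.2 η)
    (fun p => (h.integrable_mul_wave hG p.1 p.2).1)
    (fun p => Filter.Eventually.of_forall fun η => ?_) (h.integrable_norm_mul_amp hG)
    (Filter.Eventually.of_forall fun η => ?_)
  · rw [norm_mul, h.norm_wave_eq]
  · have := h.continuous_wave.comp (Continuous.prodMk_left η)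
    exact continuous_const.mul this

/-- The endpoint Strichartz estimate in `L⁴L^∞`. -/
theorem lintegral_supNorm_evol_le (h : IsDispersive P m N T) (hG : MemLp G 2 volume) :
    ∫⁻ t, supNorm (evol P m G t) ^ 4 ≤
      (ENNReal.ofReal (12 * (N * √T)) ^ (1 / 2 : ℝ) * eLpNorm G 2 volume) ^ 4 := by
  have hfin : ENNReal.ofReal (√N) * eLpNorm G 2 volume ≠ ∞ :=
    ENNReal.mul_ne_top ENNReal.ofReal_ne_top hG.2.ne
  refine lintegral_iSup_pow_four_le (h.continuous_evol hG).measurable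
    (M := (ENNReal.ofReal (√N) * eLpNorm G 2 volume).toReal) (fun t x => ?_)
    (fun c ξ hcm hc hξ => ?_) _
  · rw [← toReal_enorm]
    exact ENNReal.toReal_mono hfin (h.enorm_evol_le hG t x)
  · have hτ : Measurable fun t : ℝ => t - 0 := by fun_prop
    -- Testing the evolution along the points `ξ t` is the same as pairing `G` with a superposition
    -- of waves, which is bounded in `L²` by the dual endpoint estimate.
    have e := h.integral_mul_superpose hc hτ hξ hG.1 (h.integrable_norm_mul_amp hG)
    simp only [sub_zero] at e
    have e' : ∫ t, c t * evol P m G t (ξ t) =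
        ∫ η, G η * superpose P m volume c (fun t => t - 0) ξ η := by
      simp only [sub_zero]; exact e.symm
    rw [e']
    refine (enorm_integral_mul_le (p := 2) (q := 2) hG.1 (h.memLp_superpose hc hτ hξ).1).trans ?_
    rw [mul_right_comm, mul_comm]
    exact mul_le_mul' (h.eLpNorm_superpose_le hcm hc hξ 0) le_rfl

end IsDispersive

-- Dominated convergence with majorant `2‖G‖m`. With `q = 1` and `q = 2` together, it gives
-- continuity of the Fourier transforms in every `L^r` with `2 ≤ r ≤ ∞`.
open Filter Topology in
theorem IsDispersive.tendsto_eLpNorm_mul_wave_sub {P m : E3 → ℝ} {N T : ℝ}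
    (h : IsDispersive P m N T) {G : E3 → ℂ} (hG : AEStronglyMeasurable G volume) {q : ℝ≥0∞}
    (hq0 : q ≠ 0) (hqt : q ≠ ∞) (hGm : MemLp (fun η => ‖G η‖ * m η) q volume) (p₀ : ℝ × E3) :
    Tendsto (fun p : ℝ × E3 =>
      eLpNorm (fun η => G η * wave P m p.1 p.2 η - G η * wave P m p₀.1 p₀.2 η) q volume)
      (𝓝 p₀) (𝓝 0) := by
  have hqpos : 0 < q.toReal := ENNReal.toReal_pos hq0 hqt
  have hmeas : ∀ p : ℝ × E3, AEStronglyMeasurable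
      (fun η => G η * wave P m p.1 p.2 η - G η * wave P m p₀.1 p₀.2 η) volume := fun p =>
    (hG.mul (h.continuous_wave_apply _ _).aestronglyMeasurable).sub
      (hG.mul (h.continuous_wave_apply _ _).aestronglyMeasurable)
  have key : Tendsto (fun p : ℝ × E3 => ∫⁻ η,
      ‖G η * wave P m p.1 p.2 η - G η * wave P m p₀.1 p₀.2 η‖ₑ ^ q.toReal) (𝓝 p₀)
      (𝓝 (∫⁻ _ : E3, 0)) := by
    refine tendsto_lintegral_filter_of_dominated_convergence'
      (fun η => ‖(2 : ℝ) * (‖G η‖ * m η)‖ₑ ^ q.toReal) ?_ ?_ ?_ ?_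
    · exact Eventually.of_forall fun p => (hmeas p).enorm.pow_const _
    · refine Eventually.of_forall fun p => Eventually.of_forall fun η => ?_
      refine ENNReal.rpow_le_rpow ?_ hqpos.le
      rw [← ofReal_norm, ← ofReal_norm]
      refine ENNReal.ofReal_le_ofReal ((norm_sub_le _ _).trans ?_)
      rw [norm_mul, norm_mul, h.norm_wave_eq, h.norm_wave_eq, Real.norm_eq_abs]
      exact (two_mul _).symm.trans_le (le_abs_self _)
    · have := (hGm.const_mul (2 : ℝ)).2
      exact ((eLpNorm_lt_top_iff_lintegral_rpow_enorm_lt_top hq0 hqt).1 this).ne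
    · refine Eventually.of_forall fun η => ?_
      have hc : Continuous fun p : ℝ × E3 =>
          ‖G η * wave P m p.1 p.2 η - G η * wave P m p₀.1 p₀.2 η‖ₑ ^ q.toReal := by
        have := h.continuous_wave.comp (Continuous.prodMk_left η)
        exact ENNReal.continuous_rpow_const.comp
          ((continuous_const.mul this).sub continuous_const).enorm
      have := hc.tendsto p₀
      simpa [hqpos] using this
  have := (ENNReal.continuous_rpow_const (y := 1 / q.toReal)).tendsto _ |>.comp key
  simp only [lintegral_zero, ENNReal.zero_rpow_of_pos (one_div_pos.2 hqpos)] at this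
  refine this.congr fun p => ?_
  rw [eLpNorm_eq_lintegral_rpow_enorm_toReal hq0 hqt]
  rfl

theorem two_mul_toReal_one_div_le {r : ℝ≥0∞} (hr : 2 ≤ r) : 2 * (1 / r).toReal ≤ 1 := by
  have h1 : (1 / r).toReal ≤ (1 / 2 : ℝ≥0∞).toReal :=
    ENNReal.toReal_mono (by simp) (ENNReal.div_le_div_left hr 1)
  have h2 : (1 / 2 : ℝ≥0∞).toReal = 1 / 2 := by simp
  linarith

theorem rpow_mul_rpow_le_add {r : ℝ≥0∞} (hr : 2 ≤ r) (x y : ℝ≥0∞) :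
    x ^ (2 * (1 / r).toReal) * y ^ (1 - 2 * (1 / r).toReal) ≤ x + y := by
  have h1 := two_mul_toReal_one_div_le hr
  have h0 : 0 ≤ 2 * (1 / r).toReal := by positivity
  calc x ^ (2 * (1 / r).toReal) * y ^ (1 - 2 * (1 / r).toReal)
      ≤ (x + y) ^ (2 * (1 / r).toReal) * (x + y) ^ (1 - 2 * (1 / r).toReal) :=
        mul_le_mul' (ENNReal.rpow_le_rpow le_self_add h0)
          (ENNReal.rpow_le_rpow le_add_self (by linarith))
    _ = x + y := by
        rw [← ENNReal.rpow_add_of_nonneg _ _ h0 (by linarith), add_sub_cancel, ENNReal.rpow_one]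

theorem eLpNorm_fourier_le_add {r : ℝ≥0∞} (hr : 2 ≤ r) {w : E3 → ℂ} (h1 : Integrable w)
    (h2 : MemLp w 2 volume) :
    eLpNorm (𝓕 w) r volume ≤ eLpNorm w 2 volume + eLpNorm w 1 volume :=
  (eLpNorm_fourier_le hr h1 h2).trans (rpow_mul_rpow_le_add hr _ _)

theorem fourier_sub {f g : E3 → ℂ} (hf : Integrable f) (hg : Integrable g) (y : E3) :
    𝓕 (fun η => f η - g η) y = 𝓕 f y - 𝓕 g y := by
  simp only [Real.fourier_eq]
  rw [← integral_sub]
  · simp only [smul_sub]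
  · exact (Real.fourierIntegral_convergent_iff y).2 hf
  · exact (Real.fourierIntegral_convergent_iff y).2 hg

/-! ### Mixed norms from a pointwise bound -/

/-- Hölder in time: `β^{4/q}` lies in `L^q` as soon as `β` lies in `L⁴`. For `q = ∞` the power is
`β⁰ = 1` and the bound is the `L¹` norm. -/
theorem lintegral_enorm_mul_rpow_le {X : Type*} [NormedAddCommGroup X] {q q' : ℝ≥0∞} (hq : 4 ≤ q)
    (hqq : 1 / q + 1 / q' = 1) {g : ℝ → X} (hg : AEStronglyMeasurable g volume) {β : ℝ → ℝ≥0∞}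
    (hβ : AEMeasurable β volume) :
    ∫⁻ s, ‖g s‖ₑ * β s ^ (4 * (1 / q).toReal) ≤
      eLpNorm g q' volume * (∫⁻ s, β s ^ 4) ^ (1 / q).toReal := by
  rcases eq_or_ne q ∞ with rfl | hqt
  · have : q' = 1 := by simpa using hqq
    subst this
    simp [eLpNorm_one_eq_lintegral_enorm]
  have hq4 : 4 ≤ q.toReal := by simpa using (ENNReal.toReal_le_toReal (by norm_num) hqt).2 hq
  have hq0 : q ≠ 0 := (lt_of_lt_of_le (by norm_num) hq).ne'
  have hq'0 : q' ≠ 0 := by rintro rfl; simp at hqq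
  have hq't : q' ≠ ∞ := by
    rintro rfl
    simp only [one_div, ENNReal.inv_top, add_zero, ENNReal.inv_eq_one] at hqq
    rw [hqq] at hq
    norm_num at hq
  have hr : (1 / q).toReal + (1 / q').toReal = 1 := by
    rw [← ENNReal.toReal_add (by simp [hq0]) (by simp [hq'0]), hqq, ENNReal.toReal_one]
  simp only [one_div, ENNReal.toReal_inv] at hr
  have hconj : Real.HolderConjugate q'.toReal q.toReal := by
    have := (Real.holderConjugate_iff (p := q.toReal) (q := q'.toReal)).2 ⟨by linarith, hr⟩
    exact this.symm
  refine (ENNReal.lintegral_mul_le_Lp_mul_Lq volume hconj hg.enorm (hβ.pow_const _)).trans_eq ?_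
  rw [eLpNorm_eq_lintegral_rpow_enorm_toReal hq'0 hq't]
  simp only [one_div, ENNReal.toReal_inv]
  congr 3
  funext s
  rw [← ENNReal.rpow_mul, mul_assoc, inv_mul_cancel₀ (by linarith), mul_one]
  norm_cast

theorem eLpNorm_le_of_le_rpow {X : Type*} [NormedAddCommGroup X] {q : ℝ≥0∞} (hq : 4 ≤ q)
    {g : ℝ → X} {β : ℝ → ℝ≥0∞} {K : ℝ≥0∞} (hK : K ≠ ∞)
    (h : ∀ t, ‖g t‖ₑ ≤ K * β t ^ (4 * (1 / q).toReal)) :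
    eLpNorm g q volume ≤ K * (∫⁻ s, β s ^ 4) ^ (1 / q).toReal := by
  rcases eq_or_ne q ∞ with rfl | hqt
  · simp only [one_div, ENNReal.inv_top, ENNReal.toReal_zero, mul_zero, ENNReal.rpow_zero,
      mul_one] at h ⊢
    rw [eLpNorm_exponent_top]
    exact eLpNormEssSup_le_of_ae_enorm_bound (Filter.Eventually.of_forall h)
  have hq4 : 4 ≤ q.toReal := by simpa using (ENNReal.toReal_le_toReal (by norm_num) hqt).2 hq
  have hq0 : q ≠ 0 := (lt_of_lt_of_le (by norm_num) hq).ne'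
  rw [eLpNorm_eq_lintegral_rpow_enorm_toReal hq0 hqt]
  simp only [one_div, ENNReal.toReal_inv] at h ⊢
  have e : ∀ t, ‖g t‖ₑ ^ q.toReal ≤ K ^ q.toReal * β t ^ 4 := fun t => by
    refine (ENNReal.rpow_le_rpow (h t) (by linarith)).trans_eq ?_
    rw [ENNReal.mul_rpow_of_nonneg _ _ (by linarith), ← ENNReal.rpow_mul, mul_assoc,
      inv_mul_cancel₀ (by linarith), mul_one]
    norm_cast
  refine (ENNReal.rpow_le_rpow (lintegral_mono e) (by positivity)).trans_eq ?_
  rw [lintegral_const_mul' _ _ (ENNReal.rpow_ne_top_of_nonneg (by linarith) hK),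
    ENNReal.mul_rpow_of_nonneg _ _ (by positivity), ← ENNReal.rpow_mul,
    mul_inv_cancel₀ (by linarith), ENNReal.rpow_one]

open Filter Topology in
/-- A function with `L^∞L^∞`, `L^∞L²` and `L⁴L^∞` bounds lies in the intermediate mixed norm
spaces. -/
theorem exists_Lp_of_bounds {r q : ℝ≥0∞} [Fact (1 ≤ r)] (hr : 2 ≤ r) (hq : 4 ≤ q)
    (hqr : 4 * (1 / q).toReal ≤ 1 - 2 * (1 / r).toReal) {V : ℝ → E3 → ℂ}
    (hcx : ∀ t, Continuous (V t))
    (hcont : ∀ t₀, Tendsto (fun t => eLpNorm (V t - V t₀) r volume) (𝓝 t₀) (𝓝 0))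
    {B₀ B₁ B₂ : ℝ≥0∞} (hB₀ : B₀ ≠ ∞) (hB₁ : B₁ ≠ ∞) (hB₂ : B₂ ≠ ∞) (h0 : ∀ t x, ‖V t x‖ₑ ≤ B₀)
    (h1 : ∀ t, eLpNorm (V t) 2 volume ≤ B₁) (h2 : ∫⁻ t, supNorm (V t) ^ 4 ≤ B₂ ^ 4) :
    ∃ U : Lp (Lp ℂ r (volume : Measure E3)) q (volume : Measure ℝ),
      (∀ᵐ t : ℝ, U t =ᵐ[volume] V t) ∧
      ‖U‖ₑ ≤ B₁ ^ (2 * (1 / r).toReal) * B₂ ^ (4 * (1 / q).toReal) *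
        B₀ ^ (1 - 2 * (1 / r).toReal - 4 * (1 / q).toReal) := by
  have hθ : 0 ≤ 2 * (1 / r).toReal := by positivity
  have hθ1 := two_mul_toReal_one_div_le hr
  have hm : ∀ t, AEStronglyMeasurable (V t) volume := fun t => (hcx t).aestronglyMeasurable
  have hb : ∀ t, eLpNorm (V t) r volume ≤
      B₁ ^ (2 * (1 / r).toReal) * supNorm (V t) ^ (1 - 2 * (1 / r).toReal) := fun t =>
    (eLpNorm_le_rpow_mul_rpow hr (hm t) (enorm_le_supNorm (hcx t))).trans
      (mul_le_mul' (ENNReal.rpow_le_rpow (h1 t) hθ) le_rfl)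
  have hsup : ∀ t, supNorm (V t) ≤ B₀ := fun t => supNorm_le (h0 t)
  have hLp : ∀ t, MemLp (V t) r volume := fun t => by
    refine ⟨hm t, (hb t).trans_lt (ENNReal.mul_lt_top ?_ ?_)⟩
    · exact ENNReal.rpow_lt_top_of_nonneg hθ hB₁
    · exact ENNReal.rpow_lt_top_of_nonneg (by linarith) ((hsup t).trans_lt hB₀.lt_top).ne
  set W : ℝ → Lp ℂ r (volume : Measure E3) := fun t => (hLp t).toLp (V t) with hW
  -- Continuity in time gives strong measurability of `W`, also for `r = ∞`, where the target space
  -- is not separable.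
  have hWc : Continuous W := by
    refine continuous_iff_continuousAt.2 fun t₀ => ?_
    refine tendsto_iff_edist_tendsto_0.2 ?_
    refine (hcont t₀).congr fun t => ?_
    rw [hW, Lp.edist_toLp_toLp]
  set K := B₁ ^ (2 * (1 / r).toReal) * B₀ ^ (1 - 2 * (1 / r).toReal - 4 * (1 / q).toReal) with hK
  have hKt : K ≠ ∞ := ENNReal.mul_ne_top (ENNReal.rpow_ne_top_of_nonneg hθ hB₁)
    (ENNReal.rpow_ne_top_of_nonneg (by linarith) hB₀)
  have hWb : ∀ t, ‖W t‖ₑ ≤ K * supNorm (V t) ^ (4 * (1 / q).toReal) := fun t => by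
    rw [hW, Lp.enorm_toLp]
    refine (hb t).trans ?_
    rw [hK, mul_assoc]
    refine mul_le_mul' le_rfl ?_
    -- The exponent of the supremum is divided: `4/q` is left for the `L⁴` bound in time, and the
    -- nonnegative rest is estimated by `B₀`. This is where the inequality between `q` and `r` is
    -- used.
    have e : 1 - 2 * (1 / r).toReal =
        (1 - 2 * (1 / r).toReal - 4 * (1 / q).toReal) + 4 * (1 / q).toReal := by ring
    conv_lhs => rw [e]
    rw [ENNReal.rpow_add_of_nonneg _ _ (by linarith) (by positivity)]
    exact mul_le_mul' (ENNReal.rpow_le_rpow (hsup t) (by linarith)) le_rfl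
  have hWn : eLpNorm W q volume ≤ K * B₂ ^ (4 * (1 / q).toReal) := by
    refine (eLpNorm_le_of_le_rpow hq hKt hWb).trans (mul_le_mul' le_rfl ?_)
    refine (ENNReal.rpow_le_rpow h2 (by positivity)).trans_eq ?_
    rw [ENNReal.rpow_mul]
    norm_cast
  have hWLp : MemLp W q volume := ⟨hWc.aestronglyMeasurable, hWn.trans_lt
    (ENNReal.mul_lt_top hKt.lt_top (ENNReal.rpow_lt_top_of_nonneg (by positivity) hB₂))⟩
  refine ⟨hWLp.toLp W, ?_, ?_⟩
  · filter_upwards [hWLp.coeFn_toLp] with t ht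
    rw [ht]
    exact (hLp t).coeFn_toLp
  · rw [Lp.enorm_toLp]
    refine hWn.trans_eq ?_
    rw [hK]
    ring

namespace IsDispersive

variable {P m : E3 → ℝ} {N T : ℝ} {G : E3 → ℂ}

open Filter Topology in
theorem tendsto_eLpNorm_evol_sub (h : IsDispersive P m N T) (hG : MemLp G 2 volume) {r : ℝ≥0∞}
    (hr : 2 ≤ r) (t₀ : ℝ) :
    Tendsto (fun t => eLpNorm (evol P m G t - evol P m G t₀) r volume) (𝓝 t₀) (𝓝 0) := by
  have hp : Tendsto (fun t : ℝ => (t, (0 : E3))) (𝓝 t₀) (𝓝 (t₀, 0)) :=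
    (Continuous.prodMk_left (0 : E3)).tendsto t₀
  have hG2 : MemLp (fun η => ‖G η‖ * m η) 2 volume := by
    refine hG.mono (h.integrable_norm_mul_amp hG).1 (Eventually.of_forall fun η => ?_)
    rw [norm_mul, norm_norm, Real.norm_of_nonneg (h.nonneg η)]
    exact mul_le_of_le_one_right (norm_nonneg _) (h.le_one η)
  have l1 := (h.tendsto_eLpNorm_mul_wave_sub hG.1 two_ne_zero ENNReal.ofNat_ne_top hG2
    (t₀, 0)).comp hp
  have l2 := (h.tendsto_eLpNorm_mul_wave_sub hG.1 one_ne_zero ENNReal.one_ne_top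
    (memLp_one_iff_integrable.2 (h.integrable_norm_mul_amp hG)) (t₀, 0)).comp hp
  have l := l1.add l2
  rw [add_zero] at l
  refine tendsto_of_tendsto_of_tendsto_of_le_of_le tendsto_const_nhds l (fun _ => zero_le)
    fun t => ?_
  have i1 := h.integrable_mul_wave hG t 0
  have i2 := h.integrable_mul_wave hG t₀ 0
  have e : evol P m G t - evol P m G t₀ =
      fun x => 𝓕 (fun η => G η * wave P m t 0 η - G η * wave P m t₀ 0 η) (-x) := by
    funext x
    rw [fourier_sub i1 i2, Pi.sub_apply, evol_eq_fourier, evol_eq_fourier]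
  have i3 : Integrable fun η => G η * wave P m t 0 η - G η * wave P m t₀ 0 η := i1.sub i2
  simp only [e]
  rw [eLpNorm_comp_neg (continuous_fourier i3).aestronglyMeasurable]
  exact eLpNorm_fourier_le_add hr i3
    ((h.memLp_mul_wave hG t 0).sub (h.memLp_mul_wave hG t₀ 0))

theorem exists_Lp_evol (h : IsDispersive P m N T) (hG : MemLp G 2 volume) {r q : ℝ≥0∞}
    [Fact (1 ≤ r)] (hr : 2 ≤ r) (hq : 4 ≤ q)
    (hqr : 4 * (1 / q).toReal ≤ 1 - 2 * (1 / r).toReal) :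
    ∃ U : Lp (Lp ℂ r (volume : Measure E3)) q (volume : Measure ℝ),
      (∀ᵐ t : ℝ, U t =ᵐ[volume] evol P m G t) ∧
      ‖U‖ₑ ≤ eLpNorm G 2 volume ^ (2 * (1 / r).toReal) *
        (ENNReal.ofReal (12 * (N * √T)) ^ (1 / 2 : ℝ) * eLpNorm G 2 volume) ^ (4 * (1 / q).toReal) *
        (ENNReal.ofReal (√N) * eLpNorm G 2 volume) ^
          (1 - 2 * (1 / r).toReal - 4 * (1 / q).toReal) := by
  refine exists_Lp_of_bounds hr hq hqr
    (fun t => (h.continuous_evol hG).comp (Continuous.prodMk_right t))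
    (h.tendsto_eLpNorm_evol_sub hG hr) ?_ hG.2.ne ?_ (h.enorm_evol_le hG) (h.eLpNorm_evol_le hG)
    (h.lintegral_supNorm_evol_le hG)
  · exact ENNReal.mul_ne_top ENNReal.ofReal_ne_top hG.2.ne
  · exact ENNReal.mul_ne_top (ENNReal.rpow_ne_top_of_nonneg (by norm_num) ENNReal.ofReal_ne_top)
      hG.2.ne

end IsDispersive

/-! ### The kernel of the propagator in Lebesgue spaces -/

/-- The pointwise bound `min N (N (T / |t|)^{1/2})` for the kernel. -/
def supKer (N T t : ℝ) : ℝ≥0∞ :=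
  if |t| ≤ T then ENNReal.ofReal N else ENNReal.ofReal (N * √T) * sqrtKernel t

theorem measurable_supKer (N T : ℝ) : Measurable (supKer N T) :=
  Measurable.ite (measurableSet_le (by fun_prop) measurable_const) measurable_const
    (measurable_sqrtKernel.const_mul _)

/-- The two sides of the threshold contribute equally: `2T N⁴` from `|t| ≤ T` and `N⁴ T² · 2/T` from
the rest. -/
theorem lintegral_supKer_pow_four_le {N T : ℝ} (hN : 0 ≤ N) (hT : 0 < T) :
    ∫⁻ t, supKer N T t ^ 4 ≤ ENNReal.ofReal (4 * N ^ 4 * T) := by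
  have e : ∀ t, supKer N T t ^ 4 = (Icc (-T) T).indicator (fun _ => ENNReal.ofReal N ^ 4) t +
      ENNReal.ofReal (N * √T) ^ 4 * (if |t| ≤ T then 0 else sqrtKernel t) ^ (4 : ℝ) := fun t => by
    have hmem : t ∈ Icc (-T) T ↔ |t| ≤ T := abs_le.symm
    by_cases ht : |t| ≤ T
    · simp [supKer, ht, indicator, hmem]
    · simp only [supKer, ht, indicator, hmem, if_false, zero_add, mul_pow]
      norm_cast
  simp_rw [e]
  rw [lintegral_add_left (measurable_const.indicator measurableSet_Icc),
    lintegral_indicator measurableSet_Icc, setLIntegral_const, Real.volume_Icc,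
    lintegral_const_mul' _ _ (by simp), lintegral_sqrtKernel_far hT, ← ENNReal.ofReal_pow hN,
    ← ENNReal.ofReal_pow (by positivity), ← ENNReal.ofReal_mul (by positivity),
    ← ENNReal.ofReal_mul (by positivity), ← ENNReal.ofReal_add (by
      have : 0 ≤ T - -T := by linarith
      positivity) (by positivity)]
  refine ENNReal.ofReal_le_ofReal (le_of_eq ?_)
  have hs : √T ^ 4 = T ^ 2 := by
    rw [show √T ^ 4 = (√T ^ 2) ^ 2 by ring, Real.sq_sqrt hT.le]
  rw [mul_pow, hs]
  field_simp
  ring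

/-- The pairing of a function with the kernel of the propagator, that is, its evolution. -/
def pairing (P m : E3 → ℝ) (f : E3 → ℂ) (t : ℝ) (x : E3) : ℂ := ∫ y, f y * 𝓕 (wave P m t x) y

namespace IsDispersive

variable {P m : E3 → ℝ} {N T : ℝ}

theorem enorm_fourier_wave_le_supKer (h : IsDispersive P m N T) (t : ℝ) (x y : E3) :
    ‖𝓕 (wave P m t x) y‖ₑ ≤ supKer N T t := by
  unfold supKer
  split_ifs with ht
  · rw [← ofReal_norm]
    exact ENNReal.ofReal_le_ofReal (h.norm_fourier_wave_le t x y)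
  · refine h.enorm_fourier_wave_le (fun h0 => ht ?_) x y
    simp [h0, h.T_pos.le]

theorem eLpNorm_fourier_wave_le_supKer (h : IsDispersive P m N T) {p : ℝ≥0∞} (hp : 2 ≤ p) (t : ℝ)
    (x : E3) : eLpNorm (𝓕 (wave P m t x)) p volume ≤
      ENNReal.ofReal (√N) ^ (2 * (1 / p).toReal) * supKer N T t ^ (1 - 2 * (1 / p).toReal) :=
  (eLpNorm_le_rpow_mul_rpow hp (continuous_fourier (h.integrable_wave t x)).aestronglyMeasurable
    (h.enorm_fourier_wave_le_supKer t x)).trans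
    (mul_le_mul' (ENNReal.rpow_le_rpow (h.eLpNorm_fourier_wave_le t x) (by positivity)) le_rfl)

theorem eLpNorm_fourier_wave_le_const (h : IsDispersive P m N T) {p : ℝ≥0∞} (hp : 2 ≤ p) (t : ℝ)
    (x : E3) : eLpNorm (𝓕 (wave P m t x)) p volume ≤
      ENNReal.ofReal (√N) + ENNReal.ofReal N := by
  refine (eLpNorm_le_rpow_mul_rpow (b := ENNReal.ofReal N) hp
    (continuous_fourier (h.integrable_wave t x)).aestronglyMeasurable fun y => ?_).trans ?_
  · rw [← ofReal_norm]
    exact ENNReal.ofReal_le_ofReal (h.norm_fourier_wave_le t x y)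
  · exact (rpow_mul_rpow_le_add hp _ _).trans
      (add_le_add (h.eLpNorm_fourier_wave_le t x) le_rfl)

theorem memLp_fourier_wave (h : IsDispersive P m N T) {p : ℝ≥0∞} (hp : 2 ≤ p) (t : ℝ) (x : E3) :
    MemLp (𝓕 (wave P m t x)) p volume :=
  ⟨(continuous_fourier (h.integrable_wave t x)).aestronglyMeasurable,
    (h.eLpNorm_fourier_wave_le_const hp t x).trans_lt
      (ENNReal.add_lt_top.2 ⟨ENNReal.ofReal_lt_top, ENNReal.ofReal_lt_top⟩)⟩

/-- The kernel of the propagator as an element of `L^p`. -/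
def kerLp (h : IsDispersive P m N T) {p : ℝ≥0∞} (hp : 2 ≤ p) (z : ℝ × E3) :
    Lp ℂ p (volume : Measure E3) := (h.memLp_fourier_wave hp z.1 z.2).toLp _

-- By interpolated Hausdorff-Young, continuity in `L^p` for every `2 ≤ p ≤ ∞` follows from
-- continuity of the waves in `L¹` and in `L²`.
open Filter Topology in
theorem continuous_kerLp (h : IsDispersive P m N T) {p : ℝ≥0∞} [Fact (1 ≤ p)] (hp : 2 ≤ p) :
    Continuous (h.kerLp hp) := by
  refine continuous_iff_continuousAt.2 fun z₀ => tendsto_iff_edist_tendsto_0.2 ?_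
  have hm : ∀ q, MemLp (fun η => ‖(1 : ℂ)‖ * m η) q volume := fun q => by
    simpa using h.memLp_amp q
  have l1 := h.tendsto_eLpNorm_mul_wave_sub (G := fun _ => 1) aestronglyMeasurable_const
    two_ne_zero ENNReal.ofNat_ne_top (hm 2) z₀
  have l2 := h.tendsto_eLpNorm_mul_wave_sub (G := fun _ => 1) aestronglyMeasurable_const
    one_ne_zero ENNReal.one_ne_top (hm 1) z₀
  have l := l1.add l2
  simp only [one_mul, add_zero] at l
  refine tendsto_of_tendsto_of_tendsto_of_le_of_le tendsto_const_nhds l (fun _ => zero_le)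
    fun z => ?_
  have i1 := h.integrable_wave z.1 z.2
  have i2 := h.integrable_wave z₀.1 z₀.2
  have e : 𝓕 (wave P m z.1 z.2) - 𝓕 (wave P m z₀.1 z₀.2) =
      𝓕 (fun η => wave P m z.1 z.2 η - wave P m z₀.1 z₀.2 η) :=
    funext fun y => (fourier_sub i1 i2 y).symm
  simp only [kerLp]
  rw [Lp.edist_toLp_toLp, e]
  exact eLpNorm_fourier_le_add hp (i1.sub i2) ((h.memLp_wave 2 _ _).sub (h.memLp_wave 2 _ _))

/-- Measurability and continuity of the evolution of functions with values in `L^{p'}` come from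
this form: a continuous bilinear map applied to `f` and to a continuous family of kernels. -/
theorem pairing_eq_lpPairing (h : IsDispersive P m N T) {p p' : ℝ≥0∞} [Fact (1 ≤ p)]
    [Fact (1 ≤ p')] [ENNReal.HolderConjugate p' p] (hp : 2 ≤ p)
    (f : Lp ℂ p' (volume : Measure E3)) (z : ℝ × E3) :
    pairing P m f z.1 z.2 =
      (ContinuousLinearMap.mul ℂ ℂ).lpPairing volume p' p f (h.kerLp hp z) := by
  rw [ContinuousLinearMap.lpPairing_eq_integral, pairing]
  refine integral_congr_ae ?_
  filter_upwards [(h.memLp_fourier_wave hp z.1 z.2).coeFn_toLp] with y hy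
  rw [kerLp, hy, ContinuousLinearMap.mul_apply']

theorem enorm_pairing_le (h : IsDispersive P m N T) {p p' : ℝ≥0∞} [Fact (1 ≤ p')]
    [ENNReal.HolderConjugate p' p] (hp : 2 ≤ p) (f : Lp ℂ p' (volume : Measure E3)) (t : ℝ)
    (x : E3) : ‖pairing P m f t x‖ₑ ≤ ‖f‖ₑ *
      (ENNReal.ofReal (√N) ^ (2 * (1 / p).toReal) * supKer N T t ^ (1 - 2 * (1 / p).toReal)) := by
  refine (enorm_integral_mul_le (p := p') (q := p) (Lp.aestronglyMeasurable f)
    (h.memLp_fourier_wave hp t x).1).trans ?_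
  rw [← Lp.enorm_def]
  exact mul_le_mul' le_rfl (h.eLpNorm_fourier_wave_le_supKer hp t x)

theorem stronglyMeasurable_pairing (h : IsDispersive P m N T) {p p' : ℝ≥0∞}
    [Fact (1 ≤ p')] [ENNReal.HolderConjugate p' p] (hp : 2 ≤ p) {A : Type*} [MeasurableSpace A]
    {f : A → Lp ℂ p' (volume : Measure E3)} (hf : StronglyMeasurable f) {τ : A → ℝ}
    (hτ : Measurable τ) {ξ : A → E3} (hξ : Measurable ξ) :
    StronglyMeasurable fun a => pairing P m (f a) (τ a) (ξ a) := by
  have : Fact (1 ≤ p) := ⟨one_le_two.trans hp⟩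
  have hs : StronglyMeasurable (h.kerLp hp) := (h.continuous_kerLp hp).stronglyMeasurable
  have hτξ : Measurable fun a => (τ a, ξ a) := hτ.prodMk hξ
  have hk : StronglyMeasurable fun a => h.kerLp hp (τ a, ξ a) := hs.comp_measurable hτξ
  have e : ∀ a, pairing P m (f a) (τ a) (ξ a) =
      (ContinuousLinearMap.mul ℂ ℂ).lpPairing volume p' p (f a) (h.kerLp hp (τ a, ξ a)) :=
    fun a => h.pairing_eq_lpPairing hp (f a) (τ a, ξ a)
  obtain ⟨B, hB⟩ : ∃ B, B = (ContinuousLinearMap.mul ℂ ℂ).lpPairing (volume : Measure E3) p' p :=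
    ⟨_, rfl⟩
  have h3 : StronglyMeasurable fun a => B (f a) (h.kerLp hp (τ a, ξ a)) :=
    B.continuous₂.comp_stronglyMeasurable (hf.prodMk hk)
  simp only [e, ← hB]
  exact h3

theorem continuous_pairing (h : IsDispersive P m N T) {p p' : ℝ≥0∞}
    [Fact (1 ≤ p')] [ENNReal.HolderConjugate p' p] (hp : 2 ≤ p)
    (f : Lp ℂ p' (volume : Measure E3)) (t : ℝ) : Continuous (pairing P m f t) := by
  have : Fact (1 ≤ p) := ⟨one_le_two.trans hp⟩
  have e : pairing P m f t = fun x =>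
      (ContinuousLinearMap.mul ℂ ℂ).lpPairing volume p' p f (h.kerLp hp (t, x)) :=
    funext fun x => h.pairing_eq_lpPairing hp f (t, x)
  rw [e]
  exact (ContinuousLinearMap.continuous _).comp
    ((h.continuous_kerLp hp).comp (Continuous.prodMk_right t))

theorem continuous_fourier_wave (h : IsDispersive P m N T) :
    Continuous fun w : (ℝ × E3) × E3 => 𝓕 (wave P m w.1.1 w.1.2) w.2 := by
  simp_rw [fourier_wave]
  refine continuous_of_dominated (bound := m)
    (fun w => (h.integrable_wave _ _).1)
    (fun w => Filter.Eventually.of_forall fun η => (h.norm_wave_eq _ _ _).le) h.integrable_amp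
    (Filter.Eventually.of_forall fun η => ?_)
  unfold wave
  fun_prop

end IsDispersive

/-! ### The retarded operator -/

/-- The retarded potential `∫_{τ ≤ t} Λ(t - τ) F(τ) dτ`. -/
def retarded (P m : E3 → ℝ) (F : ℝ → E3 → ℂ) (t : ℝ) (x : E3) : ℂ :=
  ∫ τ in Iic t, pairing P m (F τ) (t - τ) x

theorem retarded_eq_integral (P m : E3 → ℝ) (F : ℝ → E3 → ℂ) (t : ℝ) (x : E3) :
    retarded P m F t x = ∫ τ, if τ ≤ t then pairing P m (F τ) (t - τ) x else 0 := by
  rw [retarded, ← integral_indicator measurableSet_Iic]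
  rfl

namespace IsDispersive

variable {P m : E3 → ℝ} {N T : ℝ} {p p' q q' : ℝ≥0∞} [Fact (1 ≤ p')]

/-- The kernel is in `L^p` with norm controlled by a power `1 - 2/p = 4/q` of a function in `L⁴`, so
its norm is in `L^q` in time. Hölder gives absolute convergence of the retarded integral at every
point, uniformly. -/
theorem lintegral_enorm_mul_supKer_le (h : IsDispersive P m N T) (hq : 4 ≤ q)
    (hqq : 1 / q + 1 / q' = 1) (hpq : 1 - 2 * (1 / p).toReal = 4 * (1 / q).toReal)
    (F : Lp (Lp ℂ p' (volume : Measure E3)) q' (volume : Measure ℝ)) (t : ℝ) :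
    ∫⁻ τ, ‖F τ‖ₑ * (ENNReal.ofReal (√N) ^ (2 * (1 / p).toReal) *
      supKer N T (t - τ) ^ (1 - 2 * (1 / p).toReal)) ≤
    ‖F‖ₑ * (ENNReal.ofReal (√N) ^ (2 * (1 / p).toReal) *
      ENNReal.ofReal (4 * N ^ 4 * T) ^ (1 / q).toReal) := by
  have hk : Measurable fun τ => supKer N T (t - τ) :=
    (measurable_supKer N T).comp (measurable_const.sub measurable_id)
  have h1 := lintegral_enorm_mul_rpow_le hq hqq (Lp.aestronglyMeasurable F) hk.aemeasurable
  rw [lintegral_sub_left_eq_self (fun τ => supKer N T τ ^ 4) t, ← Lp.enorm_def] at h1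
  simp_rw [mul_left_comm _ (ENNReal.ofReal (√N) ^ (2 * (1 / p).toReal))]
  rw [lintegral_const_mul' _ _ (ENNReal.rpow_ne_top_of_nonneg (by positivity) ENNReal.ofReal_ne_top),
    hpq]
  refine mul_le_mul' le_rfl (h1.trans (mul_le_mul' le_rfl ?_))
  exact ENNReal.rpow_le_rpow (lintegral_supKer_pow_four_le h.N_pos.le h.T_pos) (by positivity)

theorem bound_ne_top (N T : ℝ) (p q : ℝ≥0∞)
    (F : Lp (Lp ℂ p' (volume : Measure E3)) q' (volume : Measure ℝ)) :
    ‖F‖ₑ * (ENNReal.ofReal (√N) ^ (2 * (1 / p).toReal) *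
      ENNReal.ofReal (4 * N ^ 4 * T) ^ (1 / q).toReal) ≠ ∞ :=
  ENNReal.mul_ne_top enorm_ne_top (ENNReal.mul_ne_top
    (ENNReal.rpow_ne_top_of_nonneg (by positivity) ENNReal.ofReal_ne_top)
    (ENNReal.rpow_ne_top_of_nonneg (by positivity) ENNReal.ofReal_ne_top))

variable [ENNReal.HolderConjugate p' p]

theorem lintegral_enorm_pairing_le (h : IsDispersive P m N T) (hp : 2 ≤ p) (hq : 4 ≤ q)
    (hqq : 1 / q + 1 / q' = 1) (hpq : 1 - 2 * (1 / p).toReal = 4 * (1 / q).toReal)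
    (F : Lp (Lp ℂ p' (volume : Measure E3)) q' (volume : Measure ℝ)) (t : ℝ) (x : E3) :
    ∫⁻ τ, ‖pairing P m (F τ) (t - τ) x‖ₑ ≤
    ‖F‖ₑ * (ENNReal.ofReal (√N) ^ (2 * (1 / p).toReal) *
      ENNReal.ofReal (4 * N ^ 4 * T) ^ (1 / q).toReal) :=
  (lintegral_mono fun τ => h.enorm_pairing_le hp (F τ) (t - τ) x).trans
    (h.lintegral_enorm_mul_supKer_le hq hqq hpq F t)

theorem integrable_pairing (h : IsDispersive P m N T) (hp : 2 ≤ p) (hq : 4 ≤ q)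
    (hqq : 1 / q + 1 / q' = 1) (hpq : 1 - 2 * (1 / p).toReal = 4 * (1 / q).toReal)
    (F : Lp (Lp ℂ p' (volume : Measure E3)) q' (volume : Measure ℝ)) (t : ℝ) (x : E3) :
    Integrable fun τ => pairing P m (F τ) (t - τ) x :=
  ⟨(h.stronglyMeasurable_pairing hp (Lp.stronglyMeasurable F)
      (measurable_const.sub measurable_id) measurable_const).aestronglyMeasurable,
    (h.lintegral_enorm_pairing_le hp hq hqq hpq F t x).trans_lt (bound_ne_top N T p q F).lt_top⟩

theorem enorm_retarded_le (h : IsDispersive P m N T) (hp : 2 ≤ p) (hq : 4 ≤ q)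
    (hqq : 1 / q + 1 / q' = 1) (hpq : 1 - 2 * (1 / p).toReal = 4 * (1 / q).toReal)
    (F : Lp (Lp ℂ p' (volume : Measure E3)) q' (volume : Measure ℝ)) (t : ℝ) (x : E3) :
    ‖retarded P m (fun τ => F τ) t x‖ₑ ≤
    ‖F‖ₑ * (ENNReal.ofReal (√N) ^ (2 * (1 / p).toReal) *
      ENNReal.ofReal (4 * N ^ 4 * T) ^ (1 / q).toReal) :=
  (enorm_integral_le_lintegral_enorm _).trans
    ((setLIntegral_le_lintegral _ _).trans (h.lintegral_enorm_pairing_le hp hq hqq hpq F t x))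

theorem stronglyMeasurable_retardedIntegrand (h : IsDispersive P m N T) (hp : 2 ≤ p)
    (F : Lp (Lp ℂ p' (volume : Measure E3)) q' (volume : Measure ℝ)) {A : Type*}
    [MeasurableSpace A] {s : A → ℝ} (hs : Measurable s) {ξ : A → E3} (hξ : Measurable ξ) :
    StronglyMeasurable fun w : A × ℝ =>
      if w.2 ≤ s w.1 then pairing P m (F w.2) (s w.1 - w.2) (ξ w.1) else 0 := by
  refine StronglyMeasurable.ite (measurableSet_le measurable_snd (hs.comp measurable_fst)) ?_
    stronglyMeasurable_const
  exact h.stronglyMeasurable_pairing hp ((Lp.stronglyMeasurable F).comp_measurable measurable_snd)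
    ((hs.comp measurable_fst).sub measurable_snd) (hξ.comp measurable_fst)

theorem measurable_retarded (h : IsDispersive P m N T) (hp : 2 ≤ p)
    (F : Lp (Lp ℂ p' (volume : Measure E3)) q' (volume : Measure ℝ)) :
    Measurable (Function.uncurry (retarded P m fun τ => F τ)) := by
  have e : Function.uncurry (retarded P m fun τ => F τ) = fun w : ℝ × E3 =>
      ∫ τ, if τ ≤ w.1 then pairing P m (F τ) (w.1 - τ) w.2 else 0 :=
    funext fun w => retarded_eq_integral P m _ w.1 w.2
  rw [e]
  exact (h.stronglyMeasurable_retardedIntegrand hp F measurable_fst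
    measurable_snd).integral_prod_right.measurable

theorem continuous_retarded (h : IsDispersive P m N T) (hp : 2 ≤ p) (hq : 4 ≤ q)
    (hqq : 1 / q + 1 / q' = 1) (hpq : 1 - 2 * (1 / p).toReal = 4 * (1 / q).toReal)
    (F : Lp (Lp ℂ p' (volume : Measure E3)) q' (volume : Measure ℝ)) (t : ℝ) :
    Continuous (retarded P m (fun τ => F τ) t) := by
  set b : ℝ → ℝ≥0∞ := fun τ => ‖F τ‖ₑ * (ENNReal.ofReal (√N) ^ (2 * (1 / p).toReal) *
      supKer N T (t - τ) ^ (1 - 2 * (1 / p).toReal)) with hb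
  have hbm : Measurable b := by
    have hk : Measurable fun τ => supKer N T (t - τ) :=
      (measurable_supKer N T).comp (measurable_const.sub measurable_id)
    exact (Lp.stronglyMeasurable F).enorm.mul ((hk.pow_const _).const_mul _)
  have hbi : ∫⁻ τ, b τ ≠ ∞ := ((h.lintegral_enorm_mul_supKer_le hq hqq hpq F t).trans_lt
    (bound_ne_top N T p q F).lt_top).ne
  have hfin := ae_lt_top hbm hbi
  refine continuous_of_dominated (bound := fun τ => (b τ).toReal)
    (fun x => (h.integrable_pairing hp hq hqq hpq F t x).1.restrict) (fun x => ?_)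
    (integrable_toReal_of_lintegral_ne_top hbm.aemeasurable hbi).restrict
    (Filter.Eventually.of_forall fun τ => h.continuous_pairing hp (F τ) (t - τ))
  filter_upwards [ae_restrict_of_ae hfin] with τ hτ
  rw [← toReal_enorm]
  exact ENNReal.toReal_mono hτ.ne (h.enorm_pairing_le hp (F τ) (t - τ) x)

/-- Fubini for the pairing of a function with a superposition of kernels. -/
theorem integral_mul_pairing (h : IsDispersive P m N T) (hp : 2 ≤ p)
    (f : Lp ℂ p' (volume : Measure E3)) {A : Type*} [MeasurableSpace A] {μ : Measure A} [SFinite μ]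
    {c : A → ℂ} (hc : Integrable c μ) {s : A → ℝ} (hs : Measurable s) {ξ : A → E3}
    (hξ : Measurable ξ) :
    ∫ α, c α * pairing P m f (s α) (ξ α) ∂μ =
      ∫ y, f y * 𝓕 (superpose P m μ c s ξ) y := by
  have hK : Measurable fun w : A × E3 => 𝓕 (wave P m (s w.1) (ξ w.1)) w.2 := by
    have hm : Measurable fun w : A × E3 => ((s w.1, ξ w.1), w.2) := by fun_prop
    have hg : Measurable fun w : (ℝ × E3) × E3 => 𝓕 (wave P m w.1.1 w.1.2) w.2 :=
      h.continuous_fourier_wave.measurable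
    have hgm := hg.comp hm
    simp only [Function.comp_def] at hgm
    exact hgm
  have hf1 : AEStronglyMeasurable (fun w : A × E3 => f w.2) (μ.prod volume) :=
    (Lp.aestronglyMeasurable f).comp_snd
  have hc1 : AEStronglyMeasurable (fun w : A × E3 => c w.1) (μ.prod volume) := hc.1.comp_fst
  have hmeas : AEStronglyMeasurable (Function.uncurry fun α y =>
      c α * (f y * 𝓕 (wave P m (s α) (ξ α)) y)) (μ.prod volume) :=
    hc1.mul (hf1.mul hK.aestronglyMeasurable)
  have hI : Integrable (Function.uncurry fun α y =>
      c α * (f y * 𝓕 (wave P m (s α) (ξ α)) y)) (μ.prod volume) := by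
    refine ⟨hmeas, ?_⟩
    rw [hasFiniteIntegral_iff_enorm, lintegral_prod _ hmeas.enorm]
    have hb : ∀ α, ∫⁻ y, ‖c α * (f y * 𝓕 (wave P m (s α) (ξ α)) y)‖ₑ ≤
        ‖c α‖ₑ * (‖f‖ₑ * (ENNReal.ofReal (√N) + ENNReal.ofReal N)) := fun α => by
      simp_rw [enorm_mul (c α)]
      rw [lintegral_const_mul' _ _ enorm_ne_top]
      refine mul_le_mul' le_rfl ?_
      have e : ∫⁻ y, ‖f y * 𝓕 (wave P m (s α) (ξ α)) y‖ₑ =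
        eLpNorm ((f : E3 → ℂ) • 𝓕 (wave P m (s α) (ξ α))) 1 volume :=
          eLpNorm_one_eq_lintegral_enorm.symm
      rw [e]
      refine (eLpNorm_smul_le_mul_eLpNorm (p := p') (q := p) (r := 1)
        (h.memLp_fourier_wave hp _ _).1 (Lp.aestronglyMeasurable f)).trans ?_
      rw [← Lp.enorm_def]
      exact mul_le_mul' le_rfl (h.eLpNorm_fourier_wave_le_const hp _ _)
    refine (lintegral_mono hb).trans_lt ?_
    have hfin : ‖f‖ₑ * (ENNReal.ofReal (√N) + ENNReal.ofReal N) < ∞ :=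
      ENNReal.mul_lt_top enorm_lt_top
        (ENNReal.add_lt_top.2 ⟨ENNReal.ofReal_lt_top, ENNReal.ofReal_lt_top⟩)
    rw [lintegral_mul_const' _ _ hfin.ne]
    exact ENNReal.mul_lt_top hc.2 hfin
  simp only [pairing, ← integral_const_mul]
  rw [integral_integral_swap hI]
  refine integral_congr_ae (Filter.Eventually.of_forall fun y => ?_)
  simp only
  rw [h.fourier_superpose hc hs hξ, ← integral_const_mul]
  refine integral_congr_ae (Filter.Eventually.of_forall fun α => ?_)
  exact mul_left_comm _ _ _

/-- Testing the retarded potential against a measure carried by points of space-time. -/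
theorem enorm_integral_mul_retarded_le (h : IsDispersive P m N T) (hp : 2 ≤ p) (hq : 4 ≤ q)
    (hqq : 1 / q + 1 / q' = 1) (hpq : 1 - 2 * (1 / p).toReal = 4 * (1 / q).toReal)
    (F : Lp (Lp ℂ p' (volume : Measure E3)) q' (volume : Measure ℝ)) {A : Type*}
    [MeasurableSpace A] {μ : Measure A} [SFinite μ] {c : A → ℂ} (hc : Integrable c μ) {s : A → ℝ}
    (hs : Measurable s) {ξ : A → E3} (hξ : Measurable ξ) :
    ‖∫ α, c α * retarded P m (fun τ => F τ) (s α) (ξ α) ∂μ‖ₑ ≤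
      ∫⁻ τ, ‖F τ‖ₑ * eLpNorm (𝓕 (superpose P m μ ({α | τ ≤ s α}.indicator c)
        (fun α => s α - τ) ξ)) p volume := by
  have hJm : AEStronglyMeasurable (Function.uncurry fun (α : A) (τ : ℝ) => c α *
      if τ ≤ s α then pairing P m (F τ) (s α - τ) (ξ α) else 0) (μ.prod volume) := by
    have hc1 : AEStronglyMeasurable (fun w : A × ℝ => c w.1) (μ.prod volume) := hc.1.comp_fst
    exact hc1.mul (h.stronglyMeasurable_retardedIntegrand hp F hs hξ).aestronglyMeasurable
  have hJ : Integrable (Function.uncurry fun (α : A) (τ : ℝ) => c α *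
      if τ ≤ s α then pairing P m (F τ) (s α - τ) (ξ α) else 0) (μ.prod volume) := by
    refine ⟨hJm, ?_⟩
    rw [hasFiniteIntegral_iff_enorm, lintegral_prod _ hJm.enorm]
    have hb : ∀ α, ∫⁻ τ, ‖c α * if τ ≤ s α then pairing P m (F τ) (s α - τ) (ξ α) else 0‖ₑ ≤
        ‖c α‖ₑ * (‖F‖ₑ * (ENNReal.ofReal (√N) ^ (2 * (1 / p).toReal) *
          ENNReal.ofReal (4 * N ^ 4 * T) ^ (1 / q).toReal)) := fun α => by
      simp_rw [enorm_mul (c α)]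
      rw [lintegral_const_mul' _ _ enorm_ne_top]
      refine mul_le_mul' le_rfl ((lintegral_mono fun τ => ?_).trans
        (h.lintegral_enorm_pairing_le hp hq hqq hpq F (s α) (ξ α)))
      split_ifs
      · exact le_rfl
      · simp
    refine (lintegral_mono hb).trans_lt ?_
    rw [lintegral_mul_const' _ _ (bound_ne_top N T p q F)]
    exact ENNReal.mul_lt_top hc.2 (bound_ne_top N T p q F).lt_top
  simp only [retarded_eq_integral, ← integral_const_mul]
  rw [integral_integral_swap hJ]
  refine (enorm_integral_le_lintegral_enorm _).trans (lintegral_mono fun τ => ?_)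
  have hset : MeasurableSet {α | τ ≤ s α} := measurableSet_le measurable_const hs
  -- The cutoff `τ ≤ s α` is moved from the kernel to the coefficient, so that at fixed `τ` a full
  -- superposition of waves remains.
  have e : ∫ α, c α * (if τ ≤ s α then pairing P m (F τ) (s α - τ) (ξ α) else 0) ∂μ =
      ∫ α, {α | τ ≤ s α}.indicator c α * pairing P m (F τ) (s α - τ) (ξ α) ∂μ := by
    refine integral_congr_ae (Filter.Eventually.of_forall fun α => ?_)
    simp only [indicator, mem_ofPred_eq]
    split_ifs <;> simp
  have hc' : Integrable ({α | τ ≤ s α}.indicator c) μ := hc.indicator hset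
  have hs' : Measurable fun α => s α - τ := hs.sub_const τ
  simp only
  rw [e, h.integral_mul_pairing hp (F τ) hc' hs' hξ]
  refine (enorm_integral_mul_le (p := p') (q := p) (Lp.aestronglyMeasurable (F τ))
    (continuous_fourier (h.integrable_superpose hc' hs' hξ)).aestronglyMeasurable).trans_eq ?_
  rw [← Lp.enorm_def]

end IsDispersive

-- Since `v` is bounded, its conjugate restricted to a ball is an admissible test function with
-- finite norm. Fatou's lemma then lets the ball grow, without assuming that `v` is in `L²`.
open Filter Topology in
theorem eLpNorm_two_le_of_dual {v : E3 → ℂ} (hv : Continuous v) {b : ℝ} (hb : ∀ x, ‖v x‖ ≤ b)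
    {D : ℝ≥0∞} (h : ∀ g : E3 → ℂ, Integrable g → MemLp g 2 volume →
      ‖∫ x, g x * v x‖ₑ ≤ D * eLpNorm g 2 volume) : eLpNorm v 2 volume ≤ D := by
  set I : ℕ → Set E3 := fun n => Metric.closedBall 0 n with hI
  have hIm : ∀ n, MeasurableSet (I n) := fun n => Metric.isClosed_closedBall.measurableSet
  have hIv : ∀ n, volume (I n) < ∞ := fun n => measure_closedBall_lt_top
  have hbound : ∀ n, eLpNorm ((I n).indicator v) 2 volume ≤ D := by
    intro n
    set g : E3 → ℂ := (I n).indicator fun x => (starRingEnd ℂ) (v x) with hg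
    have hgc : Continuous fun x => (starRingEnd ℂ) (v x) := Complex.continuous_conj.comp hv
    have hgp : ∀ p, MemLp g p volume := fun p => by
      rw [hg, memLp_indicator_iff_restrict (hIm n)]
      have : IsFiniteMeasure (volume.restrict (I n)) := ⟨by simpa using hIv n⟩
      exact MemLp.of_bound hgc.aestronglyMeasurable b
        (Eventually.of_forall fun x => by rw [RCLike.norm_conj]; exact hb x)
    have e1 : eLpNorm g 2 volume = eLpNorm ((I n).indicator v) 2 volume := by
      refine eLpNorm_congr_norm_ae (Eventually.of_forall fun x => ?_)
      simp only [hg, indicator]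
      split_ifs
      · exact RCLike.norm_conj _
      · rfl
    have hint : Integrable fun x => ‖g x‖ ^ 2 := (hgp 2).integrable_norm_pow two_ne_zero
    have e2 : ∫ x, g x * v x = ((∫ x, ‖g x‖ ^ 2 : ℝ) : ℂ) := by
      rw [← integral_complex_ofReal]
      refine integral_congr_ae (Eventually.of_forall fun x => ?_)
      simp only [hg, indicator]
      split_ifs
      · rw [mul_comm, Complex.mul_conj, Complex.normSq_eq_norm_sq, RCLike.norm_conj]
      · simp
    have e3 : ‖∫ x, g x * v x‖ₑ = eLpNorm g 2 volume ^ 2 := by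
      rw [e2, ← ofReal_norm, Complex.norm_real,
        Real.norm_of_nonneg (integral_nonneg fun x => by positivity),
        ofReal_integral_eq_lintegral_ofReal hint (Eventually.of_forall fun x => by positivity),
        eLpNorm_eq_lintegral_rpow_enorm_toReal two_ne_zero ENNReal.ofNat_ne_top,
        ← ENNReal.rpow_two, ← ENNReal.rpow_mul]
      simp only [ENNReal.toReal_ofNat, one_div, ENNReal.rpow_two]
      norm_num
    have h1 := h g (memLp_one_iff_integrable.1 (hgp 1)) (hgp 2)
    rw [e3, sq] at h1
    rw [← e1]
    rcases eq_or_ne (eLpNorm g 2 volume) 0 with h0 | h0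
    · rw [h0]; exact zero_le
    · exact (ENNReal.mul_le_mul_iff_left h0 (hgp 2).2.ne).1 h1
  have hlim : ∀ x, Tendsto (fun n => (I n).indicator v x) atTop (𝓝 (v x)) := fun x => by
    obtain ⟨k, hk⟩ := exists_nat_ge ‖x‖
    refine tendsto_const_nhds.congr' ?_
    filter_upwards [eventually_ge_atTop k] with n hn
    have hx : x ∈ I n := by
      rw [hI, mem_closedBall_zero_iff]
      exact hk.trans (by exact_mod_cast hn)
    rw [indicator_of_mem hx]
  refine (Lp.eLpNorm_lim_le_liminf_eLpNorm
    (fun n => hv.aestronglyMeasurable.indicator (hIm n)) v (Eventually.of_forall hlim)).trans ?_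
  exact liminf_le_of_frequently_le' (Frequently.of_forall hbound)

theorem rpow_mul_rpow_of_add_eq_one {S : ℝ≥0∞} {a b : ℝ} (ha : 0 ≤ a) (hb : 0 ≤ b)
    (hab : a + b = 1) : S ^ a * S ^ b = S := by
  rw [← ENNReal.rpow_add_of_nonneg _ _ ha hb, hab, ENNReal.rpow_one]

/-- A superposition at a single time, weighted by `g`, is the free wave with datum `𝓕 g` reflected.
Testing at a fixed time is thereby reduced to the homogeneous estimate. -/
theorem superpose_const_time (P m : E3 → ℝ) (g : E3 → ℂ) (s : ℝ) (η : E3) :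
    superpose P m volume g (fun _ => s) id η = 𝓕 g (-η) * wave P m s 0 η := by
  rw [superpose, Real.fourier_eq', ← integral_mul_const]
  refine integral_congr_ae (Filter.Eventually.of_forall fun x => ?_)
  simp only [id_eq, smul_eq_mul]
  rw [wave_eq_exp_mul_wave_zero, inner_neg_right, ← mul_assoc, mul_comm (g x)]
  congr 3
  push_cast; ring

namespace IsDispersive

variable {P m : E3 → ℝ} {N T : ℝ} {p p' q q' : ℝ≥0∞} [Fact (1 ≤ p')]

theorem fourier_superpose_const_time (P m : E3 → ℝ) (g : E3 → ℂ) (s : ℝ) (y : E3) :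
    𝓕 (superpose P m volume g (fun _ => s) id) y = evol P m (fun η => 𝓕 g (-η)) s (-y) := by
  rw [evol_eq_fourier, neg_neg, ← funext (superpose_const_time P m g s)]

theorem continuous_evol_apply (h : IsDispersive P m N T) {G : E3 → ℂ} (hG : MemLp G 2 volume)
    (t : ℝ) : Continuous (evol P m G t) := by
  have hc : Continuous fun x : E3 => (t, x) := by fun_prop
  have := (h.continuous_evol hG).comp hc
  exact this

/-- The homogeneous estimate in `L^q L^p` on the sharp line `1 - 2/p = 4/q`, paired with `F` by
Hölder in time. -/
theorem lintegral_enorm_mul_evol_le (h : IsDispersive P m N T) (hp : 2 ≤ p) (hq : 4 ≤ q)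
    (hqq : 1 / q + 1 / q' = 1) (hpq : 1 - 2 * (1 / p).toReal = 4 * (1 / q).toReal)
    (F : Lp (Lp ℂ p' (volume : Measure E3)) q' (volume : Measure ℝ)) {G : E3 → ℂ}
    (hG : MemLp G 2 volume) (t : ℝ) :
    ∫⁻ τ, ‖F τ‖ₑ * eLpNorm (evol P m G (t - τ)) p volume ≤
      ‖F‖ₑ * (ENNReal.ofReal (12 * (N * √T)) ^ (1 / 2 : ℝ)) ^ (4 * (1 / q).toReal) *
        eLpNorm G 2 volume := by
  set S := eLpNorm G 2 volume with hS
  have hcx := h.continuous_evol_apply hG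
  have hβ : Measurable fun τ => supNorm (evol P m G (t - τ)) :=
    have hm : Measurable fun s => supNorm (evol P m G s) :=
      measurable_supNorm (h.continuous_evol hG).measurable
    have hst : Measurable fun τ : ℝ => t - τ := by fun_prop
    hm.comp hst
  have h1 : ∀ τ, ‖F τ‖ₑ * eLpNorm (evol P m G (t - τ)) p volume ≤
      S ^ (2 * (1 / p).toReal) *
        (‖F τ‖ₑ * supNorm (evol P m G (t - τ)) ^ (4 * (1 / q).toReal)) := fun τ => by
    rw [mul_left_comm, ← hpq]
    refine mul_le_mul' le_rfl ((eLpNorm_le_rpow_mul_rpow hp (hcx _).aestronglyMeasurable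
      (enorm_le_supNorm (hcx _))).trans (mul_le_mul' ?_ le_rfl))
    exact ENNReal.rpow_le_rpow (h.eLpNorm_evol_le hG _) (by positivity)
  refine (lintegral_mono h1).trans ?_
  rw [lintegral_const_mul' _ _ (ENNReal.rpow_ne_top_of_nonneg (by positivity) hG.2.ne)]
  have h2 := lintegral_enorm_mul_rpow_le hq hqq (Lp.aestronglyMeasurable F) hβ.aemeasurable
  rw [lintegral_sub_left_eq_self (fun τ => supNorm (evol P m G τ) ^ 4) t, ← Lp.enorm_def] at h2
  have h3 : (∫⁻ τ, supNorm (evol P m G τ) ^ 4) ^ (1 / q).toReal ≤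
      (ENNReal.ofReal (12 * (N * √T)) ^ (1 / 2 : ℝ)) ^ (4 * (1 / q).toReal) *
        S ^ (4 * (1 / q).toReal) := by
    refine (ENNReal.rpow_le_rpow (h.lintegral_supNorm_evol_le hG) (by positivity)).trans_eq ?_
    rw [← ENNReal.mul_rpow_of_nonneg _ _ (by positivity), ENNReal.rpow_mul _ 4]
    norm_cast
  refine (mul_le_mul' le_rfl (h2.trans (mul_le_mul' le_rfl h3))).trans_eq ?_
  rw [mul_left_comm, mul_left_comm (S ^ _), rpow_mul_rpow_of_add_eq_one (by positivity)
    (by positivity) (by linarith), mul_assoc]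

/-- Translation in time. -/
def _root_.RotatingEuler.timeShift
    (F : Lp (Lp ℂ p' (volume : Measure E3)) q' (volume : Measure ℝ)) (t : ℝ) :
    Lp (Lp ℂ p' (volume : Measure E3)) q' (volume : Measure ℝ) :=
  Lp.compMeasurePreserving (fun σ => σ + t) (measurePreserving_add_right volume t) F

theorem coeFn_timeShift (F : Lp (Lp ℂ p' (volume : Measure E3)) q' (volume : Measure ℝ)) (t : ℝ) :
    ∀ᵐ τ, timeShift F t τ = F (τ + t) :=
  Lp.coeFn_compMeasurePreserving F (measurePreserving_add_right volume t)

theorem continuous_timeShift [Fact (1 ≤ q')] (hq' : q' ≠ ∞)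
    (F : Lp (Lp ℂ p' (volume : Measure E3)) q' (volume : Measure ℝ)) :
    Continuous (timeShift F) := by
  have hg : Continuous fun t : ℝ => (⟨fun σ => σ + t, by fun_prop⟩ : C(ℝ, ℝ)) :=
    ContinuousMap.continuous_of_continuous_uncurry _ (by
      change Continuous fun w : ℝ × ℝ => w.2 + w.1
      fun_prop)
  exact Continuous.compMeasurePreservingLp continuous_const hg
    (fun t => measurePreserving_add_right volume t) hq'

/-- All dependence on `t` is moved into a translate of `F`, so that continuity in time of the
retarded potential follows from continuity of translations in `L^{q'}`. -/
theorem retarded_eq_zero_time (P m : E3 → ℝ)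
    (F : Lp (Lp ℂ p' (volume : Measure E3)) q' (volume : Measure ℝ)) (t : ℝ) (x : E3) :
    retarded P m (fun τ => F τ) t x = retarded P m (fun τ => timeShift F t τ) 0 x := by
  rw [retarded_eq_integral, retarded_eq_integral,
    ← integral_add_right_eq_self (fun τ => if τ ≤ t then pairing P m (F τ) (t - τ) x else 0) t]
  refine integral_congr_ae ?_
  filter_upwards [coeFn_timeShift F t] with τ hτ
  have : t - (τ + t) = 0 - τ := by ring
  simp only [hτ, this, add_le_iff_nonpos_left]

variable [ENNReal.HolderConjugate p' p]

/-- By duality with `g` in `L²`: for `τ ≤ t` the test superposition is the free evolution of `g`,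
and for `τ > t` it vanishes. The homogeneous estimate then bounds the pairing. -/
theorem eLpNorm_retarded_le (h : IsDispersive P m N T) (hp : 2 ≤ p) (hq : 4 ≤ q)
    (hqq : 1 / q + 1 / q' = 1) (hpq : 1 - 2 * (1 / p).toReal = 4 * (1 / q).toReal)
    (F : Lp (Lp ℂ p' (volume : Measure E3)) q' (volume : Measure ℝ)) (t : ℝ) :
    eLpNorm (retarded P m (fun τ => F τ) t) 2 volume ≤
      ‖F‖ₑ * (ENNReal.ofReal (12 * (N * √T)) ^ (1 / 2 : ℝ)) ^ (4 * (1 / q).toReal) := by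
  refine eLpNorm_two_le_of_dual (h.continuous_retarded hp hq hqq hpq F t)
    (b := (‖F‖ₑ * (ENNReal.ofReal (√N) ^ (2 * (1 / p).toReal) *
      ENNReal.ofReal (4 * N ^ 4 * T) ^ (1 / q).toReal)).toReal) (fun x => ?_)
    fun g hg1 hg2 => ?_
  · rw [← toReal_enorm]
    exact ENNReal.toReal_mono (bound_ne_top N T p q F) (h.enorm_retarded_le hp hq hqq hpq F t x)
  refine (h.enorm_integral_mul_retarded_le hp hq hqq hpq F hg1 (s := fun _ => t) measurable_const
    (ξ := id) measurable_id).trans ?_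
  have hG : MemLp (fun η => 𝓕 g (-η)) 2 volume :=
    (memLp_fourier hg1 hg2).comp_measurePreserving (Measure.measurePreserving_neg volume)
  have hGn : eLpNorm (fun η => 𝓕 g (-η)) 2 volume = eLpNorm g 2 volume := by
    rw [eLpNorm_comp_neg (memLp_fourier hg1 hg2).1, eLpNorm_fourier hg1 hg2]
  rw [← hGn]
  refine (lintegral_mono fun τ => mul_le_mul' le_rfl ?_).trans
    (h.lintegral_enorm_mul_evol_le hp hq hqq hpq F hG t)
  by_cases hτ : τ ≤ t
  · have e : {_α : E3 | τ ≤ t}.indicator g = g := by simp [hτ]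
    have hc := h.continuous_evol_apply hG (t - τ)
    have e' : 𝓕 (superpose P m volume g (fun _ => t - τ) id) =
        fun y => evol P m (fun η => 𝓕 g (-η)) (t - τ) (-y) :=
      funext (fourier_superpose_const_time P m g (t - τ))
    rw [e, e']
    exact (eLpNorm_comp_neg hc.aestronglyMeasurable).le
  · have e : 𝓕 (superpose P m volume ({_α : E3 | τ ≤ t}.indicator g) (fun _ => t - τ) id) = 0 := by
      funext y
      have : superpose P m volume ({_α : E3 | τ ≤ t}.indicator g) (fun _ => t - τ) id =
          fun _ => 0 := by
        funext η
        simp [superpose, hτ]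
      rw [this, Real.fourier_eq']
      simp
    rw [e, eLpNorm_zero]
    exact zero_le

-- By duality with coefficients `c` at points `ξ t`. At fixed `τ` the transform of the test
-- superposition is interpolated between `L²`, bounded by `TT*`, and `L^∞`, bounded by the potential
-- `b` of `|c|`. Both bounds are monotone in `|c|`, so restricting `c` to `t ≥ τ` is harmless. Since
-- `b` is in `L⁴` in time, Hölder against `F` closes the estimate.
set_option maxHeartbeats 1000000 in
theorem lintegral_supNorm_retarded_le (h : IsDispersive P m N T) (hp : 2 ≤ p) (hq : 4 ≤ q)
    (hqq : 1 / q + 1 / q' = 1) (hpq : 1 - 2 * (1 / p).toReal = 4 * (1 / q).toReal)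
    (F : Lp (Lp ℂ p' (volume : Measure E3)) q' (volume : Measure ℝ)) :
    ∫⁻ t, supNorm (retarded P m (fun τ => F τ) t) ^ 4 ≤
      (‖F‖ₑ * ((ENNReal.ofReal (12 * (N * √T)) ^ (1 / 2 : ℝ)) ^ (2 * (1 / p).toReal) *
        ENNReal.ofReal (12 * (N * √T)) ^ (4 * (1 / q).toReal))) ^ 4 := by
  refine lintegral_iSup_pow_four_le (h.measurable_retarded hp F)
    (M := (‖F‖ₑ * (ENNReal.ofReal (√N) ^ (2 * (1 / p).toReal) *
      ENNReal.ofReal (4 * N ^ 4 * T) ^ (1 / q).toReal)).toReal) (fun t x => ?_)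
    (fun c ξ hcm hc hξ => ?_) _
  · rw [← toReal_enorm]
    exact ENNReal.toReal_mono (bound_ne_top N T p q F) (h.enorm_retarded_le hp hq hqq hpq F t x)
  refine (h.enorm_integral_mul_retarded_le hp hq hqq hpq F hc measurable_id hξ).trans ?_
  set S := (∫⁻ t, ‖c t‖ₑ ^ (4 / 3 : ℝ)) ^ (3 / 4 : ℝ) with hS
  set K := ENNReal.ofReal (12 * (N * √T)) with hK
  set b : ℝ → ℝ≥0∞ := fun τ => ENNReal.ofReal (N * √T) * ∫⁻ t, ‖c t‖ₑ * sqrtKernel (t - τ) with hb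
  have hbm : Measurable b := by
    have hk := measurable_sqrtKernel
    have hce := hcm.enorm
    have : Measurable fun w : ℝ × ℝ => ‖c w.2‖ₑ * sqrtKernel (w.2 - w.1) := by fun_prop
    exact this.lintegral_prod_right'.const_mul _
  have hb4 : ∫⁻ τ, b τ ^ 4 ≤ (K * S) ^ 4 := by
    simp only [hb, mul_pow]
    rw [lintegral_const_mul' _ _ (by simp)]
    refine (mul_le_mul' le_rfl (lintegral_potential_pow_four_le hcm.enorm)).trans_eq ?_
    rw [hK, ENNReal.ofReal_mul (by norm_num : (0 : ℝ) ≤ 12), ← mul_pow, ← mul_pow]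
    congr 1
    norm_num
    ring
  have h1 : ∀ τ, ‖F τ‖ₑ * eLpNorm (𝓕 (superpose P m volume ({t : ℝ | τ ≤ id t}.indicator c)
      (fun t => id t - τ) ξ)) p volume ≤
      (K ^ (1 / 2 : ℝ) * S) ^ (2 * (1 / p).toReal) * (‖F τ‖ₑ * b τ ^ (4 * (1 / q).toReal)) := by
    intro τ
    rw [mul_left_comm, ← hpq]
    refine mul_le_mul' le_rfl ?_
    have hset : MeasurableSet {t : ℝ | τ ≤ id t} := measurableSet_le measurable_const measurable_id
    have hc' : Integrable ({t : ℝ | τ ≤ id t}.indicator c) := hc.indicator hset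
    have hcm' : Measurable ({t : ℝ | τ ≤ id t}.indicator c) := hcm.indicator hset
    have hs' : Measurable fun t : ℝ => t - τ := by fun_prop
    have hle : ∀ t, ‖{t : ℝ | τ ≤ id t}.indicator c t‖ₑ ≤ ‖c t‖ₑ := fun t =>
      enorm_indicator_le_enorm_self _ _
    refine (eLpNorm_le_rpow_mul_rpow hp
      (continuous_fourier (h.integrable_superpose hc' hs' hξ)).aestronglyMeasurable
      (b := b τ) fun y => ?_).trans (mul_le_mul' ?_ le_rfl)
    · rw [h.fourier_superpose hc' hs' hξ]
      refine (enorm_integral_le_lintegral_enorm _).trans ?_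
      simp only [hb]
      rw [← lintegral_const_mul' _ _ ENNReal.ofReal_ne_top]
      refine lintegral_mono_ae ?_
      filter_upwards [Measure.ae_ne volume τ] with t ht
      rw [enorm_mul, mul_left_comm]
      exact mul_le_mul' (hle t) (h.enorm_fourier_wave_le (sub_ne_zero.2 ht) _ _)
    · refine ENNReal.rpow_le_rpow ?_ (by positivity)
      rw [eLpNorm_fourier (h.integrable_superpose hc' hs' hξ) (h.memLp_superpose hc' hs' hξ)]
      refine (h.eLpNorm_superpose_le hcm' hc' hξ τ).trans (mul_le_mul' le_rfl ?_)
      refine ENNReal.rpow_le_rpow (lintegral_mono fun t => ?_) (by norm_num)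
      exact ENNReal.rpow_le_rpow (hle t) (by norm_num)
  refine (lintegral_mono h1).trans ?_
  have hFb : Measurable fun τ => ‖F τ‖ₑ * b τ ^ (4 * (1 / q).toReal) :=
    (Lp.stronglyMeasurable F).enorm.mul (hbm.pow_const _)
  rw [lintegral_const_mul _ hFb]
  have h2 := lintegral_enorm_mul_rpow_le hq hqq (Lp.aestronglyMeasurable F) hbm.aemeasurable
  rw [← Lp.enorm_def] at h2
  have h3 : (∫⁻ τ, b τ ^ 4) ^ (1 / q).toReal ≤
      K ^ (4 * (1 / q).toReal) * S ^ (4 * (1 / q).toReal) := by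
    refine (ENNReal.rpow_le_rpow hb4 (by positivity)).trans_eq ?_
    rw [← ENNReal.mul_rpow_of_nonneg _ _ (by positivity), ENNReal.rpow_mul _ 4]
    norm_cast
  refine (mul_le_mul' le_rfl (h2.trans (mul_le_mul' le_rfl h3))).trans_eq ?_
  rw [ENNReal.mul_rpow_of_nonneg _ _ (by positivity)]
  -- The powers of `‖c‖_{4/3}` from the two ends add up to one, as duality requires.
  have e : S ^ (2 * (1 / p).toReal) * S ^ (4 * (1 / q).toReal) = S :=
    rpow_mul_rpow_of_add_eq_one (by positivity) (by positivity) (by linarith)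
  conv_rhs => rw [← e]
  ring

theorem pairing_sub (h : IsDispersive P m N T) (hp : 2 ≤ p) (f g : Lp ℂ p' (volume : Measure E3))
    (t : ℝ) (x : E3) :
    pairing P m (f - g : Lp ℂ p' (volume : Measure E3)) t x =
      pairing P m f t x - pairing P m g t x := by
  have : Fact (1 ≤ p) := ⟨one_le_two.trans hp⟩
  have e := fun f => h.pairing_eq_lpPairing (p' := p') hp f (t, x)
  simp only at e
  rw [e, e, e, map_sub, sub_apply]

theorem retarded_sub (h : IsDispersive P m N T) (hp : 2 ≤ p) (hq : 4 ≤ q)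
    (hqq : 1 / q + 1 / q' = 1) (hpq : 1 - 2 * (1 / p).toReal = 4 * (1 / q).toReal)
    (F F' : Lp (Lp ℂ p' (volume : Measure E3)) q' (volume : Measure ℝ)) (t : ℝ) (x : E3) :
    retarded P m (fun τ => (F - F') τ) t x =
      retarded P m (fun τ => F τ) t x - retarded P m (fun τ => F' τ) t x := by
  simp only [retarded]
  rw [← integral_sub (h.integrable_pairing hp hq hqq hpq F t x).restrict
    (h.integrable_pairing hp hq hqq hpq F' t x).restrict]
  refine integral_congr_ae ?_
  filter_upwards [ae_restrict_of_ae (Lp.coeFn_sub F F')] with τ hτ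
  rw [hτ, Pi.sub_apply, h.pairing_sub hp]

-- The difference of two times is the retarded potential at time zero of a difference of translates
-- of `F`. Its `L²` and `L^∞` bounds control every `L^r` in between. The exponent `q' ≠ ∞` is needed
-- for continuity of translations.
set_option maxHeartbeats 1000000 in
open Filter Topology in
theorem tendsto_eLpNorm_retarded_sub (h : IsDispersive P m N T) (hp : 2 ≤ p) (hq : 4 ≤ q)
    (hqq : 1 / q + 1 / q' = 1) (hpq : 1 - 2 * (1 / p).toReal = 4 * (1 / q).toReal)
    [Fact (1 ≤ q')] (hq' : q' ≠ ∞)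
    (F : Lp (Lp ℂ p' (volume : Measure E3)) q' (volume : Measure ℝ)) {r : ℝ≥0∞} (hr : 2 ≤ r)
    (t₀ : ℝ) :
    Tendsto (fun t => eLpNorm (retarded P m (fun τ => F τ) t - retarded P m (fun τ => F τ) t₀) r
      volume) (𝓝 t₀) (𝓝 0) := by
  set D₁ := (ENNReal.ofReal (12 * (N * √T)) ^ (1 / 2 : ℝ)) ^ (4 * (1 / q).toReal) with hD₁
  set D₀ := ENNReal.ofReal (√N) ^ (2 * (1 / p).toReal) *
      ENNReal.ofReal (4 * N ^ 4 * T) ^ (1 / q).toReal with hD₀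
  have hD₁t : D₁ ≠ ∞ := ENNReal.rpow_ne_top_of_nonneg (by positivity)
    (ENNReal.rpow_ne_top_of_nonneg (by norm_num) ENNReal.ofReal_ne_top)
  have hD₀t : D₀ ≠ ∞ := ENNReal.mul_ne_top
    (ENNReal.rpow_ne_top_of_nonneg (by positivity) ENNReal.ofReal_ne_top)
    (ENNReal.rpow_ne_top_of_nonneg (by positivity) ENNReal.ofReal_ne_top)
  have hbd : ∀ t, eLpNorm (retarded P m (fun τ => F τ) t - retarded P m (fun τ => F τ) t₀) r volume
      ≤ edist (timeShift F t) (timeShift F t₀) * (D₁ + D₀) := fun t => by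
    have e : retarded P m (fun τ => F τ) t - retarded P m (fun τ => F τ) t₀ =
        retarded P m (fun τ => (timeShift F t - timeShift F t₀) τ) 0 := by
      funext x
      rw [h.retarded_sub hp hq hqq hpq, Pi.sub_apply, retarded_eq_zero_time P m F t,
        retarded_eq_zero_time P m F t₀]
    rw [e, edist_eq_enorm_sub, mul_add]
    refine (eLpNorm_le_rpow_mul_rpow hr
      (h.continuous_retarded hp hq hqq hpq (timeShift F t - timeShift F t₀) 0).aestronglyMeasurable
      (h.enorm_retarded_le hp hq hqq hpq (timeShift F t - timeShift F t₀) 0)).trans ?_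
    exact (rpow_mul_rpow_le_add hr _ _).trans
      (add_le_add (h.eLpNorm_retarded_le hp hq hqq hpq (timeShift F t - timeShift F t₀) 0) le_rfl)
  have hl : Tendsto (fun t => edist (timeShift F t) (timeShift F t₀) * (D₁ + D₀)) (𝓝 t₀) (𝓝 0) := by
    have := ENNReal.Tendsto.mul_const (b := D₁ + D₀)
      (tendsto_iff_edist_tendsto_0.1 ((continuous_timeShift hq' F).tendsto t₀))
      (Or.inr (ENNReal.add_ne_top.2 ⟨hD₁t, hD₀t⟩))
    rwa [zero_mul] at this
  exact tendsto_of_tendsto_of_tendsto_of_le_of_le tendsto_const_nhds hl (fun _ => zero_le) hbd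

theorem exists_Lp_retarded (h : IsDispersive P m N T) (hp : 2 ≤ p) (hq : 4 ≤ q)
    (hqq : 1 / q + 1 / q' = 1) (hpq : 1 - 2 * (1 / p).toReal = 4 * (1 / q).toReal)
    (F : Lp (Lp ℂ p' (volume : Measure E3)) q' (volume : Measure ℝ)) {r s : ℝ≥0∞}
    [Fact (1 ≤ r)] (hr : 2 ≤ r) (hs : 4 ≤ s)
    (hsr : 4 * (1 / s).toReal ≤ 1 - 2 * (1 / r).toReal) :
    ∃ U : Lp (Lp ℂ r (volume : Measure E3)) s (volume : Measure ℝ),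
      (∀ᵐ t : ℝ, U t =ᵐ[volume] retarded P m (fun τ => F τ) t) ∧
      ‖U‖ₑ ≤ (‖F‖ₑ * (ENNReal.ofReal (12 * (N * √T)) ^ (1 / 2 : ℝ)) ^ (4 * (1 / q).toReal)) ^
          (2 * (1 / r).toReal) *
        (‖F‖ₑ * ((ENNReal.ofReal (12 * (N * √T)) ^ (1 / 2 : ℝ)) ^ (2 * (1 / p).toReal) *
          ENNReal.ofReal (12 * (N * √T)) ^ (4 * (1 / q).toReal))) ^ (4 * (1 / s).toReal) *
        (‖F‖ₑ * (ENNReal.ofReal (√N) ^ (2 * (1 / p).toReal) *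
          ENNReal.ofReal (4 * N ^ 4 * T) ^ (1 / q).toReal)) ^
          (1 - 2 * (1 / r).toReal - 4 * (1 / s).toReal) := by
  have hq1 : 1 ≤ q' := by
    have : 1 / q' ≤ 1 / q + 1 / q' := le_add_self
    rw [hqq, one_div] at this
    exact ENNReal.inv_le_one.1 this
  have : Fact (1 ≤ q') := ⟨hq1⟩
  -- An infinite `q'` would force `q = 1`, against `4 ≤ q`.
  have hq't : q' ≠ ∞ := by
    rintro rfl
    simp only [one_div, ENNReal.inv_top, add_zero, ENNReal.inv_eq_one] at hqq
    rw [hqq] at hq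
    norm_num at hq
  refine exists_Lp_of_bounds hr hs hsr (h.continuous_retarded hp hq hqq hpq F)
    (h.tendsto_eLpNorm_retarded_sub hp hq hqq hpq hq't F hr) (bound_ne_top N T p q F) ?_ ?_
    (h.enorm_retarded_le hp hq hqq hpq F) (h.eLpNorm_retarded_le hp hq hqq hpq F)
    (h.lintegral_supNorm_retarded_le hp hq hqq hpq F)
  · exact ENNReal.mul_ne_top enorm_ne_top (ENNReal.rpow_ne_top_of_nonneg (by positivity)
      (ENNReal.rpow_ne_top_of_nonneg (by norm_num) ENNReal.ofReal_ne_top))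
  · exact ENNReal.mul_ne_top enorm_ne_top (ENNReal.mul_ne_top
      (ENNReal.rpow_ne_top_of_nonneg (by positivity)
        (ENNReal.rpow_ne_top_of_nonneg (by norm_num) ENNReal.ofReal_ne_top))
      (ENNReal.rpow_ne_top_of_nonneg (by positivity) ENNReal.ofReal_ne_top))

end IsDispersive

/-! ### The propagators `Λ_k` -/

theorem integral_comp_two_pi_smul (g : E3 → ℂ) :
    ((1 / (2 * Real.pi) ^ 3 : ℝ) : ℂ) * ∫ ξ, g ξ = ∫ η, g ((2 * Real.pi) • η) := by
  rw [Measure.integral_comp_smul, finrank_euclideanSpace_fin, Complex.real_smul,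
    abs_of_nonneg (by positivity), one_div]

/-- The phase in Mathlib's normalization of the Fourier transform. -/
def scaledPhase (p : E3 → ℝ) (δ : ℝ) (η : E3) : ℝ := p ((2 * Real.pi) • η) / δ

/-- The amplitude in Mathlib's normalization of the Fourier transform. -/
def scaledAmp (ψ : E3 → ℝ) (k : ℤ) (η : E3) : ℝ := ψ ((2 : ℝ) ^ (-k) • (2 * Real.pi) • η)

theorem wave_scaled (p ψ : E3 → ℝ) (δ : ℝ) (k : ℤ) (t : ℝ) (x η : E3) :
    wave (scaledPhase p δ) (scaledAmp ψ k) t x η =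
      Complex.exp (Complex.I * ((inner ℝ x ((2 * Real.pi) • η) +
        t / δ * p ((2 * Real.pi) • η) : ℝ) : ℂ)) *
        (ψ ((2 : ℝ) ^ (-k) • (2 * Real.pi) • η) : ℂ) := by
  rw [wave, scaledPhase, scaledAmp, inner_smul_right]
  congr 4
  ring

theorem integral_wave_scaled (p ψ : E3 → ℝ) (δ : ℝ) (k : ℤ) (t : ℝ) (x : E3) :
    ∫ η, wave (scaledPhase p δ) (scaledAmp ψ k) t x η = ((1 / (2 * Real.pi) ^ 3 : ℝ) : ℂ) *
      ∫ ξ, Complex.exp (Complex.I * ((inner ℝ x ξ + t / δ * p ξ : ℝ) : ℂ)) *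
        (ψ ((2 : ℝ) ^ (-k) • ξ) : ℂ) := by
  rw [integral_comp_two_pi_smul]
  simp_rw [wave_scaled]

theorem one_div_two_pi_cube_le_one : 1 / (2 * Real.pi) ^ 3 ≤ 1 := by
  rw [div_le_one (by positivity)]
  exact one_le_pow₀ (by linarith [Real.pi_gt_three])

theorem norm_integral_wave_scaled_le (p ψ : E3 → ℝ) (δ : ℝ) (k : ℤ) (t : ℝ) (x : E3) :
    ‖∫ η, wave (scaledPhase p δ) (scaledAmp ψ k) t x η‖ ≤
      ‖∫ ξ, Complex.exp (Complex.I * ((inner ℝ x ξ + t / δ * p ξ : ℝ) : ℂ)) *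
        (ψ ((2 : ℝ) ^ (-k) • ξ) : ℂ)‖ := by
  rw [integral_wave_scaled, norm_mul, Complex.norm_real, Real.norm_of_nonneg (by positivity)]
  exact mul_le_of_le_one_left (norm_nonneg _) one_div_two_pi_cube_le_one

theorem continuous_phase (a s ν : ℝ) : Continuous (phase a s ν) := by
  unfold phase
  fun_prop

/-- The frequency-localized propagators are dispersive, uniformly in all parameters. -/
theorem exists_isDispersive {γ : ℝ} (hγ : 1 < γ) {a : ℝ} (ha : a ≠ 0) {s : ℝ}
    (hs : s = 1 ∨ s = -1) {φ : 𝓢(E3, ℝ)} (hφ : IsCutoff φ) :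
    ∃ C : ℝ, 0 < C ∧ ∀ (ε δ : ℝ), 0 < ε → 0 < δ → ∀ k : ℤ,
      IsDispersive (scaledPhase (phase a s (nu γ ε δ)) δ) (scaledAmp (fun η => φ η ^ 2) k)
        (C * (2 : ℝ) ^ (3 * k)) (calM (nu γ ε δ) k * ε) := by
  have hsm : ContDiff ℝ 1 φ := φ.smooth 1
  have hsupp : ∀ n : ℕ, n ≠ 0 → tsupport (fun η => φ η ^ n) ⊆ {η | 1 / 2 ≤ ‖η‖ ∧ ‖η‖ ≤ 3} :=
    fun n hn => (closure_mono fun η (hη : φ η ^ n ≠ 0) =>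
      show φ η ≠ 0 from fun h0 => hη (by rw [h0, zero_pow hn])).trans hφ.support_subset
  obtain ⟨C₁, hC₁, h₁⟩ := exists_dispersive hγ ha hs (ψ := fun η => φ η ^ 2) (hsm.pow 2)
    (fun η => by positivity) (hsupp 2 two_ne_zero)
  -- The fourth power is the amplitude of `TT*`, since the propagator itself carries the square.
  obtain ⟨C₂, hC₂, h₂⟩ := exists_dispersive hγ ha hs (ψ := fun η => φ η ^ 4) (hsm.pow 4)
    (fun η => by positivity) (hsupp 4 four_ne_zero)
  have hcs : HasCompactSupport φ :=
    (isCompact_closedBall (0 : E3) 3).of_isClosed_subset (isClosed_tsupport _)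
      fun ξ hξ => mem_closedBall_zero_iff.2 (hφ.support_subset hξ).2
  have hint : 0 ≤ ∫ ξ, φ ξ ^ 2 := integral_nonneg fun ξ => by positivity
  set C₃ := ∫ ξ, φ ξ ^ 2 with hC₃
  refine ⟨C₁ + C₂ + C₃ + 1, by positivity, fun ε δ hε hδ k => ?_⟩
  have h2k : (0 : ℝ) < 2 ^ (3 * k) := by positivity
  have hpi : (2 * Real.pi) ≠ 0 := by positivity
  have hM : 0 < calM (nu γ ε δ) k := calM_pos (nu_pos hγ hε hδ) k
  have hamp : Continuous fun η : E3 => φ ((2 : ℝ) ^ (-k) • (2 * Real.pi) • η) := by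
    have := φ.continuous
    fun_prop
  have hle : ∀ {c : ℝ}, c ≤ C₁ + C₂ + C₃ + 1 → ∀ w : ℝ,
      c * (2 : ℝ) ^ (3 * k) * √w ≤ (C₁ + C₂ + C₃ + 1) * (2 : ℝ) ^ (3 * k) * √w := fun hc w => by
    gcongr
  refine ⟨?_, hamp.pow 2, ?_, fun η => sq_nonneg _, fun η => ?_, by positivity, by positivity, ?_,
    fun t x ht => ?_, fun t x ht => ?_⟩
  · have := continuous_phase a s (nu γ ε δ)
    unfold scaledPhase
    fun_prop
  · have h1 : HasCompactSupport fun η : E3 => φ ((2 : ℝ) ^ (-k) • (2 * Real.pi) • η) := by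
      have h2 := (hcs.comp_homeomorph (Homeomorph.smulOfNeZero ((2 : ℝ) ^ (-k))
        (by positivity))).comp_homeomorph (Homeomorph.smulOfNeZero (2 * Real.pi) hpi)
      exact h2
    exact h1.comp_left (g := fun y : ℝ => y ^ 2) (by simp)
  · exact pow_le_one₀ (hφ.nonneg _) (hφ.le_one _)
  · have e1 : ∫ η, scaledAmp (fun η => φ η ^ 2) k η =
        (1 / (2 * Real.pi) ^ 3) * ((2 : ℝ) ^ (3 * k) * C₃) := by
      simp only [scaledAmp]
      rw [Measure.integral_comp_smul volume (fun η => φ ((2 : ℝ) ^ (-k) • η) ^ 2),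
        Measure.integral_comp_smul volume (fun η => φ η ^ 2), finrank_euclideanSpace_fin,
        abs_of_nonneg (by positivity), abs_of_nonneg (by positivity), ← hC₃, smul_eq_mul,
        smul_eq_mul, one_div]
      congr 2
      rw [← zpow_natCast, ← zpow_mul, ← zpow_neg]
      congr 1
      push_cast; ring
    rw [e1]
    calc (1 / (2 * Real.pi) ^ 3) * ((2 : ℝ) ^ (3 * k) * C₃) ≤ (2 : ℝ) ^ (3 * k) * C₃ :=
          mul_le_of_le_one_left (by positivity) one_div_two_pi_cube_le_one
      _ = C₃ * (2 : ℝ) ^ (3 * k) := mul_comm _ _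
      _ ≤ _ := by gcongr; linarith
  · exact (norm_integral_wave_scaled_le _ _ _ _ _ _).trans
      ((h₁ ε δ hε hδ k t x ht).trans (hle (by linarith) _))
  · have e : (fun η => scaledAmp (fun η => φ η ^ 2) k η ^ 2) = scaledAmp (fun η => φ η ^ 4) k := by
      funext η
      simp only [scaledAmp]
      ring
    rw [e]
    exact (norm_integral_wave_scaled_le _ _ _ _ _ _).trans
      ((h₂ ε δ hε hδ k t x ht).trans (hle (by linarith) _))

/-- The multiplication formula moves the Fourier transform from `f` to the smooth compactly
supported wave. All later estimates then use only the kernel, for data in `L^ρ` with `1 ≤ ρ ≤ 2`. -/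
theorem Lam_eq_pairing {φ : 𝓢(E3, ℝ)} {p : E3 → ℝ} {δ : ℝ} {k : ℤ} {N T : ℝ}
    (h : IsDispersive (scaledPhase p δ) (scaledAmp (fun η => φ η ^ 2) k) N T) {ρ : ℝ≥0∞}
    (hρ : 1 ≤ ρ) (hρ2 : ρ ≤ 2) {f : E3 → ℂ} (hf : MemLp f ρ volume) (t : ℝ) (x : E3) :
    Lam φ p δ k t f x =
      pairing (scaledPhase p δ) (scaledAmp (fun η => φ η ^ 2) k) f t x := by
  rw [pairing, ← integral_fourierHat_mul_eq hρ hρ2 hf (h.integrable_wave t x) (h.memLp_wave 2 t x),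
    Lam, integral_comp_two_pi_smul]
  refine integral_congr_ae (Filter.Eventually.of_forall fun η => ?_)
  simp only [wave_scaled]
  exact mul_comm _ _

theorem Lam_eq_evol {φ : 𝓢(E3, ℝ)} {p : E3 → ℝ} {δ : ℝ} {k : ℤ} {N T : ℝ}
    (h : IsDispersive (scaledPhase p δ) (scaledAmp (fun η => φ η ^ 2) k) N T) {f : E3 → ℂ}
    (hf : MemLp f 2 volume) (t : ℝ) (x : E3) :
    Lam φ p δ k t f x =
      evol (scaledPhase p δ) (scaledAmp (fun η => φ η ^ 2) k) (plancherel f) t x := by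
  rw [Lam_eq_pairing h one_le_two le_rfl hf, pairing, evol,
    integral_plancherel_mul_eq hf (h.integrable_wave t x) (h.memLp_wave 2 t x)]

theorem eLpNorm_plancherel (f : Lp ℂ 2 (volume : Measure E3)) :
    eLpNorm (plancherel f) 2 volume = ‖f‖ₑ := by
  have e : plancherel f = ((𝓕 f : Lp ℂ 2 (volume : Measure E3)) : E3 → ℂ) := by
    rw [plancherel, dif_pos (Lp.memLp f), Lp.toLp_coeFn]
  rw [e, ← Lp.enorm_def, ← ofReal_norm, ← ofReal_norm, Lp.norm_fourier_eq]

/-! ### Exponents and constants -/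

theorem toReal_two_div (r : ℝ≥0∞) : (2 / r).toReal = 2 * (1 / r).toReal := by
  rw [ENNReal.toReal_div, ENNReal.toReal_div]
  simp [div_eq_mul_inv]

theorem toReal_half_mul_one_sub {r : ℝ≥0∞} (hr : 2 ≤ r) :
    (1 / 2 * (1 - 2 / r)).toReal = 1 / 2 * (1 - 2 * (1 / r).toReal) := by
  have h1 : 2 / r ≤ 1 := ENNReal.div_le_of_le_mul (by simpa using hr)
  rw [ENNReal.toReal_mul, ENNReal.toReal_sub_of_le h1 ENNReal.one_ne_top, toReal_two_div]
  simp

theorem four_mul_toReal_le {q r : ℝ≥0∞} (hr : 2 ≤ r) (h : 2 / q ≤ 1 / 2 * (1 - 2 / r)) :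
    4 * (1 / q).toReal ≤ 1 - 2 * (1 / r).toReal := by
  have h1 := ENNReal.toReal_mono (ENNReal.mul_ne_top (by simp)
    (ne_top_of_le_ne_top ENNReal.one_ne_top tsub_le_self)) h
  rw [toReal_two_div, toReal_half_mul_one_sub hr] at h1
  linarith

theorem one_sub_two_mul_toReal_eq {q r : ℝ≥0∞} (hr : 2 ≤ r) (h : 2 / q = 1 / 2 * (1 - 2 / r)) :
    1 - 2 * (1 / r).toReal = 4 * (1 / q).toReal := by
  have h1 := congrArg ENNReal.toReal h
  rw [toReal_two_div, toReal_half_mul_one_sub hr] at h1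
  linarith

theorem four_le_of_two_div_eq {q r : ℝ≥0∞} (h : 2 / q = 1 / 2 * (1 - 2 / r)) : 4 ≤ q := by
  have h1 : 2 / q ≤ 1 / 2 := by
    rw [h]
    exact (mul_le_mul' le_rfl tsub_le_self).trans_eq (mul_one _)
  rw [ENNReal.div_le_iff_le_mul (Or.inr (by simp)) (Or.inr (by simp))] at h1
  calc (4 : ℝ≥0∞) = 2 * 2 := by norm_num
    _ ≤ 2 * (1 / 2 * q) := mul_le_mul' le_rfl h1
    _ = q := by
      rw [← mul_assoc, one_div, ENNReal.mul_inv_cancel two_ne_zero ENNReal.ofNat_ne_top, one_mul]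

theorem conj_le_two {r r' : ℝ≥0∞} (hr : 2 ≤ r) (h : 1 / r + 1 / r' = 1) : r' ≤ 2 := by
  have h1 : 1 / r ≤ 1 / 2 := ENNReal.div_le_div_left hr 1
  have h2 : (1 / 2 : ℝ≥0∞) + 1 / 2 ≤ 1 / 2 + 1 / r' := by
    rw [ENNReal.add_halves]
    exact h.symm.trans_le (add_le_add h1 le_rfl)
  have h3 := (ENNReal.add_le_add_iff_left (by simp)).1 h2
  rw [one_div, one_div] at h3
  exact ENNReal.inv_le_inv.1 h3

theorem mul_rpow_mul_rpow_mul_rpow (S x y z : ℝ≥0∞) {α β κ : ℝ} (hα : 0 ≤ α) (hβ : 0 ≤ β)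
    (hκ : 0 ≤ κ) (h : α + β + κ = 1) :
    (S * x) ^ α * (S * y) ^ β * (S * z) ^ κ = x ^ α * y ^ β * z ^ κ * S := by
  have e : S ^ α * S ^ β * S ^ κ = S := by
    rw [← ENNReal.rpow_add_of_nonneg _ _ hα hβ, ← ENNReal.rpow_add_of_nonneg _ _ (by linarith) hκ,
      h, ENNReal.rpow_one]
  rw [ENNReal.mul_rpow_of_nonneg _ _ hα, ENNReal.mul_rpow_of_nonneg _ _ hβ,
    ENNReal.mul_rpow_of_nonneg _ _ hκ]
  conv_rhs => rw [← e]
  ring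

theorem homogeneous_constant {C T θ κ : ℝ} (hC : 0 < C) (hT : 0 < T) (k : ℤ) :
    ((12 * (C * (2 : ℝ) ^ (3 * k) * √T)) ^ (1 / 2 : ℝ)) ^ (4 * κ) *
      (√(C * (2 : ℝ) ^ (3 * k))) ^ (1 - 2 * θ - 4 * κ) =
    12 ^ (2 * κ) * C ^ (1 / 2 - θ) * (2 : ℝ) ^ (3 * k * (1 / 2 - θ)) * T ^ κ := by
  have e2 : (2 : ℝ) ^ (3 * k) = (2 : ℝ) ^ (3 * k : ℝ) := by
    rw [← Real.rpow_intCast]; push_cast; rfl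
  rw [e2]
  -- Each positive base is written as an exponential, and the identity becomes one between
  -- exponents. The power of `C 2^{3k}` is `2κ + (1 - 2θ - 4κ)/2 = 1/2 - θ`.
  obtain ⟨c, rfl⟩ : ∃ c, Real.exp c = C := ⟨_, Real.exp_log hC⟩
  obtain ⟨t, rfl⟩ : ∃ t, Real.exp t = T := ⟨_, Real.exp_log hT⟩
  obtain ⟨l, hl⟩ : ∃ l, Real.exp l = (2 : ℝ) := ⟨_, Real.exp_log two_pos⟩
  obtain ⟨w, hw⟩ : ∃ w, Real.exp w = (12 : ℝ) := ⟨_, Real.exp_log (by norm_num)⟩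
  simp only [Real.sqrt_eq_rpow]
  rw [show (2 : ℝ) ^ (3 * k : ℝ) = Real.exp (l * (3 * k)) by rw [Real.exp_mul, hl],
    show (2 : ℝ) ^ (3 * k * (1 / 2 - θ) : ℝ) = Real.exp (l * (3 * k * (1 / 2 - θ))) by
      rw [Real.exp_mul, hl], ← hw]
  simp only [← Real.exp_mul, ← Real.exp_add]
  congr 1
  ring

theorem retarded_constant {C T θ κ θ₁ κ₁ : ℝ} (hC : 0 < C) (hT : 0 < T) (k : ℤ)
    (h₁ : 1 - 2 * θ₁ = 4 * κ₁) :
    (((12 * (C * (2 : ℝ) ^ (3 * k) * √T)) ^ (1 / 2 : ℝ)) ^ (4 * κ₁)) ^ (2 * θ) *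
      (((12 * (C * (2 : ℝ) ^ (3 * k) * √T)) ^ (1 / 2 : ℝ)) ^ (2 * θ₁) *
        (12 * (C * (2 : ℝ) ^ (3 * k) * √T)) ^ (4 * κ₁)) ^ (4 * κ) *
      ((√(C * (2 : ℝ) ^ (3 * k))) ^ (2 * θ₁) *
        (4 * (C * (2 : ℝ) ^ (3 * k)) ^ 4 * T) ^ κ₁) ^ (1 - 2 * θ - 4 * κ) =
    12 ^ (4 * κ₁ * θ + 4 * κ * (1 / 2 + 2 * κ₁)) * 4 ^ (κ₁ * (1 - 2 * θ - 4 * κ)) *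
      C ^ (1 / 2 + 2 * κ₁ - θ) * (2 : ℝ) ^ (3 * k * (1 / 2 + 2 * κ₁ - θ)) * T ^ (κ + κ₁) := by
  -- The sharp admissibility relation is what makes the powers of `C 2^{3k}` and of `T` collapse to
  -- the stated ones.
  obtain rfl : θ₁ = 1 / 2 - 2 * κ₁ := by linarith
  have e2 : (2 : ℝ) ^ (3 * k) = (2 : ℝ) ^ (3 * k : ℝ) := by
    rw [← Real.rpow_intCast]; push_cast; rfl
  rw [e2]
  obtain ⟨c, rfl⟩ : ∃ c, Real.exp c = C := ⟨_, Real.exp_log hC⟩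
  obtain ⟨t, rfl⟩ : ∃ t, Real.exp t = T := ⟨_, Real.exp_log hT⟩
  obtain ⟨l, hl⟩ : ∃ l, Real.exp l = (2 : ℝ) := ⟨_, Real.exp_log two_pos⟩
  obtain ⟨w, hw⟩ : ∃ w, Real.exp w = (12 : ℝ) := ⟨_, Real.exp_log (by norm_num)⟩
  obtain ⟨v, hv⟩ : ∃ v, Real.exp v = (4 : ℝ) := ⟨_, Real.exp_log (by norm_num)⟩
  simp only [Real.sqrt_eq_rpow]
  rw [show (2 : ℝ) ^ (3 * k : ℝ) = Real.exp (l * (3 * k)) by rw [Real.exp_mul, hl],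
    show (2 : ℝ) ^ (3 * k * (1 / 2 + 2 * κ₁ - θ) : ℝ) =
      Real.exp (l * (3 * k * (1 / 2 + 2 * κ₁ - θ))) by rw [Real.exp_mul, hl],
    ← hw, show (4 : ℝ) ^ (κ₁ * (1 - 2 * θ - 4 * κ)) = Real.exp (v * (κ₁ * (1 - 2 * θ - 4 * κ))) by
      rw [Real.exp_mul, hv],
    show ∀ X : ℝ, (4 : ℝ) * X * Real.exp t = Real.exp v * X * Real.exp t by simp [hv],
    show ∀ X : ℝ, X ^ 4 = X ^ (4 : ℝ) from fun X => by norm_cast]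
  simp only [← Real.exp_mul, ← Real.exp_add]
  congr 1
  ring

theorem Lp_norm_le_of_enorm_le {X Y E E' : Type*} [MeasurableSpace X] [MeasurableSpace Y]
    [NormedAddCommGroup E] [NormedAddCommGroup E'] {μ : Measure X} {μ' : Measure Y}
    {p p' : ℝ≥0∞} {u : Lp E p μ} {v : Lp E' p' μ'} {c : ℝ} (hc : 0 ≤ c)
    (h : ‖u‖ₑ ≤ ENNReal.ofReal c * ‖v‖ₑ) : ‖u‖ ≤ c * ‖v‖ := by
  rw [Lp.enorm_def, Lp.enorm_def] at h
  have := ENNReal.toReal_mono (ENNReal.mul_ne_top ENNReal.ofReal_ne_top (Lp.eLpNorm_ne_top v)) h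
  rwa [ENNReal.toReal_mul, ENNReal.toReal_ofReal hc, ← Lp.norm_def, ← Lp.norm_def] at this

theorem ofReal_homogeneous_constant {C T θ κ : ℝ} (hC : 0 < C) (hT : 0 < T) (k : ℤ) (hκ : 0 ≤ κ)
    (hθκ : 4 * κ ≤ 1 - 2 * θ) :
    (ENNReal.ofReal (12 * (C * (2 : ℝ) ^ (3 * k) * √T)) ^ (1 / 2 : ℝ)) ^ (4 * κ) *
      ENNReal.ofReal (√(C * (2 : ℝ) ^ (3 * k))) ^ (1 - 2 * θ - 4 * κ) =
    ENNReal.ofReal (12 ^ (2 * κ) * C ^ (1 / 2 - θ) * (2 : ℝ) ^ (3 * k * (1 / 2 - θ)) * T ^ κ) := by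
  rw [ENNReal.ofReal_rpow_of_nonneg (by positivity) (by norm_num),
    ENNReal.ofReal_rpow_of_nonneg (by positivity) (by linarith),
    ENNReal.ofReal_rpow_of_nonneg (by positivity) (by linarith),
    ← ENNReal.ofReal_mul (by positivity), homogeneous_constant hC hT]

theorem ofReal_retarded_constant {C T θ κ θ₁ κ₁ : ℝ} (hC : 0 < C) (hT : 0 < T) (k : ℤ)
    (hθ : 0 ≤ θ) (hκ : 0 ≤ κ) (hθκ : 4 * κ ≤ 1 - 2 * θ) (hθ₁ : 0 ≤ θ₁) (hκ₁ : 0 ≤ κ₁)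
    (h₁ : 1 - 2 * θ₁ = 4 * κ₁) :
    ((ENNReal.ofReal (12 * (C * (2 : ℝ) ^ (3 * k) * √T)) ^ (1 / 2 : ℝ)) ^ (4 * κ₁)) ^ (2 * θ) *
      ((ENNReal.ofReal (12 * (C * (2 : ℝ) ^ (3 * k) * √T)) ^ (1 / 2 : ℝ)) ^ (2 * θ₁) *
        ENNReal.ofReal (12 * (C * (2 : ℝ) ^ (3 * k) * √T)) ^ (4 * κ₁)) ^ (4 * κ) *
      (ENNReal.ofReal (√(C * (2 : ℝ) ^ (3 * k))) ^ (2 * θ₁) *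
        ENNReal.ofReal (4 * (C * (2 : ℝ) ^ (3 * k)) ^ 4 * T) ^ κ₁) ^ (1 - 2 * θ - 4 * κ) =
    ENNReal.ofReal (12 ^ (4 * κ₁ * θ + 4 * κ * (1 / 2 + 2 * κ₁)) *
      4 ^ (κ₁ * (1 - 2 * θ - 4 * κ)) * C ^ (1 / 2 + 2 * κ₁ - θ) *
      (2 : ℝ) ^ (3 * k * (1 / 2 + 2 * κ₁ - θ)) * T ^ (κ + κ₁)) := by
  rw [ENNReal.ofReal_rpow_of_nonneg (by positivity) (by norm_num),
    ENNReal.ofReal_rpow_of_nonneg (by positivity) (by linarith),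
    ENNReal.ofReal_rpow_of_nonneg (by positivity) (by linarith),
    ENNReal.ofReal_rpow_of_nonneg (by positivity) (by linarith),
    ENNReal.ofReal_rpow_of_nonneg (by positivity) (by linarith),
    ENNReal.ofReal_rpow_of_nonneg (by positivity) (by linarith),
    ENNReal.ofReal_rpow_of_nonneg (by positivity) (by linarith),
    ← ENNReal.ofReal_mul (by positivity), ← ENNReal.ofReal_mul (by positivity),
    ENNReal.ofReal_rpow_of_nonneg (by positivity) (by linarith),
    ENNReal.ofReal_rpow_of_nonneg (by positivity) (by linarith),
    ← ENNReal.ofReal_mul (by positivity), ← ENNReal.ofReal_mul (by positivity),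
    retarded_constant hC hT k h₁]

/-! ### The Strichartz estimates for `Λ_k` -/

theorem le_mul_mul_mul_of_le {n A C x y z : ℝ} (h : n ≤ A * x * y * z) (hAC : A ≤ C) (hx : 0 ≤ x)
    (hy : 0 ≤ y) (hz : 0 ≤ z) : n ≤ C * x * y * z :=
  h.trans (by gcongr)

/-- The constant in the homogeneous Strichartz estimate. -/
def homogeneousConst (C : ℝ) (q r : ℝ≥0∞) : ℝ :=
  12 ^ (2 * (1 / q).toReal) * C ^ (1 / 2 - (1 / r).toReal)

/-- The constant in the retarded Strichartz estimate. -/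
def retardedConst (C : ℝ) (q r q₁ : ℝ≥0∞) : ℝ :=
  12 ^ (4 * (1 / q₁).toReal * (1 / r).toReal +
      4 * (1 / q).toReal * (1 / 2 + 2 * (1 / q₁).toReal)) *
    4 ^ ((1 / q₁).toReal * (1 - 2 * (1 / r).toReal - 4 * (1 / q).toReal)) *
    C ^ (1 / 2 + 2 * (1 / q₁).toReal - (1 / r).toReal)

theorem homogeneousConst_pos {C : ℝ} (hC : 0 < C) (q r : ℝ≥0∞) : 0 < homogeneousConst C q r := by
  unfold homogeneousConst; positivity

theorem retardedConst_pos {C : ℝ} (hC : 0 < C) (q r q₁ : ℝ≥0∞) : 0 < retardedConst C q r q₁ := by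
  unfold retardedConst; positivity

/-- The homogeneous Strichartz estimate. -/
theorem exists_Lp_Lam {φ : 𝓢(E3, ℝ)} {p : E3 → ℝ} {δ : ℝ} {k : ℤ} {C T : ℝ} (hC : 0 < C)
    (h : IsDispersive (scaledPhase p δ) (scaledAmp (fun η => φ η ^ 2) k) (C * (2 : ℝ) ^ (3 * k)) T)
    {q r : ℝ≥0∞} [Fact (1 ≤ r)] (hr : 2 ≤ r) (hq : 4 ≤ q)
    (hqr : 4 * (1 / q).toReal ≤ 1 - 2 * (1 / r).toReal) (f : Lp ℂ 2 (volume : Measure E3)) :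
    ∃ U : Lp (Lp ℂ r (volume : Measure E3)) q (volume : Measure ℝ),
      (∀ᵐ t : ℝ, U t =ᵐ[volume] Lam φ p δ k t f) ∧
      ‖U‖ ≤ homogeneousConst C q r *
        (2 : ℝ) ^ (3 * k * (1 / 2 - (1 / r).toReal)) * T ^ (1 / q).toReal * ‖f‖ := by
  have hT := h.T_pos
  have hC' := homogeneousConst_pos hC q r
  obtain ⟨U, hU, hUn⟩ := h.exists_Lp_evol (plancherel_memLp f) hr hq hqr
  refine ⟨U, ?_, Lp_norm_le_of_enorm_le (by positivity) (hUn.trans_eq ?_)⟩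
  · filter_upwards [hU] with t ht
    refine ht.trans (Filter.Eventually.of_forall fun x => ?_)
    exact (Lam_eq_evol h (Lp.memLp f) t x).symm
  · have hκ : 0 ≤ (1 / q).toReal := ENNReal.toReal_nonneg
    have hθ : 0 ≤ (1 / r).toReal := ENNReal.toReal_nonneg
    rw [homogeneousConst, ← ofReal_homogeneous_constant hC hT k hκ hqr, eLpNorm_plancherel]
    have e := mul_rpow_mul_rpow_mul_rpow ‖f‖ₑ 1
      (ENNReal.ofReal (12 * (C * (2 : ℝ) ^ (3 * k) * √T)) ^ (1 / 2 : ℝ))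
      (ENNReal.ofReal (√(C * (2 : ℝ) ^ (3 * k)))) (α := 2 * (1 / r).toReal)
      (β := 4 * (1 / q).toReal) (κ := 1 - 2 * (1 / r).toReal - 4 * (1 / q).toReal)
      (by linarith) (by linarith) (by linarith) (by ring)
    rw [mul_one, ENNReal.one_rpow, one_mul] at e
    rw [← e, mul_comm ‖f‖ₑ, mul_comm ‖f‖ₑ]

/-- The retarded Strichartz estimate. -/
theorem exists_Lp_integral_Lam {φ : 𝓢(E3, ℝ)} {p : E3 → ℝ} {δ : ℝ} {k : ℤ} {C T : ℝ} (hC : 0 < C)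
    (h : IsDispersive (scaledPhase p δ) (scaledAmp (fun η => φ η ^ 2) k) (C * (2 : ℝ) ^ (3 * k)) T)
    {q r q₁ r₁ q₁' r₁' : ℝ≥0∞} [Fact (1 ≤ r)] [Fact (1 ≤ r₁')] [ENNReal.HolderConjugate r₁' r₁]
    (hr : 2 ≤ r) (hq : 4 ≤ q) (hqr : 4 * (1 / q).toReal ≤ 1 - 2 * (1 / r).toReal) (hr₁ : 2 ≤ r₁)
    (hr₁' : r₁' ≤ 2) (hq₁ : 4 ≤ q₁) (hq₁' : 1 / q₁ + 1 / q₁' = 1)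
    (hqr₁ : 1 - 2 * (1 / r₁).toReal = 4 * (1 / q₁).toReal)
    (F : Lp (Lp ℂ r₁' (volume : Measure E3)) q₁' (volume : Measure ℝ)) :
    ∃ U : Lp (Lp ℂ r (volume : Measure E3)) q (volume : Measure ℝ),
      (∀ᵐ t : ℝ, U t =ᵐ[volume] fun x => ∫ τ in Iic t, Lam φ p δ k (t - τ) (F τ) x) ∧
      ‖U‖ ≤ retardedConst C q r q₁ *
        (2 : ℝ) ^ (3 * k * (1 / 2 + 2 * (1 / q₁).toReal - (1 / r).toReal)) *
        T ^ ((1 / q).toReal + (1 / q₁).toReal) * ‖F‖ := by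
  have hT := h.T_pos
  have hC' := retardedConst_pos hC q r q₁
  obtain ⟨U, hU, hUn⟩ := h.exists_Lp_retarded hr₁ hq₁ hq₁' hqr₁ F hr hq hqr
  refine ⟨U, ?_, Lp_norm_le_of_enorm_le (by positivity) (hUn.trans_eq ?_)⟩
  · filter_upwards [hU] with t ht
    refine ht.trans (Filter.Eventually.of_forall fun x => ?_)
    refine setIntegral_congr_fun measurableSet_Iic fun τ _ => ?_
    exact (Lam_eq_pairing h Fact.out hr₁' (Lp.memLp (F τ)) (t - τ) x).symm
  · have hκ : 0 ≤ (1 / q).toReal := ENNReal.toReal_nonneg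
    have hθ : 0 ≤ (1 / r).toReal := ENNReal.toReal_nonneg
    rw [retardedConst, ← ofReal_retarded_constant hC hT k hθ hκ hqr ENNReal.toReal_nonneg
      ENNReal.toReal_nonneg hqr₁,
      mul_rpow_mul_rpow_mul_rpow _ _ _ _ (by linarith) (by linarith) (by linarith) (by ring)]

theorem integrableOn_Lam {φ : 𝓢(E3, ℝ)} {p : E3 → ℝ} {δ : ℝ} {k : ℤ} {N T : ℝ}
    (h : IsDispersive (scaledPhase p δ) (scaledAmp (fun η => φ η ^ 2) k) N T)
    {q₁ r₁ q₁' r₁' : ℝ≥0∞} [Fact (1 ≤ r₁')] [ENNReal.HolderConjugate r₁' r₁] (hr₁ : 2 ≤ r₁)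
    (hr₁' : r₁' ≤ 2) (hq₁ : 4 ≤ q₁) (hq₁' : 1 / q₁ + 1 / q₁' = 1)
    (hqr₁ : 1 - 2 * (1 / r₁).toReal = 4 * (1 / q₁).toReal)
    (F : Lp (Lp ℂ r₁' (volume : Measure E3)) q₁' (volume : Measure ℝ)) (t : ℝ) (x : E3) :
    IntegrableOn (fun τ => Lam φ p δ k (t - τ) (F τ) x) (Iic t) volume := by
  have hL : ∀ τ, Lam φ p δ k (t - τ) (F τ) x =
      pairing (scaledPhase p δ) (scaledAmp (fun η => φ η ^ 2) k) (F τ) (t - τ) x := fun τ =>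
    Lam_eq_pairing h Fact.out hr₁' (Lp.memLp (F τ)) (t - τ) x
  simp_rw [hL]
  exact (h.integrable_pairing hr₁ hq₁ hq₁' hqr₁ F t x).integrableOn

end RotatingEuler

end

theorem propositionp2 (γ : ℝ) (hγ : 1 < γ) (a : ℝ) (ha : a ≠ 0) (s : ℝ) (hs : s = 1 ∨ s = -1)
    (φ : 𝓢(E3, ℝ)) (hφ : IsCutoff φ)
    (q r q₁ r₁ q₁' r₁' : ℝ≥0∞) [Fact (1 ≤ r)] [Fact (1 ≤ r₁')]
    (hr : 2 ≤ r) (hr₁ : 2 ≤ r₁) (hq : 4 ≤ q)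
    (hqr : 2 / q ≤ 1 / 2 * (1 - 2 / r)) (hqr₁ : 2 / q₁ = 1 / 2 * (1 - 2 / r₁))
    (hr₁' : 1 / r₁ + 1 / r₁' = 1) (hq₁' : 1 / q₁ + 1 / q₁' = 1) :
    ∃ C : ℝ, 0 < C ∧ ∀ (ε δ : ℝ), 0 < ε → 0 < δ → ∀ k : ℤ,
      (∀ f : Lp ℂ 2 (volume : Measure E3),
        ∃ U : Lp (Lp ℂ r (volume : Measure E3)) q (volume : Measure ℝ),
          (∀ᵐ t : ℝ, U t =ᵐ[volume] Lam φ (phase a s (nu γ ε δ)) δ k t f) ∧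
          ‖U‖ ≤ C * (2 : ℝ) ^ (3 * k * (1 / 2 - (1 / r).toReal)) *
            (calM (nu γ ε δ) k * ε) ^ (1 / q).toReal * ‖f‖) ∧
      (∀ F : Lp (Lp ℂ r₁' (volume : Measure E3)) q₁' (volume : Measure ℝ),
        (∀ (t : ℝ) (x : E3), IntegrableOn
          (fun τ => Lam φ (phase a s (nu γ ε δ)) δ k (t - τ) (F τ) x) (Iic t) volume) ∧
        ∃ U : Lp (Lp ℂ r (volume : Measure E3)) q (volume : Measure ℝ),
          (∀ᵐ t : ℝ, U t =ᵐ[volume]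
            fun x => ∫ τ in Iic t, Lam φ (phase a s (nu γ ε δ)) δ k (t - τ) (F τ) x) ∧
          ‖U‖ ≤ C * (2 : ℝ) ^ (3 * k * (1 / 2 + 2 * (1 / q₁).toReal - (1 / r).toReal)) *
            (calM (nu γ ε δ) k * ε) ^ ((1 / q).toReal + (1 / q₁).toReal) * ‖F‖) := by
  obtain ⟨C₁, hC₁, hdisp⟩ := exists_isDispersive hγ ha hs hφ
  have hqr' := four_mul_toReal_le hr hqr
  have hpq := one_sub_two_mul_toReal_eq hr₁ hqr₁
  have hq₁ := four_le_of_two_div_eq hqr₁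
  have hr₁2 := conj_le_two hr₁ hr₁'
  have : ENNReal.HolderConjugate r₁' r₁ :=
    ⟨by rw [inv_one, add_comm, ← one_div, ← one_div, hr₁']⟩
  have hA := homogeneousConst_pos hC₁ q r
  have hB := retardedConst_pos hC₁ q r q₁
  -- Both constants depend only on the exponents and on the dispersive constant `C₁`, which was
  -- fixed before `ε`, `δ` and `k`; their sum serves both estimates.
  refine ⟨homogeneousConst C₁ q r + retardedConst C₁ q r q₁, add_pos hA hB, fun ε δ hε hδ k => ?_⟩
  have h := hdisp ε δ hε hδ k
  refine ⟨fun f => ?_, fun F => ⟨integrableOn_Lam h hr₁ hr₁2 hq₁ hq₁' hpq F, ?_⟩⟩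
  · obtain ⟨U, hU, hUn⟩ := exists_Lp_Lam hC₁ h hr hq hqr' f
    exact ⟨U, hU, le_mul_mul_mul_of_le hUn (le_add_of_nonneg_right hB.le)
      (Real.rpow_nonneg zero_le_two _) (Real.rpow_nonneg h.T_pos.le _) (norm_nonneg f)⟩
  · obtain ⟨U, hU, hUn⟩ := exists_Lp_integral_Lam hC₁ h hr hq hqr' hr₁ hr₁2 hq₁ hq₁' hpq F
    exact ⟨U, hU, le_mul_mul_mul_of_le hUn (le_add_of_nonneg_left hA.le)
      (Real.rpow_nonneg zero_le_two _) (Real.rpow_nonneg h.T_pos.le _) ENNReal.toReal_nonneg⟩
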